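/- Let $G$ be a Hausdorff locally compact group, $K\trianglelefteq G$ a compact normal subgroup, $H=G/K$, and suppose that the extension splits: there is a Borel measurable group homomorphism $\eta:H\to G$ which is a right inverse of the quotient map $G\to H$ (so that $G\cong K\rtimes H$). If $L^1(H)$ is symmetric, then $L^1(G)$ is symmetric. Moreover, $L^1(G)$ is symmetric if and only if $L^1(H)$ is symmetric. Here $L^1(G)$ is the Banach $^*$-algebra of (classes of) functions integrable for a left Haar measure, with product $(f*g)(x)=\int_G f(y)g(y^{-1}x)\,dy$ and involution $f^*(x)=\Delta(x^{-1})\overline{f(x^{-1})}$, $\Delta$ being the modular function; and a Banach $^*$-algebra $\mathfrak B$ is called symmetric if for every $b\in\mathfrak B$ the spectrum of $b^*b$ (taken in the unitization when $\mathfrak B$ has no unit) is contained in $[0,\infty)$. -/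

import Mathlib

set_option linter.unusedSectionVars false

namespace GroupAlgebraL1

open MeasureTheory MeasureTheory.Measure Topology
open scoped ENNReal NNReal ComplexConjugate Pointwise

variable {G : Type*} [Group G] [TopologicalSpace G] [IsTopologicalGroup G] [LocallyCompactSpace G]

lemma continuous_modular : Continuous (modularCharacterFun : G → ℝ≥0) := by
  borelize G
  set μ : Measure G := haar
  obtain ⟨⟨f, f_cont⟩, f_comp, f_nonneg, f_one⟩ :
    ∃ f : C(G, ℝ), HasCompactSupport f ∧ 0 ≤ f ∧ f 1 ≠ 0 := exists_continuous_nonneg_pos 1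
  have f_cont' : Continuous f := f_cont
  have f_comp' : HasCompactSupport f := f_comp
  have hpos : ∫ x, f x ∂μ ≠ 0 :=
    ne_of_gt (f_cont'.integral_pos_of_hasCompactSupport_nonneg_nonzero f_comp' f_nonneg f_one)
  have key : ∀ g : G, ((modularCharacterFun g : ℝ≥0) : ℝ) = (∫ x, f (x * g) ∂μ) / ∫ x, f x ∂μ := by
    intro g
    rw [modularCharacterFun_eq_haarScalarFactor μ g,
      haarScalarFactor_eq_integral_div _ _ f_cont' f_comp' hpos,
      integral_map (by fun_prop) f_cont'.aestronglyMeasurable]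
  refine NNReal.isEmbedding_coe.continuous_iff.2 ?_
  rw [show ((↑) : ℝ≥0 → ℝ) ∘ modularCharacterFun = _ from funext key]
  refine Continuous.div_const ?_ _
  refine continuous_iff_continuousAt.2 fun x₀ ↦ ?_
  obtain ⟨t, t_comp, ht⟩ : ∃ t, IsCompact t ∧ t ∈ 𝓝 x₀ := exists_compact_mem_nhds x₀
  have hk : IsCompact (tsupport f * t⁻¹) := f_comp'.isCompact.mul t_comp.inv
  have A : ContinuousOn (fun g : G ↦ ∫ y, f (y * g) ∂μ) t := by
    apply continuousOn_integral_of_compact_support hk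
    · exact (f_cont'.comp (continuous_snd.mul continuous_fst)).continuousOn
    · intro p x hp hx
      contrapose! hx
      exact ⟨x * p, subset_tsupport _ hx, p⁻¹, by simpa using hp, by simp⟩
  exact A.continuousAt ht

lemma modular_mul (x y : G) : modularCharacterFun (x * y) =
    modularCharacterFun x * modularCharacterFun y := modularCharacterFun_map_mul x y

lemma modular_inv_mul (x : G) : modularCharacterFun x⁻¹ * modularCharacterFun x = 1 := by
  rw [← modular_mul, inv_mul_cancel, modularCharacterFun_map_one]

variable [MeasurableSpace G] [BorelSpace G] (μ : Measure G) [IsHaarMeasure μ] [Regular μ]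

lemma map_mul_right (g : G) : map (· * g) μ = (modularCharacterFun g : ℝ≥0∞) • μ := by
  have : Regular (map (· * g) μ) := Regular.map (Homeomorph.mulRight g)
  rw [modularCharacterFun_eq_haarScalarFactor μ g]
  exact isMulLeftInvariant_eq_smul_of_regular _ μ

/-- The measure `A ↦ ∫_{A⁻¹} Δ(x) dx`. -/
noncomputable def invMeasure : Measure G :=
  (μ.withDensity fun x ↦ (modularCharacterFun x : ℝ≥0∞)).inv

lemma measurable_modular : Measurable fun x : G ↦ (modularCharacterFun x : ℝ≥0∞) :=
  (ENNReal.continuous_coe.comp continuous_modular).measurable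

instance : IsMulLeftInvariant (invMeasure μ) := by
  have : IsMulRightInvariant (μ.withDensity fun x ↦ (modularCharacterFun x : ℝ≥0∞)) := by
    refine ⟨fun g ↦ ?_⟩
    have hg : Measurable fun x : G ↦ x * g := (continuous_mul_const g).measurable
    have hne : (modularCharacterFun g : ℝ≥0∞) ≠ 0 := by
      simpa using (modularCharacterFun_pos g).ne'
    ext A hA
    rw [map_apply hg hA, withDensity_apply _ (hg hA), withDensity_apply _ hA,
      ← lintegral_indicator (hg hA), ← lintegral_indicator hA]
    set F : G → ℝ≥0∞ := A.indicator fun x ↦ (modularCharacterFun x : ℝ≥0∞) with hF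
    have hFm : Measurable F := measurable_modular.indicator hA
    have h1 : ∫⁻ x, F (x * g) ∂μ = (modularCharacterFun g : ℝ≥0∞) * ∫⁻ x, F x ∂μ := by
      rw [← lintegral_map hFm hg, map_mul_right, lintegral_smul_measure, smul_eq_mul]
    have h2 : ∀ x, F (x * g) = (modularCharacterFun g : ℝ≥0∞) *
        ((fun x ↦ x * g) ⁻¹' A).indicator (fun x ↦ (modularCharacterFun x : ℝ≥0∞)) x := by
      intro x
      by_cases hx : x * g ∈ A
      · simp [hF, hx, modular_mul, mul_comm]
      · simp [hF, hx]
    simp_rw [h2] at h1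
    rw [lintegral_const_mul _ (measurable_modular.indicator (hg hA))] at h1
    exact (ENNReal.mul_right_inj hne ENNReal.coe_ne_top).1 h1
  exact inv.instIsMulLeftInvariant

instance : IsHaarMeasure (invMeasure μ) where
  lt_top_of_isCompact K hK := by
    rw [invMeasure, inv_apply]
    obtain ⟨C, hC⟩ := (hK.inv.bddAbove_image (f := (modularCharacterFun : G → ℝ≥0)) 
      continuous_modular.continuousOn)
    calc (μ.withDensity fun x ↦ (modularCharacterFun x : ℝ≥0∞)) K⁻¹
        ≤ (μ.withDensity fun x ↦ (modularCharacterFun x : ℝ≥0∞)) (closure K⁻¹) :=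
          measure_mono subset_closure
      _ = ∫⁻ x in closure K⁻¹, (modularCharacterFun x : ℝ≥0∞) ∂μ :=
          withDensity_apply _ isClosed_closure.measurableSet
      _ ≤ ∫⁻ x in closure K⁻¹, (C : ℝ≥0∞) ∂μ := by
          refine setLIntegral_mono measurable_const fun x hx ↦ ?_
          have : closure K⁻¹ ⊆ {x | modularCharacterFun x ≤ C} := by
            refine closure_minimal (fun y hy ↦ hC ⟨y, hy, rfl⟩) ?_
            exact isClosed_le continuous_modular continuous_const
          exact_mod_cast this hx
      _ = C * μ (closure K⁻¹) := by simp
      _ < ∞ := ENNReal.mul_lt_top ENNReal.coe_lt_top hK.inv.closure.measure_lt_top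
  open_pos U hU hne h0 := by
    rw [invMeasure, inv_apply, withDensity_apply _ hU.inv.measurableSet,
      lintegral_eq_zero_iff measurable_modular] at h0
    have : μ U⁻¹ = 0 := by
      rw [← Measure.restrict_eq_zero, ← ae_eq_bot]
      rw [← Filter.empty_mem_iff_bot]
      filter_upwards [h0] with x hx
      have := modularCharacterFun_pos x
      simp at hx
      exact this.ne' hx
    exact hU.inv.measure_ne_zero μ hne.inv this

lemma haarScalarFactor_invMeasure : haarScalarFactor (invMeasure μ) μ = 1 := by
  obtain ⟨⟨f, f_cont⟩, f_comp, f_nonneg, f_one⟩ :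
    ∃ f : C(G, ℝ), HasCompactSupport f ∧ 0 ≤ f ∧ f 1 ≠ 0 := exists_continuous_nonneg_pos 1
  have f_cont' : Continuous f := f_cont
  have f_comp' : HasCompactSupport f := f_comp
  have hpos : 0 < ∫ x, f x ∂μ :=
    (f_cont'.integral_pos_of_hasCompactSupport_nonneg_nonzero f_comp' f_nonneg f_one)
  have key : ∀ h : G → ℝ, Continuous h → 
      ∫ x, h x ∂(invMeasure μ) = ∫ x, (modularCharacterFun x : ℝ) * h x⁻¹ ∂μ := by
    intro h hc
    rw [invMeasure, Measure.inv, integral_map measurable_inv.aemeasurable hc.aestronglyMeasurable]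
    rw [integral_withDensity_eq_integral_smul continuous_modular.measurable]
    rfl
  set c := haarScalarFactor (invMeasure μ) μ
  have hI : ∀ h : G → ℝ, Continuous h → HasCompactSupport h →
      ∫ x, h x ∂(invMeasure μ) = c * ∫ x, h x ∂μ := by
    intro h hc hs
    rw [integral_isMulLeftInvariant_eq_smul_of_hasCompactSupport (invMeasure μ) μ hc hs,
      integral_smul_nnreal_measure]
    rfl
  have hΔ : Continuous fun x : G ↦ (modularCharacterFun x : ℝ) :=
    NNReal.continuous_coe.comp continuous_modular
  have g_cont : Continuous fun x ↦ (modularCharacterFun x : ℝ) * f x⁻¹ := by fun_prop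
  have g_comp : HasCompactSupport fun x ↦ (modularCharacterFun x : ℝ) * f x⁻¹ :=
    HasCompactSupport.mul_left (f_comp'.comp_homeomorph (Homeomorph.inv G))
  have e1 := hI f f_cont' f_comp'
  have e2 := hI _ g_cont g_comp
  rw [key _ f_cont'] at e1
  rw [key _ g_cont, e1] at e2
  have e3 : ∀ x : G, (modularCharacterFun x : ℝ) * ((modularCharacterFun x⁻¹ : ℝ) * f x⁻¹⁻¹) = f x := by
    intro x
    have : (modularCharacterFun x⁻¹ : ℝ) * (modularCharacterFun x : ℝ) = 1 := 
      by exact_mod_cast modular_inv_mul x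
    rw [inv_inv, ← mul_assoc, mul_comm (modularCharacterFun x : ℝ), this, one_mul]
  simp_rw [e3] at e2
  have : ((c : ℝ) * c - 1) * ∫ x, f x ∂μ = 0 := by linear_combination -e2
  have h3 : (c : ℝ) * c - 1 = 0 := (mul_eq_zero.1 this).resolve_right hpos.ne'
  have : (c : ℝ) = 1 := by nlinarith [c.coe_nonneg]
  exact_mod_cast this

lemma invMeasure_le : invMeasure μ ≤ μ := by
  refine Measure.le_intro fun A hA _ ↦ ?_
  refine le_of_forall_gt fun r hr ↦ ?_
  obtain ⟨U, hAU, hU, hUr⟩ := OuterRegular.outerRegular hA r hr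
  refine lt_of_le_of_lt (measure_mono hAU) ?_
  rw [measure_isHaarMeasure_eq_smul_of_isOpen (invMeasure μ) μ hU, haarScalarFactor_invMeasure,
    one_smul]
  exact hUr

/-- Inversion preserves null sets of a Haar measure. -/
lemma quasiMeasurePreserving_inv : QuasiMeasurePreserving (fun x : G ↦ x⁻¹) μ μ := by
  refine ⟨measurable_inv, AbsolutelyContinuous.mk fun A hA h0 ↦ ?_⟩
  have h1 : invMeasure μ A = 0 := le_antisymm ((invMeasure_le μ A).trans h0.le) bot_le
  rw [map_apply measurable_inv hA]
  rw [invMeasure, inv_apply, withDensity_apply _ hA.inv,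
    lintegral_eq_zero_iff measurable_modular] at h1
  change μ A⁻¹ = 0
  rw [← Measure.restrict_eq_zero, ← ae_eq_bot, ← Filter.empty_mem_iff_bot]
  filter_upwards [h1] with x hx
  have := modularCharacterFun_pos x
  simp at hx
  exact this.ne' hx

lemma quasiMeasurePreserving_inv_mul (x : G) :
    QuasiMeasurePreserving (fun y : G ↦ y⁻¹ * x) μ μ := by
  have h : (fun y : G ↦ y⁻¹ * x) = (fun y ↦ y⁻¹) ∘ (fun y ↦ x⁻¹ * y) := by
    ext y; simp
  rw [h]
  exact (quasiMeasurePreserving_inv μ).comp (measurePreserving_mul_left μ x⁻¹).quasiMeasurePreserving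

/-- The involution `f*(x) = Δ(x⁻¹) conj(f(x⁻¹))`. Mathlib's modular character is
`g ↦ μ(A g⁻¹) / μ(A)`, that is `g ↦ Δ(g⁻¹)` for the usual `Δ(g) = μ(A g) / μ(A)`. -/
noncomputable def invol (f : G → ℂ) (x : G) : ℂ := ((modularCharacterFun x : ℝ) : ℂ) * conj (f x⁻¹)

variable {μ}

lemma integrable_invol {f : G → ℂ} (hf : Integrable f μ) : Integrable (invol f) μ := by
  have h1 : Integrable (fun x ↦ conj (f x)) (invMeasure μ) := 
    Complex.conjLIE.toContinuousLinearEquiv.toContinuousLinearMap.integrable_comp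
      (hf.mono_measure (invMeasure_le μ))
  have h2 := (integrable_map_measure (by exact h1.1) measurable_inv.aemeasurable).1 h1
  rw [integrable_withDensity_iff_integrable_smul continuous_modular.measurable] at h2
  refine h2.congr (Filter.Eventually.of_forall fun x ↦ ?_)
  simp [invol, NNReal.smul_def]


section Series

variable {X E ι : Type*} [MeasurableSpace X] {ν : Measure X} [NormedAddCommGroup E]
  [Countable ι]

lemma tsum_enorm_toL1_ne_top {F : ι → X → E} (hF : ∀ i, Integrable (F i) ν)
    (hs : Summable fun i ↦ ∫ x, ‖F i x‖ ∂ν) : ∑' i, ‖(hF i).toL1 (F i)‖ₑ ≠ ∞ := by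
  rw [tsum_enorm_ne_top_iff_summable_norm]
  refine hs.congr fun i ↦ ?_
  rw [L1.norm_of_fun_eq_integral_norm]

lemma ae_summable_norm {F : ι → X → E} (hF : ∀ i, Integrable (F i) ν)
    (hs : Summable fun i ↦ ∫ x, ‖F i x‖ ∂ν) : ∀ᵐ x ∂ν, Summable fun i ↦ ‖F i x‖ := by
  refine summable_norm_of_tsum_eLpNorm_ne_top le_rfl (fun i ↦ (hF i).1) ?_
  convert tsum_enorm_toL1_ne_top hF hs using 3 with i
  rw [Integrable.enorm_toL1, eLpNorm_one_eq_lintegral_enorm]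

lemma integrable_of_ae_hasSum [CompleteSpace E] {F : ι → X → E} (hF : ∀ i, Integrable (F i) ν)
    (hs : Summable fun i ↦ ∫ x, ‖F i x‖ ∂ν) {f : X → E}
    (hf : ∀ᵐ x ∂ν, HasSum (fun i ↦ F i x) (f x)) : Integrable f ν := by
  have h := Lp.hasSum_coeFn_tsum (tsum_enorm_toL1_ne_top hF hs)
  have h2 : ∀ᵐ x ∂ν, ∀ i, (hF i).toL1 (F i) x = F i x :=
    ae_all_iff.2 fun i ↦ (hF i).coeFn_toL1
  refine (L1.integrable_coeFn (∑' i, (hF i).toL1 (F i))).congr ?_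
  filter_upwards [h, h2, hf] with x hx h2x hfx
  simp only [h2x] at hx
  exact hx.unique hfx

end Series

/-- Compactly supported continuous functions are dense in `L¹`. -/
lemma exists_approx {f : G → ℂ} (hf : Integrable f μ) {ε : ℝ} (hε : 0 < ε) :
    ∃ g : G → ℂ, HasCompactSupport g ∧ ∫ x, ‖f x - g x‖ ∂μ ≤ ε ∧ Continuous g ∧
      Integrable g μ := by
  suffices H : ∃ g : G → ℂ, eLpNorm (f - g) 1 μ ≤ ENNReal.ofReal ε ∧
      (Continuous g ∧ HasCompactSupport g) by
    obtain ⟨g, hg, gc, gs⟩ := H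
    have gi : Integrable g μ := gc.integrable_of_hasCompactSupport gs
    refine ⟨g, gs, ?_, gc, gi⟩
    rw [eLpNorm_one_eq_lintegral_enorm] at hg
    change ∫ x, ‖(f - g) x‖ ∂μ ≤ ε
    rw [integral_norm_eq_lintegral_enorm (hf.sub gi).1]
    exact ENNReal.toReal_le_of_le_ofReal hε.le hg
  refine MemLp.induction_dense ENNReal.one_ne_top _ ?_ ?_ ?_ (memLp_one_iff_integrable.2 hf)
    (by simpa using hε)
  · intro c t ht htμ ε hε
    obtain ⟨η, η_pos, hη⟩ := exists_eLpNorm_indicator_le (μ := μ) ENNReal.one_ne_top c hε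
    have hη2 : ((η / 2 : ℝ≥0) : ℝ≥0∞) ≠ 0 := by
      simpa using (half_pos η_pos).ne'
    obtain ⟨s, st, s_compact, -, μs⟩ := ht.exists_isCompact_isClosed_sdiff_lt htμ.ne hη2
    obtain ⟨V, tV, V_open, -, hV⟩ := ht.exists_isOpen_sdiff_lt htμ.ne hη2
    obtain ⟨g, gs, gc, gV, gI⟩ :=
      exists_continuousMap_one_of_isCompact_subset_isOpen s_compact V_open (st.trans tV)
    refine ⟨fun x ↦ (g x : ℂ) * c, (eLpNorm_mono fun x ↦ ?_).trans (hη (V \ s) ?_), by fun_prop, ?_⟩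
    · have g1 : ‖(g x : ℂ)‖ ≤ 1 := by
        rw [Complex.norm_real, Real.norm_of_nonneg (gI x).1]; exact (gI x).2
      have g2 : ‖(g x : ℂ) - 1‖ ≤ 1 := by
        rw [← Complex.ofReal_one, ← Complex.ofReal_sub, Complex.norm_real, Real.norm_eq_abs,
          abs_le]
        constructor <;> linarith [(gI x).1, (gI x).2]
      by_cases hs : x ∈ s
      · simp [hs, st hs, gs hs]
      · by_cases hv : x ∈ V
        · rw [Set.indicator_of_mem (show x ∈ V \ s from ⟨hv, hs⟩)]
          by_cases h't : x ∈ t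
          · simp only [Pi.sub_apply, h't, Set.indicator_of_mem]
            calc ‖(g x : ℂ) * c - c‖ = ‖(g x : ℂ) - 1‖ * ‖c‖ := by rw [← norm_mul]; ring_nf
              _ ≤ 1 * ‖c‖ := by gcongr
              _ = ‖c‖ := one_mul _
          · simp only [Pi.sub_apply, h't, not_false_eq_true, Set.indicator_of_notMem, sub_zero,
              norm_mul]
            calc ‖(g x : ℂ)‖ * ‖c‖ ≤ 1 * ‖c‖ := by gcongr
              _ = ‖c‖ := one_mul _
        · have : g x = 0 := image_eq_zero_of_notMem_tsupport fun h ↦ hv (gV h)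
          have h't : x ∉ t := fun h ↦ hv (tV h)
          simp [this, h't]
    · calc μ (V \ s) ≤ μ (V \ t ∪ t \ s) := measure_mono fun x hx ↦ by
            by_cases h : x ∈ t
            · exact Or.inr ⟨h, hx.2⟩
            · exact Or.inl ⟨hx.1, h⟩
        _ ≤ μ (V \ t) + μ (t \ s) := measure_union_le _ _
        _ ≤ ((η / 2 : ℝ≥0) : ℝ≥0∞) + ((η / 2 : ℝ≥0) : ℝ≥0∞) := add_le_add hV.le μs.le
        _ = η := by rw [← ENNReal.coe_add, add_halves]
    · have : HasCompactSupport g := gc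
      exact (this.comp_left (g := fun r : ℝ ↦ (r : ℂ)) (by simp)).mul_right
  · rintro f g ⟨h1, h2⟩ ⟨h3, h4⟩
    exact ⟨h1.add h3, h2.add h4⟩
  · rintro f ⟨h1, h2⟩
    exact h1.aestronglyMeasurable

/-- An integrable function is an absolutely convergent series of compactly supported continuous
functions. -/
lemma exists_series {f : G → ℂ} (hf : Integrable f μ) :
    ∃ u : ℕ → G → ℂ, (∀ n, Continuous (u n)) ∧ (∀ n, HasCompactSupport (u n)) ∧
      (Summable fun n ↦ ∫ x, ‖u n x‖ ∂μ) ∧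
      ∀ᵐ x ∂μ, (Summable fun n ↦ ‖u n x‖) ∧ HasSum (fun n ↦ u n x) (f x) := by
  have h := fun n : ℕ ↦ exists_approx hf
    (ε := (1 / 2 : ℝ) ^ n) (by positivity)
  choose g gs gle gc gi using h
  have hgeo : Summable fun n : ℕ ↦ (1 / 2 : ℝ) ^ n := summable_geometric_two
  set d : ℕ → G → ℂ := fun n x ↦ f x - g n x with hd
  have di : ∀ n, Integrable (d n) μ := fun n ↦ hf.sub (gi n)
  have ds : Summable fun n ↦ ∫ x, ‖d n x‖ ∂μ :=
    hgeo.of_nonneg_of_le (fun n ↦ integral_nonneg fun x ↦ norm_nonneg _) gle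
  set u : ℕ → G → ℂ := fun n ↦ n.casesOn (g 0) (fun m x ↦ g (m + 1) x - g m x) with hu
  have ui : ∀ n, Integrable (u n) μ := by
    rintro (_ | n)
    · exact gi 0
    · exact (gi (n + 1)).sub (gi n)
  have us : Summable fun n ↦ ∫ x, ‖u n x‖ ∂μ := by
    rw [← summable_nat_add_iff 1]
    refine (ds.add ((summable_nat_add_iff 1).2 ds)).of_nonneg_of_le
      (fun n ↦ integral_nonneg fun x ↦ norm_nonneg _) fun n ↦ ?_
    rw [← integral_add (di n).norm (di (n + 1)).norm]
    refine integral_mono (ui (n + 1)).norm ((di n).norm.add (di (n + 1)).norm) fun x ↦ ?_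
    have : g (n + 1) x - g n x = d n x - d (n + 1) x := by simp [hd]
    change ‖g (n + 1) x - g n x‖ ≤ ‖d n x‖ + ‖d (n + 1) x‖
    rw [this]
    exact norm_sub_le _ _
  refine ⟨u, ?_, ?_, us, ?_⟩
  · rintro (_ | n)
    · exact gc 0
    · exact (gc (n + 1)).sub (gc n)
  · rintro (_ | n)
    · exact gs 0
    · exact (gs (n + 1)).sub (gs n)
  · filter_upwards [ae_summable_norm ui us, ae_summable_norm di ds] with x hux hdx
    refine ⟨hux, ?_⟩
    rw [hux.of_norm.hasSum_iff_tendsto_nat, ← Filter.tendsto_add_atTop_iff_nat 1]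
    have e : ∀ n, ∑ i ∈ Finset.range (n + 1), u i x = f x - d n x := by
      intro n
      induction n with
      | zero => simp [hu, hd]
      | succ n ih => rw [Finset.sum_range_succ, ih]; simp [hu, hd]
    simp_rw [e]
    simpa using (tendsto_const_nhds (x := f x)).sub hdx.of_norm.tendsto_atTop_zero

variable (μ) in
/-- The convolution `(f * g)(x) = ∫ f(y) g(y⁻¹x) dy`. -/
noncomputable def convFun (f g : G → ℂ) (x : G) : ℂ := ∫ y, f y * g (y⁻¹ * x) ∂μ

lemma conv_congr {f f' g g' : G → ℂ} (hf : f =ᵐ[μ] f') (hg : g =ᵐ[μ] g') :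
    convFun μ f g = convFun μ f' g' := by
  ext x
  refine integral_congr_ae ?_
  filter_upwards [hf, (quasiMeasurePreserving_inv_mul μ x).ae_eq_comp hg] with y h1 h2
  simp only [Function.comp_apply] at h2
  rw [h1, h2]

section CompactSupport

variable {u v w : G → ℂ}

lemma hasCompactSupport_uncurry (su : HasCompactSupport u) (sv : HasCompactSupport v) :
    HasCompactSupport (Function.uncurry fun x y : G ↦ u y * v (y⁻¹ * x)) := by
  refine HasCompactSupport.intro
    (K := (fun p : G × G ↦ (p.1 * p.2, p.1)) '' (tsupport u ×ˢ tsupport v))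
    ((su.isCompact.prod sv.isCompact).image (by fun_prop)) ?_
  rintro ⟨x, y⟩ hxy
  contrapose! hxy
  simp only [Function.uncurry_apply_pair, ne_eq, mul_eq_zero, not_or] at hxy
  exact ⟨(y, y⁻¹ * x), ⟨subset_tsupport _ hxy.1, subset_tsupport _ hxy.2⟩, by simp⟩

lemma exists_compact_conv (su : HasCompactSupport u) (sv : HasCompactSupport v) : ∃ K : Set G, IsCompact K ∧ ∀ x ∉ K, ∀ y, u y * v (y⁻¹ * x) = 0 := by
  refine ⟨_, (su.isCompact.mul sv.isCompact), fun x hx y ↦ ?_⟩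
  contrapose! hx
  simp only [ne_eq, mul_eq_zero, not_or] at hx
  exact ⟨y, subset_tsupport _ hx.1, y⁻¹ * x, subset_tsupport _ hx.2, by simp⟩

lemma hasCompactSupport_conv (su : HasCompactSupport u) (sv : HasCompactSupport v) : HasCompactSupport (convFun μ u v) := by
  obtain ⟨K, hK, h⟩ := exists_compact_conv su sv
  exact HasCompactSupport.intro hK fun x hx ↦ by simp [convFun, h x hx]

lemma integrable_conv_integrand (hu : Continuous u) (hv : Continuous v) (su : HasCompactSupport u) (x : G) : Integrable (fun y ↦ u y * v (y⁻¹ * x)) μ := by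
  refine Continuous.integrable_of_hasCompactSupport (by fun_prop) ?_
  exact su.mul_right

lemma continuous_conv (hu : Continuous u) (hv : Continuous v) (su : HasCompactSupport u) : Continuous (convFun μ u v) := by
  refine continuousOn_univ.1 (continuousOn_integral_of_compact_support su.isCompact ?_ ?_)
  · exact Continuous.continuousOn (by unfold Function.uncurry; fun_prop)
  · intro p x _ hx
    simp [image_eq_zero_of_notMem_tsupport hx]

lemma integral_conv_cc (hu : Continuous u) (hv : Continuous v) (su : HasCompactSupport u) (sv : HasCompactSupport v) : ∫ x, convFun μ u v x ∂μ = (∫ x, u x ∂μ) * ∫ x, v x ∂μ := by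
  unfold convFun
  rw [integral_integral_swap_of_hasCompactSupport (by unfold Function.uncurry; fun_prop)
    (hasCompactSupport_uncurry su sv)]
  simp_rw [integral_const_mul, integral_mul_left_eq_self (μ := μ) v, integral_mul_const]

lemma conv_assoc_cc (hu : Continuous u) (hv : Continuous v) (hw : Continuous w) (su : HasCompactSupport u) (sv : HasCompactSupport v) : convFun μ (convFun μ u v) w = convFun μ u (convFun μ v w) := by
  ext x
  have h1 : ∀ y, convFun μ u v y * w (y⁻¹ * x) = ∫ z, u z * v (z⁻¹ * y) * w (y⁻¹ * x) ∂μ :=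
    fun y ↦ (integral_mul_const _ _).symm
  have h2 : ∀ z, u z * convFun μ v w (z⁻¹ * x) = ∫ y, u z * v (z⁻¹ * y) * w (y⁻¹ * x) ∂μ := by
    intro z
    rw [convFun, ← integral_const_mul, ← integral_mul_left_eq_self _ z⁻¹]
    congr with y
    simp [mul_assoc]
  change ∫ y, convFun μ u v y * w (y⁻¹ * x) ∂μ = ∫ z, u z * convFun μ v w (z⁻¹ * x) ∂μ
  simp_rw [h1, h2]
  refine integral_integral_swap_of_hasCompactSupport (by unfold Function.uncurry; fun_prop) ?_
  exact (hasCompactSupport_uncurry su sv).mul_right (f' := fun p : G × G ↦ w (p.1⁻¹ * x))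

end CompactSupport

lemma hasSum_mul_aux {a b : ℕ → ℂ} {s t : ℂ} (ha : Summable fun n ↦ ‖a n‖) (hs : HasSum a s)
    (hb : Summable fun n ↦ ‖b n‖) (ht : HasSum b t) :
    HasSum (fun p : ℕ × ℕ ↦ a p.1 * b p.2) (s * t) :=
  hs.mul ht (summable_mul_of_summable_norm ha hb)

/-- The integrated absolute value of the integrand of a convolution. -/
lemma conv_norm_cc {u v : G → ℂ} (hu : Continuous u) (hv : Continuous v)
    (su : HasCompactSupport u) (sv : HasCompactSupport v) :
    Integrable (fun x ↦ ∫ y, ‖u y * v (y⁻¹ * x)‖ ∂μ) μ ∧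
      ∫ x, ∫ y, ‖u y * v (y⁻¹ * x)‖ ∂μ ∂μ = (∫ x, ‖u x‖ ∂μ) * ∫ x, ‖v x‖ ∂μ := by
  have nc : ∀ {w : G → ℂ}, Continuous w → Continuous fun x ↦ ((‖w x‖ : ℝ) : ℂ) :=
    fun h ↦ by fun_prop
  have ns : ∀ {w : G → ℂ}, HasCompactSupport w → HasCompactSupport fun x ↦ ((‖w x‖ : ℝ) : ℂ) :=
    fun h ↦ h.comp_left (g := fun z : ℂ ↦ ((‖z‖ : ℝ) : ℂ)) (by simp)
  have e : ∀ x, convFun μ (fun x ↦ ((‖u x‖ : ℝ) : ℂ)) (fun x ↦ ((‖v x‖ : ℝ) : ℂ)) x =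
      ((∫ y, ‖u y * v (y⁻¹ * x)‖ ∂μ : ℝ) : ℂ) := by
    intro x
    rw [← integral_complex_ofReal]
    simp [convFun]
  have h := integral_conv_cc (μ := μ) (nc hu) (nc hv) (ns su) (ns sv)
  have hi : Integrable (convFun μ (fun x ↦ ((‖u x‖ : ℝ) : ℂ)) (fun x ↦ ((‖v x‖ : ℝ) : ℂ))) μ :=
    (continuous_conv (nc hu) (nc hv) (ns su)).integrable_of_hasCompactSupport
      (hasCompactSupport_conv (ns su) (ns sv))
  refine ⟨hi.re.congr (Filter.Eventually.of_forall fun x ↦ by simp [e x]), ?_⟩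
  rw [integral_congr_ae (Filter.Eventually.of_forall e)] at h
  simp only [integral_complex_ofReal] at h
  exact_mod_cast h

lemma conv_series {f g : G → ℂ} {u v : ℕ → G → ℂ} (uc : ∀ n, Continuous (u n))
    (us : ∀ n, HasCompactSupport (u n)) (usum : Summable fun n ↦ ∫ x, ‖u n x‖ ∂μ)
    (uf : ∀ᵐ x ∂μ, (Summable fun n ↦ ‖u n x‖) ∧ HasSum (fun n ↦ u n x) (f x))
    (vc : ∀ n, Continuous (v n))
    (vs : ∀ n, HasCompactSupport (v n)) (vsum : Summable fun n ↦ ∫ x, ‖v n x‖ ∂μ)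
    (vg : ∀ᵐ x ∂μ, (Summable fun n ↦ ‖v n x‖) ∧ HasSum (fun n ↦ v n x) (g x)) :
    (∀ᵐ x ∂μ, Integrable (fun y ↦ f y * g (y⁻¹ * x)) μ ∧
      HasSum (fun p : ℕ × ℕ ↦ convFun μ (u p.1) (v p.2) x) (convFun μ f g x)) ∧
    Summable fun p : ℕ × ℕ ↦ ∫ x, ‖convFun μ (u p.1) (v p.2) x‖ ∂μ := by
  have hB := fun p : ℕ × ℕ ↦ conv_norm_cc (μ := μ) (uc p.1) (vc p.2) (us p.1) (vs p.2)
  have Bnn : ∀ (p : ℕ × ℕ) x, 0 ≤ ∫ y, ‖u p.1 y * v p.2 (y⁻¹ * x)‖ ∂μ :=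
    fun p x ↦ integral_nonneg fun y ↦ norm_nonneg _
  have Bsum : Summable fun p : ℕ × ℕ ↦ ∫ x, ∫ y, ‖u p.1 y * v p.2 (y⁻¹ * x)‖ ∂μ ∂μ := by
    refine Summable.congr (usum.mul_of_nonneg vsum (fun n ↦ integral_nonneg fun x ↦ norm_nonneg _)
      (fun n ↦ integral_nonneg fun x ↦ norm_nonneg _)) fun p ↦ ((hB p).2).symm
  constructor
  · have hae : ∀ᵐ x ∂μ, Summable fun p : ℕ × ℕ ↦ ∫ y, ‖u p.1 y * v p.2 (y⁻¹ * x)‖ ∂μ := by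
      have h := ae_summable_norm (fun p ↦ (hB p).1) (by
        refine Bsum.congr fun p ↦ ?_
        refine integral_congr_ae (Filter.Eventually.of_forall fun x ↦ ?_)
        exact (Real.norm_of_nonneg (Bnn p x)).symm)
      filter_upwards [h] with x hx
      exact hx.congr fun p ↦ Real.norm_of_nonneg (Bnn p x)
    filter_upwards [hae] with x hx
    have pw : ∀ᵐ y ∂μ,
        HasSum (fun p : ℕ × ℕ ↦ u p.1 y * v p.2 (y⁻¹ * x)) (f y * g (y⁻¹ * x)) := by
      filter_upwards [uf, (quasiMeasurePreserving_inv_mul μ x).ae vg] with y h1 h2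
      exact hasSum_mul_aux (a := fun n ↦ u n y) (b := fun n ↦ v n (y⁻¹ * x)) h1.1 h1.2 h2.1 h2.2
    have hi := fun p : ℕ × ℕ ↦
      integrable_conv_integrand (μ := μ) (uc p.1) (vc p.2) (us p.1) x
    refine ⟨integrable_of_ae_hasSum hi hx pw, ?_⟩
    have := hasSum_integral_of_summable_integral_norm hi hx
    rwa [integral_congr_ae (pw.mono fun y hy ↦ hy.tsum_eq)] at this
  · refine Bsum.of_nonneg_of_le (fun p ↦ integral_nonneg fun x ↦ norm_nonneg _) fun p ↦ ?_
    refine integral_mono ?_ (hB p).1 fun x ↦ norm_integral_le_integral_norm _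
    exact ((continuous_conv (uc _) (vc _) (us _)).integrable_of_hasCompactSupport
      (hasCompactSupport_conv (us _) (vs _))).norm

/-- For integrable `f`, `g`, the convolution integral converges absolutely almost everywhere and
defines an integrable function. -/
lemma conv_aux {f g : G → ℂ} (hf : Integrable f μ) (hg : Integrable g μ) :
    (∀ᵐ x ∂μ, Integrable (fun y ↦ f y * g (y⁻¹ * x)) μ) ∧ Integrable (convFun μ f g) μ ∧
      ∫ x, convFun μ f g x ∂μ = (∫ x, f x ∂μ) * ∫ x, g x ∂μ := by
  obtain ⟨u, uc, us, usum, uf⟩ := exists_series hf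
  obtain ⟨v, vc, vs, vsum, vg⟩ := exists_series hg
  obtain ⟨key, Csum⟩ := conv_series uc us usum uf vc vs vsum vg
  have Ci := fun p : ℕ × ℕ ↦
    (continuous_conv (μ := μ) (uc p.1) (vc p.2) (us p.1)).integrable_of_hasCompactSupport
      (μ := μ) (hasCompactSupport_conv (us p.1) (vs p.2))
  refine ⟨key.mono fun x hx ↦ hx.1,
    integrable_of_ae_hasSum Ci Csum (key.mono fun x hx ↦ hx.2), ?_⟩
  have h1 := hasSum_integral_of_summable_integral_norm Ci Csum
  rw [integral_congr_ae (key.mono fun x hx ↦ hx.2.tsum_eq)] at h1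
  have e : ∀ p : ℕ × ℕ, ∫ x, convFun μ (u p.1) (v p.2) x ∂μ =
      (∫ x, u p.1 x ∂μ) * ∫ x, v p.2 x ∂μ := fun p ↦
    integral_conv_cc (uc p.1) (vc p.2) (us p.1) (vs p.2)
  rw [funext e] at h1
  have ui : ∀ n, Integrable (u n) μ := fun n ↦ (uc n).integrable_of_hasCompactSupport (us n)
  have vi : ∀ n, Integrable (v n) μ := fun n ↦ (vc n).integrable_of_hasCompactSupport (vs n)
  have hU := hasSum_integral_of_summable_integral_norm ui usum
  have hV := hasSum_integral_of_summable_integral_norm vi vsum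
  rw [integral_congr_ae (uf.mono fun x hx ↦ hx.2.tsum_eq)] at hU
  rw [integral_congr_ae (vg.mono fun x hx ↦ hx.2.tsum_eq)] at hV
  have h2 : HasSum (fun p : ℕ × ℕ ↦ (∫ x, u p.1 x ∂μ) * ∫ x, v p.2 x ∂μ)
      ((∫ x, f x ∂μ) * ∫ x, g x ∂μ) :=
    HasSum.mul (f := fun n ↦ ∫ x, u n x ∂μ) (g := fun n ↦ ∫ x, v n x ∂μ) hU hV h1.summable
  exact h1.unique h2

lemma integrable_conv {f g : G → ℂ} (hf : Integrable f μ) (hg : Integrable g μ) :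
    Integrable (convFun μ f g) μ := (conv_aux hf hg).2.1

lemma integral_norm_conv_le {f g : G → ℂ} (hf : Integrable f μ) (hg : Integrable g μ) :
    ∫ x, ‖convFun μ f g x‖ ∂μ ≤ (∫ x, ‖f x‖ ∂μ) * ∫ x, ‖g x‖ ∂μ := by
  have hf' : Integrable (fun x ↦ ((‖f x‖ : ℝ) : ℂ)) μ := hf.norm.ofReal
  have hg' : Integrable (fun x ↦ ((‖g x‖ : ℝ) : ℂ)) μ := hg.norm.ofReal
  have h := (conv_aux hf' hg').2.2
  have hi := (conv_aux hf' hg').2.1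
  have e : ∀ x, convFun μ (fun x ↦ ((‖f x‖ : ℝ) : ℂ)) (fun x ↦ ((‖g x‖ : ℝ) : ℂ)) x =
      ((∫ y, ‖f y * g (y⁻¹ * x)‖ ∂μ : ℝ) : ℂ) := by
    intro x
    rw [← integral_complex_ofReal]
    simp [convFun]
  rw [integral_congr_ae (Filter.Eventually.of_forall e)] at h
  simp only [integral_complex_ofReal] at h
  have h' : ∫ x, ∫ y, ‖f y * g (y⁻¹ * x)‖ ∂μ ∂μ = (∫ x, ‖f x‖ ∂μ) * ∫ x, ‖g x‖ ∂μ := by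
    exact_mod_cast h
  rw [← h']
  refine integral_mono (conv_aux hf hg).2.1.norm ?_ fun x ↦ norm_integral_le_integral_norm _
  refine hi.re.congr (Filter.Eventually.of_forall fun x ↦ ?_)
  simp [e x]

lemma conv_add_right {f g h : G → ℂ} (hf : Integrable f μ) (hg : Integrable g μ)
    (hh : Integrable h μ) : convFun μ f (g + h) =ᵐ[μ] convFun μ f g + convFun μ f h := by
  filter_upwards [(conv_aux hf hg).1, (conv_aux hf hh).1] with x h1 h2
  simp only [convFun, Pi.add_apply, mul_add]
  exact integral_add h1 h2

lemma conv_add_left {f g h : G → ℂ} (hf : Integrable f μ) (hg : Integrable g μ)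
    (hh : Integrable h μ) : convFun μ (f + g) h =ᵐ[μ] convFun μ f h + convFun μ g h := by
  filter_upwards [(conv_aux hf hh).1, (conv_aux hg hh).1] with x h1 h2
  simp only [convFun, Pi.add_apply, add_mul]
  exact integral_add h1 h2

lemma conv_const_smul_left (c : ℂ) (f g : G → ℂ) : convFun μ (c • f) g = c • convFun μ f g := by
  ext x
  simp only [convFun, Pi.smul_apply, smul_eq_mul, mul_assoc]
  exact integral_const_mul _ _

lemma conv_const_smul_right (c : ℂ) (f g : G → ℂ) : convFun μ f (c • g) = c • convFun μ f g := by
  ext x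
  simp only [convFun, Pi.smul_apply, smul_eq_mul, mul_left_comm _ c]
  exact integral_const_mul _ _

lemma invol_invol (f : G → ℂ) : invol (invol f) = f := by
  ext x
  have : ((modularCharacterFun x⁻¹ : ℝ) : ℂ) * ((modularCharacterFun x : ℝ) : ℂ) = 1 := by
    exact_mod_cast modular_inv_mul x
  simp only [invol, map_mul, Complex.conj_ofReal, Complex.conj_conj, inv_inv]
  rw [← mul_assoc, mul_comm ((modularCharacterFun x : ℝ) : ℂ), this, one_mul]

lemma invol_conv (f g : G → ℂ) : invol (convFun μ f g) = convFun μ (invol g) (invol f) := by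
  ext x
  simp only [invol, convFun]
  rw [← integral_conj, ← integral_const_mul, ← integral_mul_left_eq_self _ x⁻¹]
  congr with y
  have h : ((modularCharacterFun x : ℝ) : ℂ) =
      ((modularCharacterFun y : ℝ) : ℂ) * ((modularCharacterFun (y⁻¹ * x) : ℝ) : ℂ) := by
    rw [← Complex.ofReal_mul, ← NNReal.coe_mul, ← modular_mul, mul_inv_cancel_left]
  rw [h]
  simp only [map_mul, mul_inv_rev, inv_inv, mul_inv_cancel_right]
  ring_nf

lemma invol_congr {f f' : G → ℂ} (h : f =ᵐ[μ] f') : invol f =ᵐ[μ] invol f' := by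
  filter_upwards [(quasiMeasurePreserving_inv μ).ae_eq_comp h] with x hx
  simp only [Function.comp_apply] at hx
  simp [invol, hx]

lemma integral_norm_invol_le {f : G → ℂ} (hf : Integrable f μ) :
    ∫ x, ‖invol f x‖ ∂μ ≤ ∫ x, ‖f x‖ ∂μ := by
  have e : ∫ x, ‖invol f x‖ ∂μ = ∫ x, ‖f x‖ ∂(invMeasure μ) := by
    have hm : AEStronglyMeasurable (fun x ↦ ‖f x‖) (invMeasure μ) :=
      (hf.mono_measure (invMeasure_le μ)).norm.1
    rw [invMeasure, Measure.inv] at hm ⊢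
    rw [integral_map measurable_inv.aemeasurable hm,
      integral_withDensity_eq_integral_smul continuous_modular.measurable]
    congr with x
    simp [invol, NNReal.smul_def]
  rw [e]
  exact integral_mono_measure (invMeasure_le μ)
    (Filter.Eventually.of_forall fun x ↦ norm_nonneg _) hf.norm

end GroupAlgebraL1

/-- The space `L¹(G)` of (classes of) complex functions integrable for the Haar measure `μ`,
as the carrier of the convolution `*`-algebra. -/
def GroupL1 {G : Type*} [MeasurableSpace G] (μ : MeasureTheory.Measure G) : Type _ :=
  MeasureTheory.Lp ℂ 1 μ

namespace GroupL1

open MeasureTheory MeasureTheory.Measure GroupAlgebraL1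

section Basic

variable {G : Type*} [MeasurableSpace G] {μ : Measure G}

noncomputable instance : NormedAddCommGroup (GroupL1 μ) :=
  inferInstanceAs (NormedAddCommGroup (Lp ℂ 1 μ))

noncomputable instance : NormedSpace ℂ (GroupL1 μ) :=
  inferInstanceAs (NormedSpace ℂ (Lp ℂ 1 μ))

instance : CompleteSpace (GroupL1 μ) := inferInstanceAs (CompleteSpace (Lp ℂ 1 μ))

/-- The underlying element of Mathlib's `Lp` space. -/
def toLp (f : GroupL1 μ) : Lp ℂ 1 μ := f

noncomputable instance : CoeFun (GroupL1 μ) (fun _ ↦ G → ℂ) := ⟨fun f ↦ (f.toLp : G → ℂ)⟩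

lemma integrable (f : GroupL1 μ) : Integrable f μ := L1.integrable_coeFn _

/-- The class of an integrable function. -/
noncomputable def mk (f : G → ℂ) (hf : Integrable f μ) : GroupL1 μ := hf.toL1 f

lemma coeFn_mk {f : G → ℂ} (hf : Integrable f μ) : mk f hf =ᵐ[μ] f := hf.coeFn_toL1

lemma ext {f g : GroupL1 μ} (h : f =ᵐ[μ] g) : f = g := Lp.ext h

lemma coeFn_add (f g : GroupL1 μ) : (f + g : GroupL1 μ) =ᵐ[μ] (f : G → ℂ) + g := Lp.coeFn_add _ _

lemma coeFn_smul (c : ℂ) (f : GroupL1 μ) : (c • f : GroupL1 μ) =ᵐ[μ] c • (f : G → ℂ) :=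
  Lp.coeFn_smul _ _

lemma norm_eq (f : GroupL1 μ) : ‖f‖ = ∫ x, ‖f x‖ ∂μ := L1.norm_eq_integral_norm _

end Basic

variable {G : Type*} [Group G] [TopologicalSpace G] [IsTopologicalGroup G] [LocallyCompactSpace G]
  [MeasurableSpace G] [BorelSpace G] {μ : Measure G} [IsHaarMeasure μ] [Regular μ]

/-- The product is convolution, `(f * g)(x) = ∫ f(y) g(y⁻¹x) dy`. -/
noncomputable instance : Mul (GroupL1 μ) :=
  ⟨fun f g ↦ mk (convFun μ f g) (integrable_conv f.integrable g.integrable)⟩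

/-- The involution is `f*(x) = Δ(x⁻¹) conj(f(x⁻¹))`. -/
noncomputable instance : Star (GroupL1 μ) :=
  ⟨fun f ↦ mk (invol f) (integrable_invol f.integrable)⟩

lemma coeFn_mul (f g : GroupL1 μ) : (f * g : GroupL1 μ) =ᵐ[μ] convFun μ f g := coeFn_mk _

lemma coeFn_star (f : GroupL1 μ) : (star f : GroupL1 μ) =ᵐ[μ] invol f := coeFn_mk _

lemma norm_mul_le' (f g : GroupL1 μ) : ‖f * g‖ ≤ ‖f‖ * ‖g‖ := by
  rw [norm_eq, norm_eq, norm_eq]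
  exact (integral_congr_ae ((coeFn_mul f g).fun_comp (‖·‖))).trans_le
    (integral_norm_conv_le f.integrable g.integrable)

lemma mul_add' (f g h : GroupL1 μ) : f * (g + h) = f * g + f * h := by
  refine ext ((coeFn_mul _ _).trans ?_)
  rw [conv_congr (.refl _ _) (coeFn_add g h)]
  refine (conv_add_right f.integrable g.integrable h.integrable).trans ?_
  exact ((coeFn_mul _ _).symm.add (coeFn_mul _ _).symm).trans (coeFn_add _ _).symm

lemma add_mul' (f g h : GroupL1 μ) : (f + g) * h = f * h + g * h := by
  refine ext ((coeFn_mul _ _).trans ?_)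
  rw [conv_congr (coeFn_add f g) (.refl _ _)]
  refine (conv_add_left f.integrable g.integrable h.integrable).trans ?_
  exact ((coeFn_mul _ _).symm.add (coeFn_mul _ _).symm).trans (coeFn_add _ _).symm

lemma smul_mul' (c : ℂ) (f g : GroupL1 μ) : (c • f) * g = c • (f * g) := by
  refine ext ((coeFn_mul _ _).trans ?_)
  rw [conv_congr (coeFn_smul c f) (.refl _ _), conv_const_smul_left]
  exact ((coeFn_mul _ _).symm.const_smul c).trans (coeFn_smul _ _).symm

lemma mul_smul' (c : ℂ) (f g : GroupL1 μ) : f * (c • g) = c • (f * g) := by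
  refine ext ((coeFn_mul _ _).trans ?_)
  rw [conv_congr (.refl _ _) (coeFn_smul c g), conv_const_smul_right]
  exact ((coeFn_mul _ _).symm.const_smul c).trans (coeFn_smul _ _).symm

lemma continuous_mul' : Continuous fun p : GroupL1 μ × GroupL1 μ ↦ p.1 * p.2 := by
  let B : GroupL1 μ →L[ℂ] GroupL1 μ →L[ℂ] GroupL1 μ :=
    LinearMap.mkContinuous₂ (LinearMap.mk₂ ℂ (fun f g ↦ f * g) add_mul' smul_mul'
      mul_add' mul_smul') 1 fun f g ↦ by simpa using norm_mul_le' f g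
  exact B.continuous₂

lemma mk_mul_mk {f g : G → ℂ} (hf : Integrable f μ) (hg : Integrable g μ) :
    mk f hf * mk g hg = mk (convFun μ f g) (integrable_conv hf hg) := by
  refine ext ((coeFn_mul _ _).trans ?_)
  rw [conv_congr (coeFn_mk hf) (coeFn_mk hg)]
  exact (coeFn_mk _).symm

lemma mul_assoc' (f g h : GroupL1 μ) : f * g * h = f * (g * h) := by
  have hi : ∀ u : {u : G → ℂ // Continuous u ∧ HasCompactSupport u}, Integrable u.1 μ :=
    fun u ↦ u.2.1.integrable_of_hasCompactSupport u.2.2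
  have hd : DenseRange fun u : {u : G → ℂ // Continuous u ∧ HasCompactSupport u} ↦
      mk u.1 (hi u) := by
    refine Metric.denseRange_iff.2 fun f r hr ↦ ?_
    obtain ⟨g, gs, hg, gc, gi⟩ := exists_approx f.integrable (half_pos hr)
    refine ⟨⟨g, gc, gs⟩, ?_⟩
    rw [dist_eq_norm, norm_eq]
    refine lt_of_le_of_lt (le_of_eq_of_le (integral_congr_ae ?_) hg) (half_lt_self hr)
    have h1 : (f - mk g gi : GroupL1 μ) =ᵐ[μ] (f : G → ℂ) - mk g gi := Lp.coeFn_sub _ _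
    filter_upwards [h1, coeFn_mk gi] with x h1 h2
    rw [h1, Pi.sub_apply, h2]
  refine hd.induction_on₃ (p := fun f g h : GroupL1 μ ↦ f * g * h = f * (g * h)) ?_ ?_ f g h
  · have c := continuous_mul' (μ := μ)
    refine isClosed_eq ?_ ?_
    · exact c.comp ((c.comp (continuous_fst.prodMk (continuous_fst.comp continuous_snd))).prodMk
        (continuous_snd.comp continuous_snd))
    · exact c.comp (continuous_fst.prodMk (c.comp continuous_snd))
  · rintro ⟨u, uc, us⟩ ⟨v, vc, vs⟩ ⟨w, wc, ws⟩
    simp only [mk_mul_mk]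
    congr 1
    exact conv_assoc_cc uc vc wc us vs

noncomputable instance : NonUnitalNormedRing (GroupL1 μ) where
  __ := (inferInstance : NormedAddCommGroup (GroupL1 μ))
  left_distrib := mul_add'
  right_distrib := add_mul'
  zero_mul f := by simpa using smul_mul' (0 : ℂ) f f
  mul_zero f := by simpa using mul_smul' (0 : ℂ) f f
  mul_assoc := mul_assoc'
  norm_mul_le := norm_mul_le'

instance : IsScalarTower ℂ (GroupL1 μ) (GroupL1 μ) := ⟨smul_mul'⟩

instance : SMulCommClass ℂ (GroupL1 μ) (GroupL1 μ) := ⟨fun c f g ↦ (mul_smul' c f g).symm⟩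

noncomputable instance : StarRing (GroupL1 μ) where
  star_involutive f := by
    refine ext ((coeFn_star _).trans ?_)
    refine (invol_congr (coeFn_star f)).trans ?_
    rw [invol_invol]
  star_mul f g := by
    refine ext ((coeFn_star _).trans ?_)
    refine (invol_congr (coeFn_mul f g)).trans ?_
    rw [invol_conv, ← conv_congr (coeFn_star g) (coeFn_star f)]
    exact (coeFn_mul _ _).symm
  star_add f g := by
    refine ext ((coeFn_star _).trans ?_)
    refine (invol_congr (coeFn_add f g)).trans ?_
    refine Filter.EventuallyEq.trans ?_
      (((coeFn_star f).symm.add (coeFn_star g).symm).trans (coeFn_add _ _).symm)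
    exact Filter.Eventually.of_forall fun x ↦ by simp [invol, mul_add]

instance : StarModule ℂ (GroupL1 μ) where
  star_smul c f := by
    refine ext ((coeFn_star _).trans ?_)
    refine (invol_congr (coeFn_smul c f)).trans ?_
    refine Filter.EventuallyEq.trans ?_
      (((coeFn_star f).symm.const_smul (star c)).trans (coeFn_smul _ _).symm)
    exact Filter.Eventually.of_forall fun x ↦ by simp [invol, mul_left_comm]

instance : NormedStarGroup (GroupL1 μ) where
  norm_star_le f := by
    rw [norm_eq, norm_eq]
    exact (integral_congr_ae ((coeFn_star f).fun_comp (‖·‖))).trans_le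
      (integral_norm_invol_le f.integrable)

end GroupL1

/-- A (possibly non-unital) complex `*`-algebra is symmetric if the spectrum of `b* b` consists of
non-negative real numbers for all `b`. If there is no unit, the spectrum is taken in the
unitization, which is what `quasispectrum` computes; if there is one, `quasispectrum` is the usual
spectrum together with `0`. -/
def IsSymmetricStarAlgebra (A : Type*) [NonUnitalRing A] [Module ℂ A] [Star A] : Prop :=
  ∀ b : A, ∀ z ∈ quasispectrum ℂ (star b * b), 0 ≤ z.re ∧ z.im = 0

/-- A locally compact group is symmetric (or hermitian) if its convolution algebra `L¹(G)`, with
respect to Haar measure on the Borel sets, is symmetric. (Rescaling the Haar measure gives an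
isomorphic `*`-algebra, so the choice of normalization is irrelevant.) -/
def IsSymmetricGroup (G : Type*) [Group G] [TopologicalSpace G] [IsTopologicalGroup G]
    [LocallyCompactSpace G] : Prop :=
  letI : MeasurableSpace G := borel G
  haveI : BorelSpace G := ⟨rfl⟩
  IsSymmetricStarAlgebra (GroupL1 (MeasureTheory.Measure.haar : MeasureTheory.Measure G))

set_option linter.unusedSectionVars false
set_option linter.overlappingInstances false
/-! ### Hermitian Banach `*`-algebras -/

section Hermitian

open Filter Topology

/-! Write `H` for `G ⧸ K`. The section is automatically continuous (`Subgroup.continuous_section`),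
so `G` is topologically a semidirect product and Weil's formula splits Haar integration on `G` into
integrals over `K` and `H`. Peter–Weyl theory then cuts `L¹(G)` into pieces that look like matrices
over `L¹(H)`. A finite orthonormal family `ζ₁, …, ζₙ` in `C(K)` with right-invariant span has a
reproducing kernel of the form `∑ ζⱼ(x) conj ζⱼ(y) = e(x y⁻¹)`, and `e` is a self-adjoint idempotent
for convolution. Convolution by `e` is a projection multiplier of `L¹(G)`, and `f ↦ c ·`
(coefficient along `ζ_p` of `f * ζ_q`) embeds the corner `e L¹(G) e` in the `n × n` matrices over
`L¹(H)`. The subspaces `e L¹(G)` together are dense (`dense_leftL1_kernel`).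

Positivity is carried from `H` to `G` through simple modules. Up to complex conjugation, a spectral
value `z` of `a* a` is an eigenvalue in a simple module (`exists_maximal_of_mem_spectrum`). Suppose
that `ψ` is a positive functional, not zero on all squares, with `ψ(y* x) = 0` whenever `x` kills a
certain vector `w`. Then `⟨x w, y w⟩ = ψ(y* x)` is a well-defined positive definite form on the
module, and `⟨a* a v, v⟩ = ⟨a v, a v⟩` forces `z ≥ 0` (`eigenvalue_nonneg_of_positive_form`).

Such functionals come from states of hermitian Banach `*`-algebras. There the sum of two positive
elements is positive (by Pták's inequality) and `a* a` is positive (Shirali–Ford), so the Riesz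
extension theorem gives states vanishing on a prescribed real subspace that does not interfere with
the cone (`exists_state_vanishing`). This is used twice: to show that matrices over a hermitian
algebra are hermitian (`IsHermitianAlgebra.matrix`), and to find states on the matrices over the
unitization of `L¹(H)` which annihilate what kills `w` (`exists_state_of_corner`). The criterion
`isSymmetricStarAlgebra_of_corners` combines both.

Conversely, the constant function `1` on `K` gives the corner of `K`-biinvariant functions, which is
a copy of `L¹(H)`. Quasi-inverses in `L¹(G)` compress to quasi-inverses in this corner, so symmetry
passes down (`isSymmetricStarAlgebra_of_extension`). -/

/-- A complex `*`-algebra is hermitian if self-adjoint elements have real spectrum. -/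
def IsHermitianAlgebra (B : Type*) [Ring B] [Algebra ℂ B] [Star B] : Prop :=
  ∀ h : B, IsSelfAdjoint h → ∀ z ∈ spectrum ℂ h, z.im = 0

/-- Spectral radius less than one. -/
def SpectrallySmall {B : Type*} [Ring B] [Algebra ℂ B] (x : B) : Prop :=
  ∀ z ∈ spectrum ℂ x, ‖z‖ < 1

/-- Self-adjoint elements with spectrum in the right half plane. -/
def SpectrallyNonneg {B : Type*} [Ring B] [Algebra ℂ B] [Star B] (x : B) : Prop :=
  IsSelfAdjoint x ∧ ∀ z ∈ spectrum ℂ x, 0 ≤ z.re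

variable {B : Type*} [NormedRing B] [NormedAlgebra ℂ B]

lemma SpectrallySmall.isUnit_one_sub {x : B} (hx : SpectrallySmall x) : IsUnit (1 - x) := by
  by_contra h
  have : (1 : ℂ) ∈ spectrum ℂ x := by
    rw [spectrum.mem_iff]; simpa using h
  simpa using hx 1 this

lemma SpectrallySmall.smul {x : B} (hx : SpectrallySmall x) {c : ℂ} (hc : ‖c‖ ≤ 1) :
    SpectrallySmall (c • x) := by
  intro z hz
  by_cases h0 : c = 0
  · subst h0
    rw [zero_smul] at hz
    by_contra hz1
    have hz0 : z ≠ 0 := by rintro rfl; simp at hz1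
    rw [spectrum.mem_iff, sub_zero] at hz
    exact hz ((IsUnit.mk0 z hz0).map (algebraMap ℂ B))
  · have := (spectrum.smul_mem_smul_iff (a := x) (s := c⁻¹ * z) (r := Units.mk0 c h0)).1
      (by simpa [Units.smul_def, h0] using hz)
    have h1 := hx _ this
    rw [norm_mul, norm_inv] at h1
    have hcp : 0 < ‖c‖ := norm_pos_iff.2 h0
    calc ‖z‖ = ‖c‖ * (‖c‖⁻¹ * ‖z‖) := by field_simp
      _ ≤ 1 * (‖c‖⁻¹ * ‖z‖) := by gcongr
      _ < 1 := by simpa using h1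

lemma SpectrallySmall.mul_comm {x y : B} (h : SpectrallySmall (x * y)) :
    SpectrallySmall (y * x) := by
  intro z hz
  by_cases h0 : z = 0
  · simp [h0]
  · have : z ∈ spectrum ℂ (y * x) \ {0} := ⟨hz, h0⟩
    rw [spectrum.nonzero_mul_comm] at this
    exact h z this.1

variable [CompleteSpace B]

/-- By Gelfand's formula `‖xⁿ‖ ≤ rⁿ` eventually, for any `r < 1` above the spectral radius. -/
lemma SpectrallySmall.summable_norm_pow {x : B} (hx : SpectrallySmall x) :
    Summable fun n : ℕ ↦ ‖x ^ n‖ := by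
  nontriviality B
  have h1 : spectralRadius ℂ x < (1 : NNReal) :=
    spectrum.spectralRadius_lt_of_forall_lt x fun z hz ↦ by exact_mod_cast hx z hz
  obtain ⟨r, hr1, hr2⟩ := exists_between h1
  lift r to NNReal using hr2.ne_top
  have hr2' : (r : ℝ) < 1 := by exact_mod_cast hr2
  have h2 := (spectrum.pow_nnnorm_pow_one_div_tendsto_nhds_spectralRadius x).eventually_lt_const hr1
  refine summable_of_isBigO_nat (summable_geometric_of_lt_one r.2 hr2')
    (Asymptotics.IsBigO.of_bound 1 ?_)
  filter_upwards [h2, eventually_gt_atTop 0] with n hn hn0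
  have hn' : (0 : ℝ) < n := by exact_mod_cast hn0
  have h3 : (‖x ^ n‖₊ : ENNReal) ≤ (r : ENNReal) ^ (n : ℝ) := by
    have := ENNReal.rpow_le_rpow hn.le hn'.le
    rwa [← ENNReal.rpow_mul, one_div, inv_mul_cancel₀ hn'.ne', ENNReal.rpow_one] at this
  rw [ENNReal.rpow_natCast] at h3
  have h4 : ‖x ^ n‖₊ ≤ r ^ n := by exact_mod_cast h3
  have h5 : ‖x ^ n‖ ≤ (r : ℝ) ^ n := by exact_mod_cast h4
  simpa using h5

lemma SpectrallySmall.tendsto_pow {x : B} (hx : SpectrallySmall x) :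
    Tendsto (fun n : ℕ ↦ x ^ n) atTop (𝓝 0) :=
  tendsto_zero_iff_norm_tendsto_zero.2 hx.summable_norm_pow.tendsto_atTop_zero

lemma spectrallySmall_of_norm_lt {x : B} (hx : ‖x‖ * ‖(1 : B)‖ < 1) : SpectrallySmall x :=
  fun _ hz ↦ (spectrum.norm_le_norm_mul_of_mem hz).trans_lt hx

variable [StarRing B] [StarModule ℂ B] [ContinuousStar B]

/-- The coefficients of the power series of `√(1 - x)`. -/
noncomputable def sqrtCoeff (n : ℕ) : ℂ := (-1) ^ n * ((Ring.choose (1 / 2 : ℝ) n : ℝ) : ℂ)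

lemma norm_sqrtCoeff_le (n : ℕ) : ‖sqrtCoeff n‖ ≤ 1 := by
  have key : ∀ n : ℕ, |Ring.choose (1 / 2 : ℝ) n| ≤ 1 := by
    intro n
    have h := Ring.descPochhammer_eq_factorial_smul_choose (1 / 2 : ℝ) n
    -- Each new factor `1/2 - n` of the falling factorial has absolute value at most `n + 1`.
    have h2 : |(descPochhammer ℤ n).smeval (1 / 2 : ℝ)| ≤ n.factorial := by
      clear h
      induction n with
      | zero => simp [descPochhammer_zero]
      | succ n ih =>
        rw [descPochhammer_succ_right, Polynomial.smeval_mul, abs_mul, Nat.factorial_succ, mul_comm]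
        push_cast
        refine mul_le_mul ?_ ih (abs_nonneg _) (by positivity)
        simp only [Polynomial.smeval_sub, Polynomial.smeval_X, pow_one, Polynomial.smeval_natCast]
        rw [abs_le]
        constructor <;> simp <;> linarith [(Nat.cast_nonneg n : (0 : ℝ) ≤ n)]
    rw [h, nsmul_eq_mul, abs_mul, Nat.abs_cast] at h2
    have : (0 : ℝ) < n.factorial := by exact_mod_cast n.factorial_pos
    nlinarith
  simpa [sqrtCoeff] using key n

/-- Vandermonde's identity for `1/2 + 1/2 = 1`: the Cauchy square of the binomial series of `√(1 -
X)` is `1 - X`. -/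
lemma sum_antidiagonal_sqrtCoeff (n : ℕ) :
    ∑ p ∈ Finset.HasAntidiagonal.antidiagonal n, sqrtCoeff p.1 * sqrtCoeff p.2 =
      if n = 0 then 1 else if n = 1 then -1 else 0 := by
  have h := Ring.add_choose_eq (r := (1 / 2 : ℝ)) (s := 1 / 2) n (Commute.all _ _)
  have e : ∀ p ∈ Finset.HasAntidiagonal.antidiagonal n, sqrtCoeff p.1 * sqrtCoeff p.2 =
      (-1) ^ n * ((Ring.choose (1 / 2 : ℝ) p.1 * Ring.choose (1 / 2 : ℝ) p.2 : ℝ) : ℂ) := by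
    intro p hp
    rw [← Finset.HasAntidiagonal.mem_antidiagonal.1 hp, pow_add]
    simp only [sqrtCoeff]
    push_cast
    ring
  rw [Finset.sum_congr rfl e, ← Finset.mul_sum, ← Complex.ofReal_sum, ← h]
  have h1 : (1 / 2 + 1 / 2 : ℝ) = ((1 : ℕ) : ℝ) := by norm_num
  rw [h1, Ring.choose_natCast]
  rcases n with _ | _ | n
  · simp
  · simp
  · simp [Nat.choose_eq_zero_of_lt]

/-- Ford's square root lemma. The binomial series converges absolutely because its coefficients are
bounded and the norms of the powers of `x` are summable; the coefficients are real, so the sum is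
self-adjoint. -/
lemma SpectrallySmall.exists_sqrt {x : B} (hx : SpectrallySmall x) (hsa : IsSelfAdjoint x) :
    ∃ w : B, IsSelfAdjoint w ∧ w * w = 1 - x := by
  have hn : Summable fun n : ℕ ↦ ‖sqrtCoeff n • x ^ n‖ := by
    refine hx.summable_norm_pow.of_nonneg_of_le (fun n ↦ norm_nonneg _) fun n ↦ ?_
    rw [norm_smul]
    exact (mul_le_mul_of_nonneg_right (norm_sqrtCoeff_le n) (norm_nonneg _)).trans (one_mul _).le
  refine ⟨∑' n, sqrtCoeff n • x ^ n, ?_, ?_⟩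
  · rw [IsSelfAdjoint, tsum_star]
    congr with n
    rw [star_smul, star_pow, hsa.star_eq]
    simp [sqrtCoeff]
  · rw [tsum_mul_tsum_eq_tsum_sum_antidiagonal_of_summable_norm hn hn]
    have e : ∀ n, ∑ p ∈ Finset.HasAntidiagonal.antidiagonal n, (sqrtCoeff p.1 • x ^ p.1) * (sqrtCoeff p.2 • x ^ p.2) =
        (if n = 0 then 1 else if n = 1 then -1 else 0 : ℂ) • x ^ n := by
      intro n
      rw [← sum_antidiagonal_sqrtCoeff, Finset.sum_smul]
      refine Finset.sum_congr rfl fun p hp ↦ ?_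
      rw [smul_mul_smul_comm, ← pow_add, Finset.HasAntidiagonal.mem_antidiagonal.1 hp]
    simp_rw [e]
    rw [tsum_eq_sum (s := {0, 1})]
    · simp [sub_eq_add_neg]
    · intro n hn
      simp only [Finset.mem_insert, Finset.mem_singleton, not_or] at hn
      simp [hn.1, hn.2]


/-- `Complex.I • k` is self-adjoint, so the spectrum of `k` is purely imaginary and misses `-1`. -/
lemma isUnit_one_add_of_star_eq_neg (H : IsHermitianAlgebra B) {k : B} (hk : star k = -k) :
    IsUnit (1 + k) := by
  by_contra h
  have h1 : (-1 : ℂ) ∈ spectrum ℂ k := by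
    rw [spectrum.mem_iff]
    intro h2
    apply h
    have := h2.neg
    rwa [show -((algebraMap ℂ B) (-1) - k) = 1 + k by simp [add_comm]] at this
  have h2 := (spectrum.smul_mem_smul_iff (r := Units.mk0 Complex.I Complex.I_ne_zero)).2 h1
  have h3 := H (Complex.I • k) (by rw [IsSelfAdjoint, star_smul, hk]; simp) _ (by
    simpa [Units.smul_def] using h2)
  simp at h3

/-- If `w² = 1 - a* a`, then `(1 + a*)(1 - a) = w (1 + w⁻¹ (a* - a) w⁻¹) w`, whose middle factor is
one plus a skew-adjoint element. This makes `1 - a` left invertible. The same for `a*`, followed by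
taking adjoints, makes it right invertible. -/
lemma isUnit_one_sub_of_star_mul_self (H : IsHermitianAlgebra B) {a : B}
    (ha : SpectrallySmall (star a * a)) : IsUnit (1 - a) := by
  have key : ∀ a : B, SpectrallySmall (star a * a) → IsUnit ((1 + star a) * (1 - a)) := by
    intro a ha
    obtain ⟨w, hw, hw2⟩ := ha.exists_sqrt (IsSelfAdjoint.star_mul_self a)
    have hu : IsUnit w := by
      have h := ha.isUnit_one_sub
      rw [← hw2] at h
      exact ((Commute.refl w).isUnit_mul_iff.1 h).1
    obtain ⟨u, rfl⟩ := hu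
    have hui : star (↑u⁻¹ : B) = ↑u⁻¹ := by
      have h1 : star u = u := Units.ext hw
      rw [← Units.coe_star_inv, h1]
    have h2 : star ((↑u⁻¹ : B) * (star a - a) * ↑u⁻¹) = -((↑u⁻¹ : B) * (star a - a) * ↑u⁻¹) := by
      simp only [star_mul, star_sub, star_star, hui]
      noncomm_ring
    have h3 := (u.isUnit.mul (isUnit_one_add_of_star_eq_neg H h2)).mul u.isUnit
    have e : (u : B) * (1 + (↑u⁻¹ : B) * (star a - a) * ↑u⁻¹) * u = (1 + star a) * (1 - a) := by
      calc (u : B) * (1 + (↑u⁻¹ : B) * (star a - a) * ↑u⁻¹) * u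
          = (u : B) * u + (u * (↑u⁻¹ : B)) * (star a - a) * ((↑u⁻¹ : B) * u) := by noncomm_ring
        _ = 1 - star a * a + (star a - a) := by simp [hw2]
        _ = _ := by noncomm_ring
    rwa [e] at h3
  obtain ⟨u, hu⟩ := key a ha
  obtain ⟨v, hv⟩ := (key (star a) (by rw [star_star]; exact ha.mul_comm)).star
  rw [star_mul, star_add, star_sub, star_star, star_one] at hv
  refine isUnit_iff_exists_and_exists.2 ⟨⟨(1 + star a) * ↑v⁻¹, ?_⟩, ⟨↑u⁻¹ * (1 + star a), ?_⟩⟩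
  · rw [← mul_assoc, ← hv, Units.mul_inv]
  · rw [mul_assoc, ← hu, Units.inv_mul]

/-- Pták's inequality `r(a)² ≤ r(a* a)`. -/
lemma SpectrallySmall.of_star_mul_self (H : IsHermitianAlgebra B) {a : B}
    (ha : SpectrallySmall (star a * a)) : SpectrallySmall a := by
  intro z hz
  by_contra! hz1
  have hz0 : z ≠ 0 := by rintro rfl; simp at hz1; linarith
  have h := isUnit_one_sub_of_star_mul_self H (a := z⁻¹ • a) (by
    rw [star_smul, smul_mul_smul_comm]
    refine ha.smul ?_
    rw [norm_mul, norm_star, norm_inv]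
    have := inv_le_one_of_one_le₀ hz1
    exact mul_le_one₀ this (by positivity) this)
  rw [spectrum.mem_iff] at hz
  apply hz
  have := (IsUnit.mk0 z hz0).map (algebraMap ℂ B) |>.mul h
  rwa [mul_sub, mul_one, ← Algebra.smul_def, smul_inv_smul₀ hz0] at this

/-- Pták's inequality gives `r(hk)² ≤ r(k h² k) = r(h² k²)`. Iterating leads to `h^(2^n) k^(2^n)`,
whose norm tends to zero. -/
lemma SpectrallySmall.mul (H : IsHermitianAlgebra B) {h k : B} (hh : IsSelfAdjoint h)
    (hk : IsSelfAdjoint k) (sh : SpectrallySmall h) (sk : SpectrallySmall k) :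
    SpectrallySmall (h * k) := by
  have step : ∀ n : ℕ, SpectrallySmall (h ^ (2 ^ n) * k ^ (2 ^ n)) → SpectrallySmall (h * k) := by
    intro n
    induction n with
    | zero => simp
    | succ n ih =>
      intro hn
      refine ih (SpectrallySmall.of_star_mul_self H ?_)
      rw [star_mul, star_pow, star_pow, hh.star_eq, hk.star_eq, mul_assoc]
      refine SpectrallySmall.mul_comm ?_
      convert hn using 1
      rw [pow_succ, pow_mul, pow_mul]
      noncomm_ring
  have h1 : Tendsto (fun n : ℕ ↦ ‖h ^ (2 ^ n) * k ^ (2 ^ n)‖ * ‖(1 : B)‖) atTop (𝓝 0) := by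
    have e : Tendsto (fun n : ℕ ↦ 2 ^ n) atTop atTop := tendsto_pow_atTop_atTop_of_one_lt one_lt_two
    have := ((sh.tendsto_pow.comp e).mul (sk.tendsto_pow.comp e)).norm.mul_const ‖(1 : B)‖
    simpa using this
  obtain ⟨n, hn⟩ := (h1.eventually_lt_const zero_lt_one).exists
  exact step n (spectrallySmall_of_norm_lt hn)

namespace SpectrallyNonneg

lemma of_subsingleton [Subsingleton B] (x : B) : SpectrallyNonneg x :=
  ⟨Subsingleton.elim _ _, fun z hz ↦ by simp [spectrum.of_subsingleton] at hz⟩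

lemma smul {x : B} (hx : SpectrallyNonneg x) {t : ℝ} (ht : 0 ≤ t) :
    SpectrallyNonneg ((t : ℂ) • x) := by
  refine ⟨by rw [IsSelfAdjoint, star_smul, hx.1.star_eq]; simp, fun z hz ↦ ?_⟩
  rcases ht.eq_or_lt with rfl | ht
  · simp only [Complex.ofReal_zero, zero_smul] at hz
    by_contra hz1
    have hz0 : z ≠ 0 := by rintro rfl; simp at hz1
    rw [spectrum.mem_iff, sub_zero] at hz
    exact hz ((IsUnit.mk0 z hz0).map (algebraMap ℂ B))
  · have h0 : (t : ℂ) ≠ 0 := by exact_mod_cast ht.ne'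
    have := (spectrum.smul_mem_smul_iff (a := x) (s := (t : ℂ)⁻¹ * z) (r := Units.mk0 _ h0)).1
      (by simpa [Units.smul_def, h0] using hz)
    have h2 := hx.2 _ this
    rw [← Complex.ofReal_inv, Complex.re_ofReal_mul] at h2
    exact nonneg_of_mul_nonneg_right h2 (by positivity)

lemma isUnit_add {x : B} (hx : SpectrallyNonneg x) {t : ℝ} (ht : 0 < t) :
    IsUnit (algebraMap ℂ B t + x) := by
  by_contra h
  have : (-t : ℂ) ∈ spectrum ℂ x := by
    rw [spectrum.mem_iff]
    intro h2
    apply h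
    have := h2.neg
    rwa [show -((algebraMap ℂ B) (-t) - x) = algebraMap ℂ B t + x by
      rw [map_neg]; abel] at this
  have := hx.2 _ this
  simp at this
  linarith

lemma of_isUnit (H : IsHermitianAlgebra B) {x : B} (hx : IsSelfAdjoint x)
    (h : ∀ t : ℝ, 0 < t → IsUnit (algebraMap ℂ B t + x)) : SpectrallyNonneg x := by
  refine ⟨hx, fun z hz ↦ ?_⟩
  by_contra! hz1
  have h1 := h (-z.re) (by linarith)
  have h2 : z = (z.re : ℂ) := Complex.ext rfl (by simpa using H x hx z hz)
  rw [h2, spectrum.mem_iff] at hz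
  apply hz
  have := h1.neg
  rwa [show -((algebraMap ℂ B) ((-z.re : ℝ) : ℂ) + x) = (algebraMap ℂ B) (z.re : ℂ) - x by
    rw [Complex.ofReal_neg, map_neg]; abel] at this

/-- Replaces a positive `h` by `h / (1 + h)`, to which `SpectrallySmall.mul` applies: `s ↦ s / (1 +
s)` maps `[0, ∞)` into `[0, 1)`. -/
lemma exists_inverse {h : B} (hh : SpectrallyNonneg h) (H : IsHermitianAlgebra B) :
    ∃ u : Bˣ, (u : B) = 1 + h ∧ IsSelfAdjoint ((↑u⁻¹ : B) * h) ∧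
      SpectrallySmall ((↑u⁻¹ : B) * h) ∧ Commute (↑u⁻¹ : B) h := by
  obtain ⟨u, hu⟩ := hh.isUnit_add (t := 1) one_pos
  simp only [Complex.ofReal_one, map_one] at hu
  have huh : Commute (u : B) h := by rw [hu]; exact (Commute.one_left h).add_left (Commute.refl h)
  have hc : Commute (↑u⁻¹ : B) h := huh.units_inv_left
  have hui : star (↑u⁻¹ : B) = ↑u⁻¹ := by
    have h1 : star u = u := Units.ext (by
      rw [Units.coe_star, hu, star_add, star_one, hh.1.star_eq])
    rw [← Units.coe_star_inv, h1]
  refine ⟨u, hu, ?_, ?_, hc⟩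
  · rw [IsSelfAdjoint, star_mul, hui, hh.1.star_eq]; exact hc.eq.symm
  · have e : (↑u⁻¹ : B) * h = 1 - ↑u⁻¹ := by
      rw [show h = u - 1 by rw [hu]; abel, mul_sub, Units.inv_mul, mul_one]
    intro z hz
    rw [e] at hz
    have h1 : 1 - z ∈ spectrum ℂ (↑u⁻¹ : B) := by
      rw [spectrum.mem_iff] at hz ⊢
      intro h2
      apply hz
      have := h2.neg
      rwa [show -((algebraMap ℂ B) (1 - z) - ↑u⁻¹) = (algebraMap ℂ B) z - (1 - ↑u⁻¹) by
        rw [map_sub, map_one]; abel] at this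
    rw [← spectrum.inv₀_mem_iff, hu] at h1
    have h2 : (1 - z)⁻¹ - 1 ∈ spectrum ℂ h := by
      rw [spectrum.mem_iff] at h1 ⊢
      intro h2
      apply h1
      rwa [show (algebraMap ℂ B) ((1 - z)⁻¹ - 1) - h = (algebraMap ℂ B) (1 - z)⁻¹ - (1 + h) by
        rw [map_sub, map_one]; abel] at h2
    have h3 := hh.2 _ h2
    have h4 := H h hh.1 _ h2
    set s := (1 - z)⁻¹ - 1 with hs
    have hsr : s = (s.re : ℂ) := Complex.ext rfl (by simpa using h4)
    have hz1 : (1 - z) ≠ 0 := by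
      intro h5
      have h6 : s.re = -1 := by rw [hs, h5]; simp
      linarith
    have hz2 : z = ((s.re / (1 + s.re) : ℝ) : ℂ) := by
      have h5 : (1 - z)⁻¹ = 1 + (s.re : ℂ) := by rw [← hsr, hs]; ring
      have h6 : (1 : ℂ) + s.re ≠ 0 := by rw [← h5]; exact inv_ne_zero hz1
      have h7 : 1 - z = (1 + (s.re : ℂ))⁻¹ := by rw [← h5, inv_inv]
      push_cast
      field_simp
      have h8 : (1 - z) * (1 + (s.re : ℂ)) = 1 := by rw [h7, inv_mul_cancel₀ h6]
      linear_combination -h8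
    rw [hz2, Complex.norm_real, Real.norm_of_nonneg (by positivity), div_lt_one (by linarith)]
    linarith

/-- With `u = 1 + h` and `v = 1 + k` one has `1 + h + k = u v - h k = u (1 - (u⁻¹ h)(v⁻¹ k)) v`, and
the product in the middle is spectrally small. Rescaling turns `1` into any `t > 0`. -/
lemma add (H : IsHermitianAlgebra B) {h k : B} (hh : SpectrallyNonneg h)
    (hk : SpectrallyNonneg k) : SpectrallyNonneg (h + k) := by
  have key : ∀ h k : B, SpectrallyNonneg h → SpectrallyNonneg k → IsUnit (1 + (h + k)) := by
    intro h k hh hk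
    obtain ⟨u, hu, u1, u2, u3⟩ := hh.exists_inverse H
    obtain ⟨v, hv, v1, v2, v3⟩ := hk.exists_inverse H
    have h1 := (SpectrallySmall.mul H u1 v1 u2 v2).isUnit_one_sub
    have h2 := (u.isUnit.mul h1).mul v.isUnit
    convert h2 using 1
    have e : (u : B) * (1 - ↑u⁻¹ * h * (↑v⁻¹ * k)) * v =
        u * v - (u * ↑u⁻¹) * h * (↑v⁻¹ * k * v) := by noncomm_ring
    have e2 : (↑v⁻¹ : B) * k * v = k := by rw [v3.eq, mul_assoc, Units.inv_mul, mul_one]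
    rw [e, e2, Units.mul_inv, hu, hv]
    noncomm_ring
  refine of_isUnit H (hh.1.add hk.1) fun t ht ↦ ?_
  have h0 : (t : ℂ) ≠ 0 := by exact_mod_cast ht.ne'
  have h1 := key _ _ (hh.smul (inv_nonneg.2 ht.le)) (hk.smul (inv_nonneg.2 ht.le))
  have h2 := (IsUnit.mk0 (t : ℂ) h0).map (algebraMap ℂ B) |>.mul h1
  rwa [Complex.ofReal_inv, ← smul_add, mul_add, mul_one, ← Algebra.smul_def, smul_inv_smul₀ h0] at h2

lemma sq (H : IsHermitianAlgebra B) {h : B} (hh : IsSelfAdjoint h) :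
    SpectrallyNonneg (h * h) := by
  cases subsingleton_or_nontrivial B
  · exact of_subsingleton _
  refine ⟨by rw [IsSelfAdjoint, star_mul, hh.star_eq], fun z hz ↦ ?_⟩
  rw [← pow_two, spectrum.map_pow] at hz
  obtain ⟨s, hs, rfl⟩ := hz
  have := H h hh s hs
  simp only [pow_two, Complex.mul_re, this]
  nlinarith [mul_self_nonneg s.re]

lemma algebraMap_ofReal {t : ℝ} (ht : 0 ≤ t) : SpectrallyNonneg (algebraMap ℂ B t) := by
  have h1 : SpectrallyNonneg (1 : B) := by
    cases subsingleton_or_nontrivial B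
    · exact of_subsingleton _
    refine ⟨IsSelfAdjoint.one B, fun z hz ↦ ?_⟩
    rw [spectrum.one_eq] at hz
    simp [Set.mem_singleton_iff.1 hz]
  simpa [Algebra.algebraMap_eq_smul_one] using h1.smul ht

/-- Makes `1` an order unit of the self-adjoint part, as the Riesz extension needs. The factor `‖1‖`
is there because the norm of the unit is not normalized. -/
lemma of_norm_le {x : B} (H : IsHermitianAlgebra B) (hx : IsSelfAdjoint x) :
    SpectrallyNonneg (algebraMap ℂ B ((‖x‖ * ‖(1 : B)‖ : ℝ) : ℂ) + x) := by
  refine of_isUnit H ?_ fun t ht ↦ ?_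
  · refine IsSelfAdjoint.add ?_ hx
    exact (algebraMap_ofReal (by positivity)).1
  · by_contra h
    have h1 : (-(t + ‖x‖ * ‖(1 : B)‖ : ℝ) : ℂ) ∈ spectrum ℂ x := by
      rw [spectrum.mem_iff]
      intro h2
      apply h
      have := h2.neg
      rwa [show -((algebraMap ℂ B) (-(t + ‖x‖ * ‖(1 : B)‖ : ℝ) : ℂ) - x) =
        algebraMap ℂ B t + (algebraMap ℂ B ((‖x‖ * ‖(1 : B)‖ : ℝ) : ℂ) + x) by
          rw [map_neg, Complex.ofReal_add, map_add]; abel] at this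
    have h2 := spectrum.norm_le_norm_mul_of_mem h1
    rw [norm_neg, Complex.norm_real, Real.norm_of_nonneg (by positivity)] at h2
    linarith

/-- The Shirali–Ford theorem. -/
theorem star_mul_self (H : IsHermitianAlgebra B) (a : B) : SpectrallyNonneg (star a * a) := by
  cases subsingleton_or_nontrivial B
  · exact of_subsingleton _
  set s := star a * a with hs
  have ssa : IsSelfAdjoint s := IsSelfAdjoint.star_mul_self a
  refine ⟨ssa, fun z hz ↦ ?_⟩
  by_contra! hz0
  have hzr : z = (z.re : ℂ) := Complex.ext rfl (by simpa using H s ssa z hz)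
  set δ : ℝ := -z.re with hδ
  have δ_pos : 0 < δ := by linarith
  -- The spectrum of `s` lies in `[-R, R]`, where `p(t) = t (R - t)^(2n)` is at most `C = R ·
  -- R^(2n)`, whereas `p(-δ) = -δ (R + δ)^(2n) < -C` for large `n`. Thus passing from `a` to `b = a
  -- (R - s)^n` makes the negative spectral value outweigh all positive ones.
  set R : ℝ := ‖s‖ * ‖(1 : B)‖ + 1 with hR
  have R_pos : 0 < R := by positivity
  obtain ⟨n, hn⟩ : ∃ n : ℕ, R / δ < (((R + δ) / R) ^ 2) ^ n := by
    have : 1 < ((R + δ) / R) ^ 2 := one_lt_pow₀ (by rw [one_lt_div R_pos]; linarith) two_ne_zero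
    exact pow_unbounded_of_one_lt _ this
  have hn' : R * R ^ (2 * n) < δ * (R + δ) ^ (2 * n) := by
    rw [← pow_mul, div_pow, div_lt_div_iff₀ δ_pos (by positivity)] at hn
    linarith
  set g : B := (algebraMap ℂ B R - s) ^ n with hg
  have gsa : star g = g := by
    rw [hg, star_pow, star_sub, ssa.star_eq, (algebraMap_ofReal R_pos.le).1.star_eq]
  set b : B := a * g with hb
  set p : Polynomial ℂ := Polynomial.X * (Polynomial.C (R : ℂ) - Polynomial.X) ^ (2 * n) with hp
  have hsg : Commute s g := by
    rw [hg]
    exact ((Algebra.commute_algebraMap_right (R : ℂ) s).sub_right (Commute.refl s)).pow_right n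
  have hbb : star b * b = Polynomial.aeval s p := by
    rw [hb, star_mul, gsa, hp]
    simp only [map_mul, Polynomial.aeval_X, map_pow, map_sub, Polynomial.aeval_C]
    rw [two_mul, pow_add, ← hg, ← mul_assoc, mul_assoc g, ← hs, ← hsg.eq, mul_assoc]
  have hsp : spectrum ℂ (star b * b) = (fun k ↦ Polynomial.eval k p) '' spectrum ℂ s := by
    rw [hbb, spectrum.map_polynomial_aeval]
  set C : ℝ := R * R ^ (2 * n) with hC
  have hCb : SpectrallyNonneg (algebraMap ℂ B C - star b * b) := by
    refine ⟨(algebraMap_ofReal (by positivity)).1.sub (IsSelfAdjoint.star_mul_self b),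
      fun w hw ↦ ?_⟩
    have hw' : (C : ℂ) - w ∈ spectrum ℂ (star b * b) := by
      rw [spectrum.mem_iff] at hw ⊢
      intro h
      apply hw
      have := h.neg
      rwa [show -((algebraMap ℂ B) (C - w) - star b * b) =
        algebraMap ℂ B w - (algebraMap ℂ B C - star b * b) by rw [map_sub]; abel] at this
    rw [hsp] at hw'
    obtain ⟨t, ht, htw⟩ := hw'
    have htr : t = (t.re : ℂ) := Complex.ext rfl (by simpa using H s ssa t ht)
    have htn : |t.re| ≤ R := (Complex.abs_re_le_norm t).trans
      ((spectrum.norm_le_norm_mul_of_mem ht).trans (by linarith))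
    have hval : Polynomial.eval t p = ((t.re * (R - t.re) ^ (2 * n) : ℝ) : ℂ) := by
      rw [htr]; simp [hp]
    simp only [hval] at htw
    have : w.re = C - t.re * (R - t.re) ^ (2 * n) := by
      have := congrArg Complex.re htw
      rw [Complex.ofReal_re, Complex.sub_re, Complex.ofReal_re] at this
      linarith
    rw [this, sub_nonneg]
    have hnn : 0 ≤ (R - t.re) ^ (2 * n) := by
      rw [pow_mul]; positivity
    rcases le_total t.re 0 with h0 | h0
    · exact (mul_nonpos_of_nonpos_of_nonneg h0 hnn).trans (by positivity)
    · rw [hC]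
      have h1 := (abs_le.1 htn).2
      refine mul_le_mul h1 (pow_le_pow_left₀ (by linarith) (by linarith) _) hnn R_pos.le
  set β : ℝ := δ * (R + δ) ^ (2 * n) with hβ
  have hβ1 : (-β : ℂ) ∈ spectrum ℂ (star b * b) := by
    rw [hsp]
    refine ⟨z, hz, ?_⟩
    rw [hzr]
    simp only [hp, hβ, hδ]
    push_cast
    simp [sub_eq_add_neg]
  have hβpos : 0 < β := by positivity
  have hβ2 : (-β : ℂ) ∈ spectrum ℂ (b * star b) := by
    have h0 : (-β : ℂ) ∈ spectrum ℂ (star b * b) \ {0} := ⟨hβ1, by simpa using hβpos.ne'⟩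
    rw [spectrum.nonzero_mul_comm] at h0
    exact h0.1
  set h : B := b + star b
  set k : B := Complex.I • (b - star b)
  have hh : IsSelfAdjoint h := by simp [h, IsSelfAdjoint, add_comm]
  have hk : IsSelfAdjoint k := by
    rw [IsSelfAdjoint, star_smul, star_sub, star_star]
    simp [k, smul_sub, sub_eq_add_neg, add_comm]
  -- Since `h² + k² = 2 (b b* + b* b)`, the element `C + b b*` is a sum of positive elements. This
  -- contradicts `-β` being in the spectrum of `b b*` with `β > C`.
  have e : algebraMap ℂ B C + b * star b =
      ((1 / 2 : ℝ) : ℂ) • (h * h + k * k) + (algebraMap ℂ B C - star b * b) := by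
    have e1 : k * k = -((b - star b) * (b - star b)) := by
      simp only [k, smul_mul_smul_comm, Complex.I_mul_I, neg_smul, one_smul]
    have e2 : h * h + k * k = (2 : ℂ) • (b * star b + star b * b) := by
      rw [e1, two_smul]
      simp only [h]
      noncomm_ring
    rw [e2, smul_smul]
    norm_num [add_comm]
  have hfin : SpectrallyNonneg (algebraMap ℂ B C + b * star b) := by
    rw [e]
    exact add H ((add H (sq H hh) (sq H hk)).smul (by norm_num)) hCb
  have h3 : ((C - β : ℝ) : ℂ) ∈ spectrum ℂ (algebraMap ℂ B C + b * star b) := by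
    rw [spectrum.mem_iff] at hβ2 ⊢
    intro h
    apply hβ2
    rwa [show algebraMap ℂ B ((C - β : ℝ) : ℂ) - (algebraMap ℂ B C + b * star b) =
      algebraMap ℂ B (-β : ℂ) - b * star b by
        rw [Complex.ofReal_sub, map_sub, map_neg]; abel] at h
  have := hfin.2 _ h3
  simp at this
  linarith

end SpectrallyNonneg

/-- For `R = 2 + ‖p‖ ‖1‖` the spectrum of `1 + p` lies in `[1, R - 1]`, hence that of `1 - R⁻¹ (1 +
p)` in `[1/R, 1 - 1/R]`. -/
lemma SpectrallyNonneg.tendsto_pow (H : IsHermitianAlgebra B) {p : B} (hp : SpectrallyNonneg p) :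
    ∃ R : ℝ, 0 < R ∧ Tendsto (fun n : ℕ ↦ (1 - ((R⁻¹ : ℝ) : ℂ) • (1 + p)) ^ n) atTop (𝓝 0) := by
  set R : ℝ := 2 + ‖p‖ * ‖(1 : B)‖ with hR
  have R_pos : 0 < R := by positivity
  refine ⟨R, R_pos, SpectrallySmall.tendsto_pow fun z hz ↦ ?_⟩
  have h0 : ((R⁻¹ : ℝ) : ℂ) ≠ 0 := by exact_mod_cast (inv_pos.2 R_pos).ne'
  have h1 : 1 - z ∈ spectrum ℂ (((R⁻¹ : ℝ) : ℂ) • (1 + p)) := by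
    rw [spectrum.mem_iff] at hz ⊢
    intro h
    apply hz
    have := h.neg
    rwa [show -((algebraMap ℂ B) (1 - z) - ((R⁻¹ : ℝ) : ℂ) • (1 + p)) =
      algebraMap ℂ B z - (1 - ((R⁻¹ : ℝ) : ℂ) • (1 + p)) by rw [map_sub, map_one]; abel] at this
  have h2 : (R : ℂ) * (1 - z) ∈ spectrum ℂ (1 + p) := by
    refine (spectrum.smul_mem_smul_iff (r := Units.mk0 _ h0)).1 ?_
    have hR0 : (R : ℂ) ≠ 0 := by exact_mod_cast R_pos.ne'
    simpa [Units.smul_def, hR0] using h1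
  have h3 : (R : ℂ) * (1 - z) - 1 ∈ spectrum ℂ p := by
    rw [spectrum.mem_iff] at h2 ⊢
    intro h
    apply h2
    rwa [show algebraMap ℂ B ((R : ℂ) * (1 - z)) - (1 + p) =
      algebraMap ℂ B ((R : ℂ) * (1 - z) - 1) - p by rw [map_sub _ _ 1, map_one]; abel]
  have h4 := hp.2 _ h3
  have h5 := H p hp.1 _ h3
  have h6 := (Complex.re_le_norm _).trans (spectrum.norm_le_norm_mul_of_mem h3)
  simp only [Complex.sub_re, Complex.re_ofReal_mul, Complex.one_re, Complex.sub_im,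
    Complex.im_ofReal_mul, Complex.one_im] at h4 h5 h6
  have him : z.im = 0 := by
    have : R * z.im = 0 := by linarith
    exact (mul_eq_zero.1 this).resolve_left R_pos.ne'
  have hzr : z = (z.re : ℂ) := Complex.ext rfl (by simpa using him)
  rw [hzr, Complex.norm_real, Real.norm_eq_abs, abs_lt]
  constructor
  · by_contra! h
    nlinarith
  · by_contra! h
    nlinarith

/-- A Riesz extension theorem: a real subspace `J` of self-adjoint elements such that the
distance of scalars to the positive cone is not changed by `J` is annihilated by a state. -/
theorem exists_state_vanishing (H : IsHermitianAlgebra B) (J : Submodule ℝ (selfAdjoint B))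
    (hJ : ∀ t : ℝ, ∀ x ∈ J, SpectrallyNonneg (algebraMap ℂ B t + x) → 0 ≤ t) :
    ∃ φ : B →ₗ[ℂ] ℂ, Continuous φ ∧ φ 1 = 1 ∧ (∀ x ∈ J, φ x = 0) ∧
      (∀ x, SpectrallyNonneg x → 0 ≤ (φ x).re ∧ (φ x).im = 0) := by
  let P : PointedCone ℝ (selfAdjoint B) :=
    { carrier := {x | SpectrallyNonneg (x : B)}
      add_mem' := fun ha hb ↦ SpectrallyNonneg.add H ha hb
      zero_mem' := by
        simpa using SpectrallyNonneg.algebraMap_ofReal (B := B) (le_refl 0)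
      smul_mem' := fun c x hx ↦ by
        have := SpectrallyNonneg.smul hx c.2
        rw [Set.mem_ofPred_eq]
        exact this }
  have hP : ∀ x, x ∈ P ↔ SpectrallyNonneg (x : B) := fun x ↦ Iff.rfl
  have hone : ∀ t : ℝ, ((t • (1 : selfAdjoint B) : selfAdjoint B) : B) = algebraMap ℂ B t := by
    intro t
    rw [Algebra.algebraMap_eq_smul_one]
    rfl
  -- The extension takes place in the quotient by `J`. There the class `e` of `1` is an order unit
  -- for the image of the cone, and `hJ` says exactly that `t e ↦ t` is non-negative on that image.
  set e : (selfAdjoint B) ⧸ J := J.mkQ 1 with he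
  have he0 : e ≠ 0 := by
    intro h
    rw [he, Submodule.mkQ_apply, Submodule.Quotient.mk_eq_zero] at h
    have := hJ (-1) 1 h (by
      have := SpectrallyNonneg.algebraMap_ofReal (B := B) (le_refl 0)
      simpa using this)
    linarith
  have hdom : ∀ x : (LinearPMap.mkSpanSingleton (K := ℝ) (σ := RingHom.id ℝ) e (1 : ℝ) he0).domain,
      ∃ c : ℝ, (x : (selfAdjoint B) ⧸ J) = c • e ∧
        (LinearPMap.mkSpanSingleton (K := ℝ) (σ := RingHom.id ℝ) e (1 : ℝ) he0) x = c := by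
    rintro ⟨x, hx⟩
    obtain ⟨c, rfl⟩ := Submodule.mem_span_singleton.1 hx
    refine ⟨c, rfl, ?_⟩
    exact (LinearPMap.mkSpanSingleton'_apply _ _ _ _ _).trans (by simp)
  obtain ⟨g, hg1, hg2⟩ := riesz_extension (P.map J.mkQ)
    (LinearPMap.mkSpanSingleton (K := ℝ) (σ := RingHom.id ℝ) e (1 : ℝ) he0) (by
      intro x hx
      obtain ⟨c, hc, hc2⟩ := hdom x
      rw [hc2]
      rw [hc] at hx
      obtain ⟨p, hp, hpe⟩ := hx
      have h1 : p - c • 1 ∈ J := by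
        rw [← Submodule.Quotient.mk_eq_zero, ← Submodule.mkQ_apply, map_sub, map_smul, ← he]
        exact sub_eq_zero.2 hpe
      refine hJ c _ h1 ?_
      have : SpectrallyNonneg (p : B) := hp
      simpa [hone] using this) (by
      intro y
      obtain ⟨y, rfl⟩ := J.mkQ_surjective y
      refine ⟨⟨(‖(y : B)‖ * ‖(1 : B)‖) • e, Submodule.smul_mem _ _
        (Submodule.mem_span_singleton_self e)⟩, ⟨(‖(y : B)‖ * ‖(1 : B)‖) • 1 + y, ?_, ?_⟩⟩
      · change SpectrallyNonneg (((‖(y : B)‖ * ‖(1 : B)‖) • (1 : selfAdjoint B) + y : selfAdjoint B) : B)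
        rw [AddSubgroup.coe_add, hone]
        exact SpectrallyNonneg.of_norm_le H y.2
      · simp [he])
  set f : selfAdjoint B →ₗ[ℝ] ℝ := g.comp J.mkQ with hf
  have fpos : ∀ x : selfAdjoint B, SpectrallyNonneg (x : B) → 0 ≤ f x :=
    fun x hx ↦ hg2 _ ⟨x, hx, rfl⟩
  have fone : f 1 = 1 := by
    have h1 := hg1 ⟨e, Submodule.mem_span_singleton_self e⟩
    obtain ⟨c, hc, hc2⟩ := hdom ⟨e, Submodule.mem_span_singleton_self e⟩
    rw [hc2] at h1
    have : c = 1 := by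
      have h2 : (1 - c) • e = 0 := by rw [sub_smul, one_smul, sub_eq_zero]; exact hc
      have := (smul_eq_zero.1 h2).resolve_right he0
      linarith
    rw [this] at h1
    exact h1
  have fbound : ∀ x : selfAdjoint B, ‖f x‖ ≤ ‖(1 : B)‖ * ‖x‖ := by
    have h1 : ∀ x : selfAdjoint B, -f x ≤ ‖(1 : B)‖ * ‖x‖ := by
      intro x
      have h2 := fpos ((‖(x : B)‖ * ‖(1 : B)‖) • 1 + x) (by
        rw [AddSubgroup.coe_add, hone]
        exact SpectrallyNonneg.of_norm_le H x.2)
      rw [map_add, map_smul, fone, smul_eq_mul, mul_one] at h2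
      have : ‖x‖ = ‖(x : B)‖ := rfl
      rw [this]
      linarith
    intro x
    rw [Real.norm_eq_abs, abs_le]
    refine ⟨by linarith [h1 x], ?_⟩
    have := h1 (-x)
    rwa [map_neg, neg_neg, norm_neg] at this
  have fcont : Continuous f := AddMonoidHomClass.continuous_of_bound f _ fbound
  have rcont : Continuous (realPart : B →ₗ[ℝ] selfAdjoint B) := by
    refine continuous_induced_rng.2 ?_
    have : (Subtype.val ∘ (realPart : B →ₗ[ℝ] selfAdjoint B)) = fun x : B ↦ (2⁻¹ : ℝ) • (x + star x) := by
      ext x; simp [realPart_apply_coe]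
    rw [this]
    fun_prop
  have icont : Continuous (imaginaryPart : B →ₗ[ℝ] selfAdjoint B) := by
    have : (imaginaryPart : B →ₗ[ℝ] selfAdjoint B) = fun x : B ↦ -realPart (Complex.I • x) := by
      ext x; simp [realPart_I_smul]
    rw [this]
    exact (rcont.comp (continuous_const_smul Complex.I)).neg
  refine ⟨{ toFun := fun x ↦ (f (realPart x) : ℂ) + Complex.I * f (imaginaryPart x)
            map_add' := ?_
            map_smul' := ?_ }, ?_, ?_, ?_, ?_⟩
  · intro x y
    simp only [map_add, Complex.ofReal_add]
    ring
  · intro c x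
    simp only [realPart_smul, imaginaryPart_smul, map_add, map_sub, map_smul, smul_eq_mul,
      RingHom.id_apply]
    apply Complex.ext <;> simp
  · change Continuous fun x ↦ (f (realPart x) : ℂ) + Complex.I * f (imaginaryPart x)
    have h1 := fcont.comp rcont
    have h2 := fcont.comp icont
    exact (Complex.continuous_ofReal.comp h1).add
      (continuous_const.mul (Complex.continuous_ofReal.comp h2))
  · have h1 : realPart (1 : B) = 1 := by
      ext; exact (IsSelfAdjoint.one B).coe_realPart
    have h2 : imaginaryPart (1 : B) = 0 := (IsSelfAdjoint.one B).imaginaryPart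
    simp [h1, h2, fone]
  · intro x hx
    have h1 : realPart (x : B) = x := by
      ext; exact x.2.coe_realPart
    have h2 : imaginaryPart (x : B) = 0 := x.2.imaginaryPart
    have h3 : f x = 0 := by
      rw [hf, LinearMap.comp_apply, Submodule.mkQ_apply, (Submodule.Quotient.mk_eq_zero J).2 hx,
        map_zero]
    simp [h1, h2, h3]
  · intro x hx
    have h1 : ((realPart (x : B) : selfAdjoint B) : B) = x := hx.1.coe_realPart
    have h2 : imaginaryPart (x : B) = 0 := hx.1.imaginaryPart
    have h3 := fpos (realPart x) (by rwa [h1])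
    simp [h2, h3]

end Hermitian
/-! ### Positive forms on simple modules -/

section PositiveForm

variable {A : Type*} [NonUnitalRing A] [StarRing A] [Module ℂ A] [IsScalarTower ℂ A A]
  [SMulCommClass ℂ A A] [StarModule ℂ A]

/-- The Cauchy–Schwarz inequality in the degenerate case. -/
lemma map_star_mul_eq_zero_of_nonneg (ψ : A →ₗ[ℂ] ℂ)
    (hψ : ∀ x : A, 0 ≤ (ψ (star x * x)).re ∧ (ψ (star x * x)).im = 0) {x : A}
    (hx : ψ (star x * x) = 0) (y : A) : ψ (star y * x) = 0 := by
  -- As `ψ (x* x) = 0`, no quadratic term in `c` survives. A non-negative affine function of a real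
  -- parameter `s` is constant; `c = s` and `c = s i` yield two linear relations.
  have key : ∀ c : ℂ, ψ (star (y + c • x) * (y + c • x)) =
      ψ (star y * y) + (star c * ψ (star x * y) + c * ψ (star y * x)) := by
    intro c
    simp only [star_add, star_smul, add_mul, mul_add, smul_mul_assoc, mul_smul_comm, map_add,
      map_smul, smul_eq_mul, hx]
    ring
  set α := ψ (star x * y)
  set β := ψ (star y * x)
  set γ := ψ (star y * y) with hγ
  have hg := hψ y
  rw [← hγ] at hg
  have real_zero : ∀ γ r : ℝ, (∀ s : ℝ, 0 ≤ γ + s * r) → r = 0 := by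
    intro γ r h
    by_contra hr
    have := h (-(γ + 1) / r)
    rw [div_mul_cancel₀ _ hr] at this
    linarith
  have h1 : ∀ δ : ℂ, (∀ s : ℝ, 0 ≤ (γ + s * δ).re ∧ (γ + s * δ).im = 0) → δ = 0 := by
    intro δ h
    apply Complex.ext
    · refine real_zero γ.re _ fun s ↦ ?_
      simpa using (h s).1
    · have := (h 1).2
      simpa [hg.2] using this
  have h2 : α + β = 0 := h1 _ fun s ↦ by
    have := hψ (y + (s : ℂ) • x)
    rw [key] at this
    convert this using 4 <;> simp <;> ring
  have h3 : Complex.I * (β - α) = 0 := h1 _ fun s ↦ by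
    have := hψ (y + (s * Complex.I : ℂ) • x)
    rw [key] at this
    convert this using 4 <;> simp <;> ring
  have h4 : β - α = 0 := (mul_eq_zero.1 h3).resolve_left Complex.I_ne_zero
  linear_combination (h2 + h4) / 2

variable {M V : Type*} [Ring M] [Algebra ℂ M] [AddCommGroup V] [Module M V] [IsSimpleModule M V]

/-- If a simple module carries (through the orbit of `w` under a `*`-ideal) a nonzero invariant
positive form, then `a* a` has non-negative eigenvalues. -/
theorem eigenvalue_nonneg_of_positive_form (ι : A →ₙₐ[ℂ] M) (ι_inj : Function.Injective ι)
    (ι_left : ∀ m a, ∃ b, ι b = m * ι a) (ι_right : ∀ m a, ∃ b, ι b = ι a * m)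
    (ψ : A →ₗ[ℂ] ℂ) (hψ : ∀ x : A, 0 ≤ (ψ (star x * x)).re ∧ (ψ (star x * x)).im = 0)
    (w : V) (hw0 : ∃ a, ι a • w ≠ 0) (hw : ∀ x, ι x • w = 0 → ∀ y, ψ (star y * x) = 0)
    (h0 : ∃ x, ψ (star x * x) ≠ 0) {a : A} {v : V} (hv : v ≠ 0) {z : ℂ}
    (hz : ι (star a * a) • v = algebraMap ℂ M z • v) : 0 ≤ z.re ∧ z.im = 0 := by
  have ι_smul : ∀ (c : ℂ) x, ι (c • x) = algebraMap ℂ M c * ι x := fun c x ↦ by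
    rw [map_smul, Algebra.smul_def]
  -- The orbit of `w` is a nonzero submodule, hence everything, so the form `⟨ι a • w, ι b • w⟩ = ψ
  -- (b* a)` lives on all of `V`.
  let orbit : Submodule M V :=
    { carrier := {u | ∃ a, ι a • w = u}
      add_mem' := by
        rintro _ _ ⟨a, rfl⟩ ⟨b, rfl⟩
        exact ⟨a + b, by rw [map_add, add_smul]⟩
      zero_mem' := ⟨0, by simp⟩
      smul_mem' := by
        rintro m _ ⟨a, rfl⟩
        obtain ⟨b, hb⟩ := ι_left m a
        exact ⟨b, by rw [hb, mul_smul]⟩ }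
  have horbit : orbit = ⊤ := by
    refine (eq_bot_or_eq_top orbit).resolve_left fun h ↦ ?_
    obtain ⟨a, ha⟩ := hw0
    have : ι a • w ∈ orbit := ⟨a, rfl⟩
    rw [h, Submodule.mem_bot] at this
    exact ha this
  obtain ⟨x, rfl⟩ : v ∈ orbit := horbit ▸ Submodule.mem_top
  -- Definiteness: the vectors `ι a • w` with `a` in the left kernel of `ψ` form a submodule. If it
  -- contained `v ≠ 0` it would be `V`, and `ψ` would vanish on all `y* y`.
  have hx : ψ (star x * x) ≠ 0 := by
    intro hx
    let N : Submodule M V :=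
      { carrier := {u | ∃ a, (∀ y, ψ (star y * a) = 0) ∧ ι a • w = u}
        add_mem' := by
          rintro _ _ ⟨a, ha, rfl⟩ ⟨b, hb, rfl⟩
          exact ⟨a + b, fun y ↦ by rw [mul_add, map_add, ha, hb, add_zero],
            by rw [map_add, add_smul]⟩
        zero_mem' := ⟨0, by simp⟩
        smul_mem' := by
          rintro m _ ⟨a, ha, rfl⟩
          obtain ⟨b, hb⟩ := ι_left m a
          refine ⟨b, fun y ↦ ?_, by rw [hb, mul_smul]⟩
          obtain ⟨c, hc⟩ := ι_right m (star y)
          have : star y * b = star (star c) * a := ι_inj (by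
            rw [map_mul, map_mul, hb, star_star, hc, mul_assoc])
          rw [this, ha] }
    have hN : N = ⊤ := by
      refine (eq_bot_or_eq_top N).resolve_left fun h ↦ hv ?_
      have : ι x • w ∈ N := ⟨x, map_star_mul_eq_zero_of_nonneg ψ hψ hx, rfl⟩
      rwa [h, Submodule.mem_bot] at this
    obtain ⟨y, hy⟩ := h0
    obtain ⟨b, hb, hbw⟩ : ι y • w ∈ N := hN ▸ Submodule.mem_top
    have h1 := hw (y - b) (by rw [map_sub, sub_smul, hbw, sub_self]) y
    rw [mul_sub, map_sub, hb, sub_zero] at h1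
    exact hy h1
  -- This element kills `w`, so `ψ ((a x)* (a x)) = z ψ (x* x)`.
  have h1 := hw (star a * a * x - z • x) (by
    rw [map_sub, sub_smul, map_mul, mul_smul, ι_smul, mul_smul, hz, sub_self]) x
  rw [mul_sub, map_sub, mul_smul_comm, map_smul, sub_eq_zero, smul_eq_mul,
    show star x * (star a * a * x) = star (a * x) * (a * x) by
      rw [star_mul]; simp only [mul_assoc]] at h1
  have h2 := hψ (a * x)
  have h3 := hψ x
  have h4 : ψ (star x * x) = ((ψ (star x * x)).re : ℂ) := Complex.ext rfl (by simpa using h3.2)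
  have h5 : (ψ (star x * x)).re ≠ 0 := by
    intro h
    rw [h] at h4
    exact hx (by simpa using h4)
  have h6 : 0 < (ψ (star x * x)).re := lt_of_le_of_ne h3.1 h5.symm
  rw [h1, h4, Complex.re_mul_ofReal, Complex.im_mul_ofReal] at h2
  exact ⟨nonneg_of_mul_nonneg_left h2.1 h6, (mul_eq_zero.1 h2.2).resolve_right h5⟩

end PositiveForm

/-! ### Spectral values as eigenvalues in simple modules -/

section SimpleModule

variable {M : Type*} [Ring M] [Algebra ℂ M] [StarRing M] [StarModule ℂ M]

/-- A left inverse of `star z - s` becomes, by taking adjoints, a right inverse of `z - s`. So `z -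
s` and `star z - s` cannot both be left invertible, and one of them generates a proper left ideal.
In the simple quotient by `L` the class of `1` is an eigenvector of `s`. -/
lemma exists_maximal_of_mem_spectrum {s : M} (hs : IsSelfAdjoint s) {z : ℂ}
    (hz : z ∈ spectrum ℂ s) :
    ∃ L : Ideal M, L.IsMaximal ∧ ∃ z' : ℂ, (z' = z ∨ z' = star z) ∧ algebraMap ℂ M z' - s ∈ L := by
  by_contra! H
  have key : ∀ z' : ℂ, (z' = z ∨ z' = star z) → ∃ m : M, m * (algebraMap ℂ M z' - s) = 1 := by
    intro z' hz'
    by_contra! h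
    obtain ⟨L, hL, hL2⟩ := Ideal.exists_le_maximal (Ideal.span {algebraMap ℂ M z' - s}) (by
      rw [Ideal.ne_top_iff_one, Ideal.mem_span_singleton']
      rintro ⟨m, hm⟩
      exact h m hm)
    exact H L hL z' hz' (hL2 (Ideal.mem_span_singleton_self _))
  obtain ⟨m, hm⟩ := key z (Or.inl rfl)
  obtain ⟨m', hm'⟩ := key (star z) (Or.inr rfl)
  refine hz (isUnit_iff_exists_and_exists.2 ⟨⟨star m', ?_⟩, ⟨m, hm⟩⟩)
  have := congrArg star hm'
  rwa [star_mul, star_sub, hs.star_eq, star_one, ← algebraMap_star_comm, star_star] at this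

end SimpleModule

/-! ### Matrix algebras over hermitian algebras -/

section Matrix

variable {D : Type*} [NormedRing D] [NormedAlgebra ℂ D] [CompleteSpace D] [StarRing D]
  [StarModule ℂ D] [ContinuousStar D] {n : Type*} [Fintype n] [DecidableEq n]

/-- Matrix algebras over hermitian Banach `*`-algebras are hermitian. -/
theorem IsHermitianAlgebra.matrix (H : IsHermitianAlgebra D) :
    IsHermitianAlgebra (Matrix n n D) := by
  have φpos : ∀ φ : D →ₗ[ℂ] ℂ, (∀ x, SpectrallyNonneg x → 0 ≤ (φ x).re ∧ (φ x).im = 0) →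
      ∀ x, 0 ≤ (φ (star x * x)).re ∧ (φ (star x * x)).im = 0 := fun φ hφ x ↦
    hφ _ (SpectrallyNonneg.star_mul_self H x)
  have key : ∀ a : Matrix n n D, ∀ z ∈ spectrum ℂ (star a * a), 0 ≤ z.re ∧ z.im = 0 := by
    intro a z hz
    obtain ⟨L, hL, z', hz', hL2⟩ := exists_maximal_of_mem_spectrum (IsSelfAdjoint.star_mul_self a) hz
    have : IsSimpleModule (Matrix n n D) (Matrix n n D ⧸ L) :=
      isSimpleModule_iff_isCoatom.2 hL.out
    set v : Matrix n n D ⧸ L := L.mkQ 1 with hv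
    have hv0 : v ≠ 0 := by
      rw [hv, Submodule.mkQ_apply, Ne, Submodule.Quotient.mk_eq_zero]
      exact (Ideal.ne_top_iff_one L).1 hL.ne_top
    have hmv : ∀ m : Matrix n n D, m • v = L.mkQ m := by
      intro m; rw [hv, ← map_smul, smul_eq_mul, mul_one]
    have hav : (star a * a) • v = algebraMap ℂ (Matrix n n D) z' • v := by
      rw [hmv, hmv, eq_comm, ← sub_eq_zero, ← map_sub, Submodule.mkQ_apply,
        Submodule.Quotient.mk_eq_zero]
      exact hL2
    -- The diagonal idempotents sum to `1`. On `w = e_kk v` a functional `φ` of `D` will act through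
    -- `x ↦ φ (x k k)`.
    obtain ⟨k, hk⟩ : ∃ k : n, Matrix.single k k (1 : D) • v ≠ 0 := by
      by_contra! h
      apply hv0
      rw [← one_smul (Matrix n n D) v, ← Matrix.sum_single_one, Finset.sum_smul]
      exact Finset.sum_eq_zero fun k _ ↦ h k
    set w := Matrix.single k k (1 : D) • v with hw
    have hkw : Matrix.single k k (1 : D) • w = w := by
      rw [hw, ← mul_smul]; simp
    let J : Submodule ℝ (selfAdjoint D) :=
      { carrier := {x | Matrix.single k k (x : D) • w = 0}
        add_mem' := by
          intro x y hx hy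
          simp only [Set.mem_ofPred_eq] at hx hy ⊢
          rw [AddSubgroup.coe_add, Matrix.single_add, add_smul, hx, hy, add_zero]
        zero_mem' := by simp
        smul_mem' := by
          intro c x hx
          simp only [Set.mem_ofPred_eq] at hx ⊢
          have : Matrix.single k k ((c • x : selfAdjoint D) : D) =
              Matrix.single k k (algebraMap ℂ D c) * Matrix.single k k (x : D) := by
            rw [Matrix.single_mul_single_same, ← Algebra.smul_def]
            rfl
          rw [this, mul_smul, hx, smul_zero] }
    -- If `t + x` is positive with `t < 0`, then `x` is invertible in `D` and cannot annihilate the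
    -- nonzero vector `w`.
    obtain ⟨φ, -, φ1, φJ, φP⟩ := exists_state_vanishing H J (by
      intro t x hx hp
      by_contra! ht
      have hx' : Matrix.single k k (x : D) • w = 0 := hx
      obtain ⟨u, hu⟩ := hp.isUnit_add (t := -t) (by linarith)
      have h1 : (x : D) = u := by
        rw [hu, ← add_assoc, ← map_add]; simp
      apply hk
      rw [← hkw, ← u.inv_mul, ← h1, ← Matrix.single_mul_single_same (j := k), mul_smul, hx', smul_zero])
    have hφ := φpos φ φP
    have hann : ∀ d : D, Matrix.single k k d • w = 0 → φ d = 0 := by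
      intro d hd
      have h1 : φ (star d * d) = 0 := φJ ⟨star d * d, IsSelfAdjoint.star_mul_self d⟩ (by
        change Matrix.single k k (star d * d) • w = 0
        rw [← Matrix.single_mul_single_same (j := k), mul_smul, hd, smul_zero])
      simpa using map_star_mul_eq_zero_of_nonneg φ hφ h1 1
    have hres := eigenvalue_nonneg_of_positive_form (V := Matrix n n D ⧸ L)
      (NonUnitalAlgHom.id ℂ (Matrix n n D)) (fun _ _ h ↦ h) (fun m a ↦ ⟨m * a, rfl⟩)
      (fun m a ↦ ⟨a * m, rfl⟩) (φ.comp (Matrix.entryLinearMap ℂ D k k)) (by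
        intro x
        have : (star x * x) k k = ∑ j, star (x j k) * x j k := by
          simp [Matrix.mul_apply, Matrix.star_apply]
        simp only [LinearMap.comp_apply, Matrix.entryLinearMap_apply, this, map_sum, Complex.re_sum,
          Complex.im_sum]
        exact ⟨Finset.sum_nonneg fun j _ ↦ (hφ _).1, Finset.sum_eq_zero fun j _ ↦ (hφ _).2⟩)
      w ⟨1, by simpa using hk⟩ (by
        intro x hx y
        have hx : x • w = 0 := hx
        refine hann _ ?_
        have : Matrix.single k k ((star y * x) k k) =
            Matrix.single k k 1 * star y * x * Matrix.single k k 1 := by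
          rw [mul_assoc _ (star y), Matrix.single_mul_mul_single]; simp
        rw [Matrix.entryLinearMap_apply, this, mul_smul, hkw, mul_smul, hx, smul_zero])
      ⟨1, by simp [φ1]⟩ hv0 (a := a) (z := z') hav
    rcases hz' with rfl | rfl
    · exact hres
    · simpa using hres
  -- For self-adjoint `h`, `z²` is a spectral value of `h* h`, so `z² ≥ 0` and `z` is real.
  intro h hh z hz
  have h1 := key h (z ^ 2) (by
    rw [hh.star_eq, ← pow_two]
    exact spectrum.pow_mem_pow h 2 hz)
  simp only [pow_two, Complex.mul_re, Complex.mul_im] at h1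
  have h2 : z.re * z.im = 0 := by linarith [h1.2]
  rcases mul_eq_zero.1 h2 with h3 | h3
  · nlinarith [h1.1, mul_self_nonneg z.im]
  · exact h3

end Matrix

/-! ### The unitization of a symmetric algebra -/

section Unitization

variable (A : Type*) [NonUnitalNormedRing A] [StarRing A] [NormedStarGroup A] [NormedSpace ℂ A]
  [IsScalarTower ℂ A A] [SMulCommClass ℂ A A] [StarModule ℂ A]

/-- The unitization with the `ℓ¹` norm. -/
abbrev L1Unitization : Type _ := WithLp 1 (Unitization ℂ A)

namespace L1Unitization

open WithLp

variable {A}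

noncomputable instance : StarRing (L1Unitization A) where
  star x := toLp 1 (star (ofLp x))
  star_involutive x := by simp
  star_mul x y := ofLp_injective 1 (star_mul (ofLp x) (ofLp y))
  star_add x y := ofLp_injective 1 (star_add (ofLp x) (ofLp y))

lemma ofLp_star (x : L1Unitization A) : ofLp (star x) = star (ofLp x) := rfl

instance : StarModule ℂ (L1Unitization A) where
  star_smul c x := ofLp_injective 1 (by simp [ofLp_star])

instance : ContinuousStar (L1Unitization A) where
  continuous_star := by
    refine AddMonoidHomClass.continuous_of_bound (starAddEquiv : L1Unitization A ≃+ _) 1 fun x ↦ ?_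
    change ‖star x‖ ≤ _
    simp [unitization_norm_def, ofLp_star]

variable (A) in
/-- The inclusion of an algebra in its unitization. -/
noncomputable def inr : A →ₙₐ[ℂ] L1Unitization A where
  toFun a := toLp 1 (a : Unitization ℂ A)
  map_smul' c a := by simp
  map_zero' := by simp
  map_add' a b := by simp
  map_mul' a b := ofLp_injective 1 (by simp)

lemma ofLp_inr (a : A) : ofLp (inr A a) = (a : Unitization ℂ A) := rfl

lemma norm_inr (a : A) : ‖inr A a‖ = ‖a‖ := unitization_norm_inr a

lemma inr_injective : Function.Injective (inr A) := fun a b h ↦ by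
  have := congrArg ofLp h
  simpa [ofLp_inr] using this

lemma inr_star (a : A) : inr A (star a) = star (inr A a) := ofLp_injective 1 (by
  simp [ofLp_star, ofLp_inr])

lemma exists_inr_eq_mul (m : L1Unitization A) (a : A) : ∃ b, inr A b = m * inr A a :=
  ⟨(ofLp m).fst • a + (ofLp m).snd * a, ofLp_injective 1 (by
    apply Unitization.ext <;> simp [ofLp_inr])⟩

lemma exists_inr_eq_mul' (m : L1Unitization A) (a : A) : ∃ b, inr A b = inr A a * m :=
  ⟨(ofLp m).fst • a + a * (ofLp m).snd, ofLp_injective 1 (by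
    apply Unitization.ext <;> simp [ofLp_inr])⟩

lemma eq_algebraMap_add (m : L1Unitization A) :
    m = algebraMap ℂ _ (ofLp m).fst + inr A (ofLp m).snd := ofLp_injective 1 (by
    apply Unitization.ext <;> simp [ofLp_inr, Unitization.algebraMap_eq_inl])

lemma spectrum_inr (a : A) : spectrum ℂ (inr A a) = quasispectrum ℂ a := by
  rw [Unitization.quasispectrum_eq_spectrum_inr, ← ofLp_inr]
  exact (AlgEquiv.spectrum_eq (unitizationAlgEquiv (𝕜 := ℂ) (A := A) ℂ) (inr A a)).symm

/-- The unitization of a symmetric algebra is hermitian. -/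
theorem isHermitianAlgebra (H : IsSymmetricStarAlgebra A) : IsHermitianAlgebra (L1Unitization A) := by
  intro h hh z hz
  rw [eq_algebraMap_add h] at hz
  set t := (ofLp h).fst
  set a := (ofLp h).snd
  have hh' : star (ofLp h) = ofLp h := congrArg ofLp hh
  have ht : t.im = 0 := by
    have := congrArg (fun u : Unitization ℂ A ↦ u.fst) hh'
    simp only [Unitization.fst_star] at this
    exact Complex.conj_eq_iff_im.1 this
  have ha : star a = a := by
    have := congrArg (fun u : Unitization ℂ A ↦ u.snd) hh'
    simpa only [Unitization.snd_star] using this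
  -- Since `t` is real and `a` self-adjoint, `(z - t)²` is a spectral value of `a* a`, hence
  -- non-negative, so `z` is real.
  have h1 : z - t ∈ spectrum ℂ (inr A a) := by
    rw [spectrum.mem_iff] at hz ⊢
    rwa [map_sub, sub_sub]
  have h2 := spectrum.pow_mem_pow (inr A a) 2 h1
  rw [pow_two (inr A a), ← map_mul, spectrum_inr] at h2
  nth_rewrite 1 [← ha] at h2
  have h3 := H a _ h2
  simp only [pow_two, Complex.mul_re, Complex.mul_im, Complex.sub_re, Complex.sub_im, ht, sub_zero] at h3
  have h4 : (z.re - t.re) * z.im = 0 := by linarith [h3.2]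
  rcases mul_eq_zero.1 h4 with h5 | h5
  · nlinarith [h3.1, mul_self_nonneg z.im]
  · exact h5

end L1Unitization

end Unitization
/-! ### A criterion for symmetry through corners -/

section Corner

open Filter Topology L1Unitization

variable {A : Type*} [NonUnitalNormedRing A] [StarRing A] [NormedStarGroup A] [NormedSpace ℂ A]
  [IsScalarTower ℂ A A] [SMulCommClass ℂ A A] [StarModule ℂ A]

/-- The right multiplication by the adjoint of a left multiplier `l`. -/
def adjointMultiplier (l : A → A) (x : A) : A := star (l (star x))

/-- A self-adjoint idempotent multiplier of a `*`-algebra, given by its left action. -/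
structure IsProjectionMultiplier (l : A →ₗ[ℂ] A) : Prop where
  map_mul : ∀ x y, l (x * y) = l x * y
  adjoint_mul : ∀ x y, adjointMultiplier l x * y = x * l y
  idem : ∀ x, l (l x) = l x
  comm : ∀ x, l (adjointMultiplier l x) = adjointMultiplier l (l x)

namespace IsProjectionMultiplier

variable {l : A →ₗ[ℂ] A}

lemma adjoint_idem (hl : IsProjectionMultiplier l) (x : A) :
    adjointMultiplier l (adjointMultiplier l x) = adjointMultiplier l x := by
  simp [adjointMultiplier, hl.idem]

lemma map_mul_adjoint (hl : IsProjectionMultiplier l) (x y : A) :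
    adjointMultiplier l (x * y) = x * adjointMultiplier l y := by
  simp [adjointMultiplier, hl.map_mul]

lemma corner_idem (hl : IsProjectionMultiplier l) (x : A) :
    l (adjointMultiplier l x) = x → l x = x ∧ adjointMultiplier l x = x := by
  intro h
  constructor
  · rw [← h, hl.idem]
  · rw [← h, hl.comm, hl.adjoint_idem]

lemma corner_corner (hl : IsProjectionMultiplier l) (x : A) :
    l (adjointMultiplier l (l (adjointMultiplier l x))) = l (adjointMultiplier l x) := by
  rw [← hl.comm, hl.idem, hl.adjoint_idem]

variable {V : Type*} [AddCommGroup V] [Module (L1Unitization A) V]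

/-- If `l` is thought of as left multiplication by a projection `p`, the vector `w = p f v` is fixed
by `p`, so `b p w = b w`. -/
lemma adjoint_smul (hl : IsProjectionMultiplier l) {w v : V} {f : A} (hw : w = inr A (l f) • v)
    (b : A) : inr A (adjointMultiplier l b) • w = inr A b • w := by
  rw [hw, ← mul_smul, ← mul_smul, ← _root_.map_mul, ← _root_.map_mul, hl.adjoint_mul, hl.idem]

/-- The multiplier `p` need not act on `V`, but `p z w` depends only on `z w`: for every `b`, `b (p
z) w = (b p) (z w)`, and no nonzero vector is killed by all `b`. -/
lemma smul_map_smul (hl : IsProjectionMultiplier l) {w : V}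
    (nondeg : ∀ u : V, (∀ a, inr A a • u = 0) → u = 0) {z z' : A}
    (hz : inr A z • w = inr A z' • w) : inr A (l z) • w = inr A (l z') • w := by
  rw [← sub_eq_zero]
  refine nondeg _ fun b ↦ ?_
  rw [smul_sub, ← mul_smul, ← mul_smul, ← _root_.map_mul, ← _root_.map_mul, ← hl.adjoint_mul, ← hl.adjoint_mul,
    _root_.map_mul, _root_.map_mul, mul_smul, mul_smul, hz, sub_self]

end IsProjectionMultiplier

/-- The vectors killed by `A` form a submodule because `A` is an ideal of its unitization. -/
lemma eq_zero_of_forall_inr_smul {V : Type*} [AddCommGroup V] [Module (L1Unitization A) V]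
    [IsSimpleModule (L1Unitization A) V] (h0 : ∃ a, ∃ v : V, inr A a • v ≠ 0) (u : V)
    (hu : ∀ a, inr A a • u = 0) : u = 0 := by
  let N : Submodule (L1Unitization A) V :=
    { carrier := {u | ∀ a, inr A a • u = 0}
      add_mem' := fun hx hy a ↦ by rw [smul_add, hx a, hy a, add_zero]
      zero_mem' := fun a ↦ smul_zero _
      smul_mem' := fun m x hx a ↦ by
        obtain ⟨b, hb⟩ := exists_inr_eq_mul' m a
        rw [← mul_smul, ← hb, hx b] }
  have hN : N = ⊥ := by
    refine (eq_bot_or_eq_top N).resolve_right fun h ↦ ?_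
    obtain ⟨a, v, hv⟩ := h0
    have : v ∈ N := h ▸ Submodule.mem_top
    exact hv (this a)
  have : u ∈ N := hu
  rwa [hN, Submodule.mem_bot] at this

lemma exists_inr_smul_eq {V : Type*} [AddCommGroup V] [Module (L1Unitization A) V]
    [IsSimpleModule (L1Unitization A) V] (h0 : ∃ a, ∃ v : V, inr A a • v ≠ 0) {w : V}
    (hw : w ≠ 0) (u : V) : ∃ a, inr A a • w = u := by
  let N : Submodule (L1Unitization A) V :=
    { carrier := {u | ∃ a, inr A a • w = u}
      add_mem' := by
        rintro _ _ ⟨a, rfl⟩ ⟨b, rfl⟩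
        exact ⟨a + b, by rw [map_add, add_smul]⟩
      zero_mem' := ⟨0, by simp⟩
      smul_mem' := by
        rintro m _ ⟨a, rfl⟩
        obtain ⟨b, hb⟩ := exists_inr_eq_mul m a
        exact ⟨b, by rw [hb, mul_smul]⟩ }
  have hN : N = ⊤ := by
    refine (eq_bot_or_eq_top N).resolve_left fun h ↦ hw (eq_zero_of_forall_inr_smul h0 w fun a ↦ ?_)
    have : inr A a • w ∈ N := ⟨a, rfl⟩
    rwa [h, Submodule.mem_bot] at this
  have : u ∈ N := hN ▸ Submodule.mem_top
  exact this

variable {M : Type*} [NormedRing M] [NormedAlgebra ℂ M] [CompleteSpace M] [StarRing M]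
  [StarModule ℂ M] [ContinuousStar M]

/-- A hermitian realization of a corner provides states compatible with a given simple module. -/
theorem exists_state_of_corner (H : IsHermitianAlgebra M) {l : A →ₗ[ℂ] A}
    (hl : IsProjectionMultiplier l) (Φ : A →ₗ[ℂ] M)
    (Φ_mul : ∀ x y, Φ (x * l y) = Φ x * Φ y) (Φ_star : ∀ x, Φ (star x) = star (Φ x))
    (Φ_map : ∀ x, Φ (l x) = Φ x) {C : ℝ}
    (Φ_bound : ∀ x, ‖l (adjointMultiplier l x)‖ ≤ C * ‖Φ x‖)
    {V : Type*} [AddCommGroup V] [Module (L1Unitization A) V] [IsSimpleModule (L1Unitization A) V]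
    {w v : V} {f : A} (hwf : w = inr A (l f) • v) (hw0 : w ≠ 0)
    (hclosed : IsClosed {x : A | inr A x • w = 0}) :
    ∃ φ : M →ₗ[ℂ] ℂ, Continuous φ ∧
      (∀ x, SpectrallyNonneg x → 0 ≤ (φ x).re ∧ (φ x).im = 0) ∧
      (∀ x, inr A x • w = 0 → ∀ y, φ (Φ (star y * x)) = 0) ∧ ∃ x, φ (Φ (star x * x)) ≠ 0 := by
  have h0 : ∃ a, ∃ v : V, inr A a • v ≠ 0 := ⟨_, v, hwf ▸ hw0⟩
  have nondeg := eq_zero_of_forall_inr_smul h0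
  set r := adjointMultiplier l with hr
  have r_star : ∀ x, r (star x) = star (l x) := fun x ↦ by simp [hr, adjointMultiplier]
  have l_star : ∀ x, l (star x) = star (r x) := fun x ↦ by simp [hr, adjointMultiplier]
  have Φ_r : ∀ x, Φ (r x) = Φ x := fun x ↦ by
    rw [hr, adjointMultiplier, Φ_star, Φ_map, Φ_star, star_star]
  have rw_ : ∀ b, inr A (r b) • w = inr A b • w := hl.adjoint_smul hwf
  have lw_ : ∀ {z z' : A}, inr A z • w = inr A z' • w → inr A (l z) • w = inr A (l z') • w :=
    fun h ↦ hl.smul_map_smul nondeg h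
  -- In the notation `l x = p x`, `r x = x p`: from `y w = w` the corner element `c = p y p` also
  -- fixes `w`, and it serves as a unit at `w`.
  obtain ⟨c, hcw, hc⟩ : ∃ c, inr A c • w = w ∧ l (r c) = c := by
    obtain ⟨y, hy⟩ := exists_inr_smul_eq h0 hw0 w
    refine ⟨l (r y), ?_, hl.corner_corner y⟩
    rw [← sub_eq_zero]
    refine nondeg _ fun b ↦ ?_
    rw [smul_sub, ← mul_smul, ← map_mul, ← hl.adjoint_mul, map_mul, mul_smul, rw_ y, hy, ← hr, rw_,
      sub_self]
  obtain ⟨hcl, hcr⟩ : l c = c ∧ r c = c := hl.corner_idem c hc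
  have alg_smul : ∀ (t : ℂ) (x : A), inr A (t • x) = algebraMap ℂ (L1Unitization A) t * inr A x :=
    fun t x ↦ by rw [map_smul, Algebra.smul_def]
  -- The elements `t + Φ x` for which `t + p x p`, in the unitization of `A`, kills `w`.
  let J : Submodule ℝ (selfAdjoint M) :=
    { carrier := {m | ∃ (t : ℂ) (x : A), (m : M) = algebraMap ℂ M t + Φ x ∧
        (algebraMap ℂ (L1Unitization A) t + inr A (l (r x))) • w = 0}
      add_mem' := by
        rintro m m' ⟨t, x, hm, h⟩ ⟨t', x', hm', h'⟩
        refine ⟨t + t', x + x', ?_, ?_⟩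
        · rw [AddSubgroup.coe_add, hm, hm', map_add, map_add]; abel
        · have e : r (x + x') = r x + r x' := by simp [hr, adjointMultiplier]
          rw [e]
          simp only [map_add, add_smul] at h h' ⊢
          rw [show ∀ a b c d : V, a + b + (c + d) = (a + c) + (b + d) by intros; abel, h, h', add_zero]
      zero_mem' := ⟨0, 0, by simp, by simp [hr, adjointMultiplier]⟩
      smul_mem' := by
        rintro s m ⟨t, x, hm, h⟩
        have hs : ((s • m : selfAdjoint M) : M) = (s : ℂ) • (m : M) := rfl
        refine ⟨s * t, (s : ℂ) • x, ?_, ?_⟩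
        · rw [hs, hm, smul_add, map_smul, map_mul, Algebra.smul_def]
        · have e : r ((s : ℂ) • x) = (s : ℂ) • r x := by simp [hr, adjointMultiplier]
          rw [e, map_smul, alg_smul, map_mul, ← mul_add, mul_smul, h, smul_zero] }
  obtain ⟨φ, φc, φ1, φJ, φP⟩ := exists_state_vanishing H J (by
    rintro s m ⟨t, x, hm, h⟩ hp
    by_contra! hs
    set p := algebraMap ℂ M s + (m : M) with hpdef
    have hs0 : (s : ℂ) ≠ 0 := by exact_mod_cast hs.ne
    -- If `s < 0` and `p = s + m` is positive, then `1 + (-s)⁻¹ p = (-s)⁻¹ m`, so the powers of `1 -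
    -- ρ m` tend to zero.
    obtain ⟨R, R_pos, hR⟩ := (hp.smul (t := (-s)⁻¹) (by
      rw [inv_nonneg]; linarith)).tendsto_pow H
    set ρ : ℂ := ((R⁻¹ : ℝ) : ℂ) * (((-s)⁻¹ : ℝ) : ℂ) with hρ
    have e1 : 1 - ((R⁻¹ : ℝ) : ℂ) • (1 + (((-s)⁻¹ : ℝ) : ℂ) • p) = 1 - ρ • (m : M) := by
      rw [hρ, mul_smul]
      congr 2
      rw [hpdef, smul_add, Algebra.algebraMap_eq_smul_one, smul_smul, ← add_assoc]
      have : (((-s)⁻¹ : ℝ) : ℂ) * s = -1 := by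
        push_cast
        rw [inv_neg, neg_mul, inv_mul_cancel₀ hs0]
      rw [this, neg_smul, one_smul, add_neg_cancel, zero_add]
    rw [e1] at hR
    set x' := l (r x) with hx'
    obtain ⟨hxl, hxr⟩ : l x' = x' ∧ r x' = x' := hl.corner_idem x' (hl.corner_corner x)
    -- `(1 - ρ m)^n Φ c` lifts to a corner element `z n` which still fixes `w`, because the lift `t
    -- + x'` of `m` kills `w`. The norm bound forces `z n → 0`, and as the annihilator of `w` is
    -- closed and contains `z n - c`, it contains `-c`; so `w = c w = 0`.
    have hz : ∀ n : ℕ, ∃ z : A, Φ z = (1 - ρ • (m : M)) ^ n * Φ c ∧ l (r z) = z ∧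
        inr A z • w = w := by
      intro n
      induction n with
      | zero => exact ⟨c, by simp, hc, hcw⟩
      | succ n ih =>
        obtain ⟨z, hz1, hz2, hz3⟩ := ih
        obtain ⟨hzl, hzr⟩ : l z = z ∧ r z = z := hl.corner_idem z hz2
        have rsub : ∀ a b, r (a - b) = r a - r b := fun a b ↦ by simp [hr, adjointMultiplier]
        have radd : ∀ a b, r (a + b) = r a + r b := fun a b ↦ by simp [hr, adjointMultiplier]
        have rsmul : ∀ (t : ℂ) a, r (t • a) = t • r a := fun t a ↦ by simp [hr, adjointMultiplier]
        refine ⟨z - ρ • (t • z + x' * z), ?_, ?_, ?_⟩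
        · have e2 : Φ (x' * z) = Φ x * Φ z := by
            rw [← hzl, Φ_mul, hx', Φ_map, Φ_r, hzl]
          rw [map_sub, map_smul, map_add, map_smul, e2, pow_succ', mul_assoc, ← hz1, hm, sub_mul,
            one_mul, smul_mul_assoc, add_mul, Algebra.smul_def t]
        · rw [rsub, rsmul, radd, rsmul, hzr, hr, hl.map_mul_adjoint, ← hr, hzr, map_sub, map_smul,
            map_add, map_smul, hzl, hl.map_mul, hxl]
        · rw [map_sub, alg_smul, map_add, alg_smul, map_mul _ x' z, ← add_mul, sub_smul, mul_smul, mul_smul,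
            hz3, h, smul_zero, sub_zero]
    choose z hz1 hz2 hz3 using hz
    have hzlim : Tendsto z atTop (𝓝 0) := by
      rw [tendsto_zero_iff_norm_tendsto_zero]
      have h1 : Tendsto (fun n ↦ C * ‖Φ (z n)‖) atTop (𝓝 0) := by
        simp_rw [hz1]
        simpa using ((hR.mul_const (Φ c)).norm.const_mul C)
      refine squeeze_zero (fun n ↦ norm_nonneg _) (fun n ↦ ?_) h1
      have := Φ_bound (z n)
      rwa [hz2] at this
    have hmem : -c ∈ {x : A | inr A x • w = 0} := by
      refine hclosed.mem_of_tendsto (b := atTop) (f := fun n ↦ z n - c) ?_ ?_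
      · simpa using hzlim.sub_const c
      · refine Eventually.of_forall fun n ↦ ?_
        rw [Set.mem_ofPred_eq, map_sub, sub_smul, hz3, hcw, sub_self]
    rw [Set.mem_ofPred_eq, map_neg, neg_smul, hcw, neg_eq_zero] at hmem
    exact hw0 hmem)
  have hφ : ∀ x, 0 ≤ (φ (star x * x)).re ∧ (φ (star x * x)).im = 0 := fun x ↦
    φP _ (SpectrallyNonneg.star_mul_self H x)
  have hCS : ∀ k : M, φ (star k * k) = 0 → φ k = 0 := fun k hk ↦ by
    simpa using map_star_mul_eq_zero_of_nonneg φ hφ hk 1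
  refine ⟨φ, φc, φP, ?_, c, ?_⟩
  · intro x hx y
    -- `d = p y* x p` kills `w`, so `Φ(d)* Φ(d)` lies in `J`, and Cauchy–Schwarz against `1` gives
    -- `φ (Φ d) = 0`.
    set d := l (r (star y * x)) with hd
    have hdw : inr A d • w = 0 := by
      have h1 : inr A (r (star y * x)) • w = inr A (0 : A) • w := by
        rw [rw_, map_mul, mul_smul, hx, smul_zero, map_zero, zero_smul]
      rw [hd, lw_ h1, map_zero, map_zero, zero_smul]
    obtain ⟨hdl, hdr⟩ : l d = d ∧ r d = d := hl.corner_idem d (hl.corner_corner _)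
    have hdd : Φ (star d * d) = star (Φ d) * Φ d := by
      nth_rewrite 2 [← hdl]
      rw [Φ_mul, Φ_star]
    have hmem : (⟨star (Φ d) * Φ d, IsSelfAdjoint.star_mul_self _⟩ : selfAdjoint M) ∈ J := by
      refine ⟨0, star d * d, by rw [map_zero, zero_add, hdd], ?_⟩
      rw [map_zero, zero_add, hr, hl.map_mul_adjoint, ← hr, hdr, hl.map_mul, l_star, hdr, map_mul,
        mul_smul, hdw, smul_zero]
    have h2 := hCS _ (φJ _ hmem)
    rwa [hd, Φ_map, Φ_r] at h2
  · intro hcc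
    have hcs : l (star c) = star c := by rw [l_star, hcr]
    have hcsr : r (star c) = star c := by rw [r_star, hcl]
    have hcc' : Φ (star c * c) = star (Φ c) * Φ c := by
      nth_rewrite 2 [← hcl]
      rw [Φ_mul, Φ_star]
    have h1 : φ (Φ c) = 0 := hCS _ (by rw [← hcc', hcc])
    -- `1 - c` kills `w`, hence so does `(1 - c)* (1 - c)`, and `φ (Φ c - 1) = 0`. Together with `φ
    -- (Φ c) = 0` this contradicts `φ 1 = 1`.
    have hmem : (⟨star (Φ c - 1) * (Φ c - 1), IsSelfAdjoint.star_mul_self _⟩ : selfAdjoint M) ∈ J := by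
      refine ⟨1, star c * c - c - star c, ?_, ?_⟩
      · change star (Φ c - 1) * (Φ c - 1) = _
        rw [map_sub, map_sub, hcc', Φ_star, map_one, star_sub, star_one]
        noncomm_ring
      · have e : l (r (star c * c - c - star c)) = star c * c - c - star c := by
          have rsub : ∀ a b, r (a - b) = r a - r b := fun a b ↦ by simp [hr, adjointMultiplier]
          rw [rsub, rsub, hcr, hcsr, hr, hl.map_mul_adjoint, ← hr, hcr, map_sub, map_sub, hcl, hcs,
            hl.map_mul, hcs]
        rw [e, map_one, map_sub, map_sub, map_mul]
        simp only [add_smul, sub_smul, mul_smul, hcw, one_smul]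
        abel
    have h2 := hCS _ (φJ _ hmem)
    rw [map_sub, h1, φ1] at h2
    simp at h2


attribute [local instance] Matrix.linftyOpNormedRing Matrix.linftyOpNormedAlgebra

/-- The norm is the largest `ℓ¹` norm of a row, so the matrices are isometric to a finite product of
`ℓ¹` spaces. -/
lemma completeSpace_matrix (D n : Type*) [NormedRing D] [CompleteSpace D] [Fintype n]
    [DecidableEq n] : @CompleteSpace (Matrix n n D)
      (Matrix.linftyOpNormedRing (n := n) (α := D)).toMetricSpace.toUniformSpace := by
  let f : Matrix n n D →+ (n → PiLp 1 fun _ : n ↦ D) :=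
    { toFun := fun m p ↦ WithLp.toLp 1 (m p)
      map_zero' := rfl
      map_add' := fun _ _ ↦ rfl }
  have hf : Isometry f := AddMonoidHomClass.isometry_of_norm f fun m ↦ by
    rw [Pi.norm_def, Matrix.linfty_opNorm_def]
    congr 2 with p
    simp only [PiLp.nnnorm_eq_of_L1]
    rfl
  refine (hf.isUniformInducing.completeSpace_congr fun g ↦ ?_).2 inferInstance
  exact ⟨Matrix.of fun p q ↦ g p q, rfl⟩

lemma continuousStar_matrix (D n : Type*) [NormedRing D] [StarRing D] [ContinuousStar D]
    [Fintype n] [DecidableEq n] : @ContinuousStar (Matrix n n D)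
      (Matrix.linftyOpNormedRing (n := n) (α := D)).toMetricSpace.toUniformSpace.toTopologicalSpace
      _ := by
  have h : ContinuousStar (Matrix n n D) := ⟨continuous_id.matrix_conjTranspose⟩
  exact h

/-- A Banach `*`-algebra is symmetric if it has sufficiently many corners which embed as closed
`*`-subalgebras in matrix algebras over a hermitian algebra, in a compatible way. -/
theorem isSymmetricStarAlgebra_of_corners [CompleteSpace A] {D : Type*} [NormedRing D]
    [NormedAlgebra ℂ D] [CompleteSpace D] [StarRing D] [StarModule ℂ D] [ContinuousStar D]
    (H : IsHermitianAlgebra D) {I : Type*} {n : I → Type*} [∀ i, Fintype (n i)]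
    [∀ i, DecidableEq (n i)] (l : I → A →ₗ[ℂ] A) (hl : ∀ i, IsProjectionMultiplier (l i))
    (T : ∀ i, n i → n i → A →L[ℂ] D)
    (T_mul : ∀ i p q x y, T i p q (x * l i y) = ∑ k, T i p k x * T i k q y)
    (T_star : ∀ i p q x, T i p q (star x) = star (T i q p x))
    (T_map : ∀ i p q x, T i p q (l i x) = T i p q x)
    (T_bound : ∀ i, ∃ C : ℝ, ∀ x, ‖l i (adjointMultiplier (l i) x)‖ ≤ C * ∑ p, ∑ q, ‖T i p q x‖)
    (T_pos : ∀ i j x, ∃ Y : n j → n i → D,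
      ∀ p q, T i p q (star (l j x) * l j x) = ∑ k, star (Y k p) * Y k q)
    (dense : Dense {x | ∃ i y, x = l i y}) : IsSymmetricStarAlgebra A := by
  intro a z hz
  rw [← spectrum_inr] at hz
  obtain ⟨L, hL, z', hz', hL2⟩ := exists_maximal_of_mem_spectrum
    (by rw [IsSelfAdjoint, ← inr_star, star_mul, star_star]) hz
  have : IsSimpleModule (L1Unitization A) (L1Unitization A ⧸ L) :=
    isSimpleModule_iff_isCoatom.2 hL.out
  set v : L1Unitization A ⧸ L := L.mkQ 1 with hv
  have hmv : ∀ m : L1Unitization A, m • v = L.mkQ m := by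
    intro m; rw [hv, ← map_smul, smul_eq_mul, mul_one]
  have hLv : ∀ m : L1Unitization A, m • v = 0 ↔ m ∈ L := fun m ↦ by
    rw [hmv, Submodule.mkQ_apply, Submodule.Quotient.mk_eq_zero]
  have hv0 : v ≠ 0 := by
    rw [← one_smul (L1Unitization A) v, Ne, hLv]
    exact (Ideal.ne_top_iff_one L).1 hL.ne_top
  have hav : inr A (star a * a) • v = algebraMap ℂ (L1Unitization A) z' • v := by
    rw [eq_comm, ← sub_eq_zero, ← sub_smul, hLv]
    exact hL2
  suffices hres : 0 ≤ z'.re ∧ z'.im = 0 by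
    rcases hz' with rfl | rfl
    · exact hres
    · simpa using hres
  -- When `z' ≠ 0` the eigenvector `v` is not killed by all of `A`. Annihilators are closed, since
  -- maximal left ideals of a Banach algebra are, so by density some `l i f` does not kill `v`.
  by_cases hz0 : z' = 0
  · simp [hz0]
  have hinr : Continuous (inr A) :=
    (AddMonoidHomClass.isometry_of_norm (inr A) norm_inr).continuous
  have hann : ∀ u : L1Unitization A ⧸ L, IsClosed {x : A | inr A x • u = 0} := by
    intro u
    obtain ⟨m, rfl⟩ := L.mkQ_surjective u
    have : {x : A | inr A x • L.mkQ m = 0} = (fun x ↦ inr A x * m) ⁻¹' (L : Set (L1Unitization A)) := by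
      ext x
      change L.mkQ (inr A x • m) = 0 ↔ inr A x * m ∈ L
      exact Submodule.Quotient.mk_eq_zero L
    rw [this]
    exact Ideal.IsMaximal.isClosed.preimage (hinr.mul continuous_const)
  obtain ⟨i, f, hf⟩ : ∃ i f, inr A (l i f) • v ≠ 0 := by
    by_contra! h
    have h1 : ∀ x : A, inr A x • v = 0 := by
      intro x
      refine (hann v).closure_subset_iff.2 ?_ (dense x)
      rintro _ ⟨i, y, rfl⟩
      exact h i y
    have h2 : algebraMap ℂ (L1Unitization A) z' • v = 0 := by rw [← hav, h1]
    apply hv0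
    have h3 : algebraMap ℂ (L1Unitization A) z'⁻¹ • algebraMap ℂ (L1Unitization A) z' • v = v := by
      rw [← mul_smul, ← map_mul, inv_mul_cancel₀ hz0, map_one, one_smul]
    rw [← h3, h2, smul_zero]
  set w := inr A (l i f) • v with hw
  let Φ : A →ₗ[ℂ] Matrix (n i) (n i) D :=
    { toFun := fun x ↦ Matrix.of fun p q ↦ T i p q x
      map_add' := fun x y ↦ by ext; simp
      map_smul' := fun c x ↦ by ext; simp }
  have Φ_apply : ∀ x p q, Φ x p q = T i p q x := fun _ _ _ ↦ rfl
  obtain ⟨C, hC⟩ := T_bound i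
  have hnorm : ∀ m : Matrix (n i) (n i) D, ∑ p, ∑ q, ‖m p q‖ ≤ Fintype.card (n i) * ‖m‖ := by
    intro m
    have h1 : ∀ p ∈ Finset.univ, ∑ q, ‖m p q‖ ≤ ‖m‖ := fun p _ ↦ by
      rw [Matrix.linfty_opNorm_def]
      have := Finset.le_sup (f := fun p ↦ ∑ q, ‖m p q‖₊) (Finset.mem_univ p)
      have := NNReal.coe_le_coe.2 this
      push_cast at this ⊢
      exact this
    simpa using Finset.sum_le_sum h1
  have := continuousStar_matrix D (n i)
  have := completeSpace_matrix D (n i)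
  obtain ⟨φ, φc, φP, φann, φ0⟩ := exists_state_of_corner (H.matrix (n := n i)) (hl i) Φ
    (by
      intro x y
      ext p q
      simp only [Φ_apply, T_mul, Matrix.mul_apply])
    (by
      intro x
      ext p q
      simp only [Φ_apply, T_star, Matrix.star_apply])
    (by
      intro x
      ext p q
      simp only [Φ_apply, T_map])
    (C := |C| * Fintype.card (n i)) (by
      intro x
      refine (hC x).trans ?_
      rw [mul_assoc]
      refine mul_le_mul (le_abs_self C) (hnorm (Φ x)) (by positivity) (abs_nonneg _)) hw hf (hann w)
  have Φc : Continuous Φ := by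
    refine continuous_matrix fun p q ↦ (T i p q).continuous
  refine eigenvalue_nonneg_of_positive_form (V := L1Unitization A ⧸ L) (inr A) inr_injective
    exists_inr_eq_mul exists_inr_eq_mul' (φ.comp Φ) ?_ w ?_ φann φ0 hv0 hav
  -- Positivity of `φ ∘ Φ` on squares is a closed condition, so `T_pos` on the dense ranges
  -- suffices.
  · have hcl : IsClosed {x : A | 0 ≤ (φ (Φ (star x * x))).re ∧ (φ (Φ (star x * x))).im = 0} := by
      have hc : Continuous fun x : A ↦ φ (Φ (star x * x)) :=
        φc.comp (Φc.comp (continuous_star.mul continuous_id))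
      exact (isClosed_le continuous_const (Complex.continuous_re.comp hc)).inter
        (isClosed_eq (Complex.continuous_im.comp hc) continuous_const)
    intro x
    refine hcl.closure_subset_iff.2 ?_ (dense x)
    rintro _ ⟨j, y, rfl⟩
    obtain ⟨Y, hY⟩ := T_pos i j y
    rcases isEmpty_or_nonempty (n i) with h | ⟨⟨p₀⟩⟩
    · have : Φ (star (l j y) * l j y) = 0 := Subsingleton.elim _ _
      simp [this]
    -- `Y` is rectangular. Each row `Y k`, placed in row `p₀` of a square zero matrix, gives `m k`,
    -- and `Y* Y = ∑ (m k)* (m k)`.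
    let m : n j → Matrix (n i) (n i) D := fun k ↦ Matrix.of fun p q ↦ if p = p₀ then Y k q else 0
    have e : Φ (star (l j y) * l j y) = ∑ k, star (m k) * m k := by
      ext p q
      rw [Φ_apply, hY, Matrix.sum_apply]
      refine Finset.sum_congr rfl fun k _ ↦ ?_
      rw [Matrix.mul_apply, Finset.sum_eq_single p₀]
      · simp [m, Matrix.star_apply]
      · intro b _ hb
        simp [m, Matrix.star_apply, hb]
      · simp
    have h1 : ∀ k, 0 ≤ (φ (star (m k) * m k)).re ∧ (φ (star (m k) * m k)).im = 0 := fun k ↦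
      φP _ (SpectrallyNonneg.star_mul_self (H.matrix (n := n i)) _)
    rw [Set.mem_ofPred_eq, e, map_sum, Complex.re_sum, Complex.im_sum]
    exact ⟨Finset.sum_nonneg fun k _ ↦ (h1 k).1, Finset.sum_eq_zero fun k _ ↦ (h1 k).2⟩
  · obtain ⟨x, hx⟩ := exists_inr_smul_eq ⟨_, v, hf⟩ hf w
    exact ⟨x, by rw [hx]; exact hf⟩

end Corner

/-! ### Peter–Weyl theory on a compact group through reproducing kernels -/

namespace CompactGroup

open MeasureTheory MeasureTheory.Measure Topology
open scoped ENNReal NNReal ComplexConjugate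

variable {K : Type*} [Group K] [TopologicalSpace K] [IsTopologicalGroup K] [CompactSpace K]
  [MeasurableSpace K] [BorelSpace K] {κ : Measure K} [IsHaarMeasure κ] [Regular κ]
  [IsProbabilityMeasure κ]

/-- Right translation multiplies the measure by the modular character but preserves the finite total
mass. -/
lemma modularCharacterFun_eq_one (κ : Measure K) [IsHaarMeasure κ] [Regular κ]
    [IsProbabilityMeasure κ] (k : K) : modularCharacterFun k = 1 := by
  have h := congrArg (fun m : Measure K ↦ m Set.univ) (GroupAlgebraL1.map_mul_right κ k)
  simp only [Measure.smul_apply, smul_eq_mul] at h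
  rw [map_apply (measurable_mul_const k) MeasurableSet.univ, Set.preimage_univ, measure_univ,
    mul_one] at h
  exact_mod_cast h.symm

instance : IsMulRightInvariant κ := by
  refine ⟨fun k ↦ ?_⟩
  rw [GroupAlgebraL1.map_mul_right κ k, modularCharacterFun_eq_one κ]
  simp

instance : IsInvInvariant κ := by
  have h : ∀ x : K, (modularCharacterFun x : ℝ≥0∞) = 1 := fun x ↦ by
    simp [modularCharacterFun_eq_one κ]
  have h1 : GroupAlgebraL1.invMeasure κ = κ.inv := by
    simp only [GroupAlgebraL1.invMeasure, h]
    rw [← Pi.one_def, withDensity_one]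
  have h2 : Regular κ.inv := Regular.map (Homeomorph.inv K)
  have h3 : Regular (GroupAlgebraL1.invMeasure κ) := by rw [h1]; exact h2
  have h4 := isMulLeftInvariant_eq_smul_of_regular (GroupAlgebraL1.invMeasure κ) κ
  rw [GroupAlgebraL1.haarScalarFactor_invMeasure, one_smul] at h4
  exact ⟨h1.symm.trans h4⟩

lemma integrable (κ : Measure K) [IsFiniteMeasureOnCompacts κ] {E : Type*} [NormedAddCommGroup E]
    {f : K → E} (hf : Continuous f) : Integrable f κ :=
  hf.integrable_of_hasCompactSupport (HasCompactSupport.of_compactSpace f)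

variable (κ) in
/-- A finite orthonormal family of continuous functions on a compact group, spanning a space of
functions which is invariant under right translations. The latter is expressed through the
reproducing kernel. -/
structure ReproducingSystem where
  /-- the number of functions -/
  card : ℕ
  /-- the functions -/
  toFun : Fin card → C(K, ℂ)
  orthonormal : ∀ i j, ∫ x, conj (toFun i x) * toFun j x ∂κ = if i = j then 1 else 0
  kernel_mul_right : ∀ x y k, ∑ j, toFun j (x * k) * conj (toFun j (y * k)) =
    ∑ j, toFun j x * conj (toFun j y)

variable (κ) in
/-- The inclusion of the continuous functions into `L²`. -/
noncomputable abbrev toL2 : C(K, ℂ) →L[ℂ] Lp ℂ 2 κ := ContinuousMap.toLp 2 κ ℂ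

lemma toL2_injective : Function.Injective (toL2 κ) := ContinuousMap.toLp_injective κ

lemma inner_toL2 (f g : C(K, ℂ)) : inner ℂ (toL2 κ f) (toL2 κ g) = ∫ x, conj (f x) * g x ∂κ := by
  rw [ContinuousMap.inner_toLp]
  simp_rw [mul_comm]

lemma norm_toL2_one : ‖toL2 κ 1‖ = 1 := by
  have h := inner_self_eq_norm_sq (𝕜 := ℂ) (toL2 κ 1)
  rw [inner_toL2] at h
  have h2 : ‖toL2 κ 1‖ ^ 2 = 1 := by rw [← h]; simp
  nlinarith [norm_nonneg (toL2 κ 1)]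

lemma integral_norm_le_norm_toL2 (f : C(K, ℂ)) : ∫ x, ‖f x‖ ∂κ ≤ ‖toL2 κ f‖ := by
  let a : C(K, ℂ) := ⟨fun x ↦ (‖f x‖ : ℂ), by fun_prop⟩
  have h1 : inner ℂ (toL2 κ 1) (toL2 κ a) = ((∫ x, ‖f x‖ ∂κ : ℝ) : ℂ) := by
    rw [inner_toL2, ← integral_complex_ofReal]
    simp [a]
  have h2 : ‖toL2 κ a‖ = ‖toL2 κ f‖ := by
    have e : inner ℂ (toL2 κ a) (toL2 κ a) = inner ℂ (toL2 κ f) (toL2 κ f) := by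
      rw [inner_toL2, inner_toL2]
      congr with x
      simp only [a, ContinuousMap.coe_mk, Complex.conj_ofReal]
      rw [mul_comm (conj (f x)), Complex.mul_conj, Complex.normSq_eq_norm_sq]
      push_cast; ring
    have e' := congrArg RCLike.re e
    rw [inner_self_eq_norm_sq, inner_self_eq_norm_sq] at e'
    exact (pow_left_inj₀ (norm_nonneg _) (norm_nonneg _) two_ne_zero).1 e'
  have h3 := norm_inner_le_norm (𝕜 := ℂ) (toL2 κ 1) (toL2 κ a)
  rw [h1, h2, norm_toL2_one, one_mul, Complex.norm_real] at h3
  exact (le_abs_self _).trans h3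

/-- Right translation of continuous functions. -/
noncomputable def translate (k : K) (f : C(K, ℂ)) : C(K, ℂ) := f.comp ⟨fun x ↦ x * k, by fun_prop⟩

@[simp] lemma translate_apply (k : K) (f : C(K, ℂ)) (x : K) : translate k f x = f (x * k) := rfl

/-- A finite-dimensional right-invariant space of continuous functions has a reproducing system
which computes the best approximation. -/
lemma exists_reproducingSystem (W : Submodule ℂ C(K, ℂ)) [FiniteDimensional ℂ W]
    (hW : ∀ k, ∀ f ∈ W, translate k f ∈ W) : ∃ S : ReproducingSystem κ, ∀ φ : C(K, ℂ), ∀ w ∈ W,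
      ∫ x, ‖φ x - ∑ j, S.toFun j x * ∫ y, conj (S.toFun j y) * φ y ∂κ‖ ∂κ ≤
        ‖toL2 κ φ - toL2 κ w‖ := by
  let W' : Submodule ℂ (Lp ℂ 2 κ) := W.map (toL2 κ).toLinearMap
  have : FiniteDimensional ℂ W' := inferInstanceAs (FiniteDimensional ℂ (W.map _))
  let b := stdOrthonormalBasis ℂ W'
  have hb : ∀ i, ∃ f ∈ W, toL2 κ f = b i := fun i ↦ (b i).2
  choose ζ hζW hζ using hb
  have horth : ∀ i j, ∫ x, conj (ζ i x) * ζ j x ∂κ = if i = j then 1 else 0 := by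
    intro i j
    rw [← inner_toL2, hζ, hζ, ← Submodule.coe_inner, orthonormal_iff_ite.1 b.orthonormal]
  have hspan : ∀ f ∈ W, f = ∑ i, (∫ x, conj (ζ i x) * f x ∂κ) • ζ i := by
    intro f hf
    refine toL2_injective (κ := κ) ?_
    have h1 := b.sum_repr' ⟨toL2 κ f, f, hf, rfl⟩
    have h2 := congrArg Subtype.val h1
    simp only [Submodule.coe_inner, AddSubmonoidClass.coe_finsetSum, Submodule.coe_smul] at h2
    rw [← h2, _root_.map_sum]
    refine Finset.sum_congr rfl fun i _ ↦ ?_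
    rw [map_smul, hζ, ← hζ i, inner_toL2]
  let S : ReproducingSystem κ :=
    { card := _
      toFun := ζ
      orthonormal := horth
      kernel_mul_right := by
        intro x y k
        -- `U` is the matrix of right translation by `k`. Translation preserves inner products, so
        -- `U` is unitary, and `U U* = 1` is the invariance of the kernel.
        let U : Matrix (Fin (Module.finrank ℂ W')) (Fin (Module.finrank ℂ W')) ℂ :=
          Matrix.of fun j i ↦ ∫ x, conj (ζ j x) * ζ i (x * k) ∂κ
        have hU : ∀ i x, ζ i (x * k) = ∑ j, U j i * ζ j x := by
          intro i x
          have h := congrArg (fun f : C(K, ℂ) ↦ f x) (hspan _ (hW k _ (hζW i)))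
          simpa [ContinuousMap.sum_apply, U] using h
        have hUU : U.conjTranspose * U = 1 := by
          ext i j
          have e : ∫ x, conj (ζ i (x * k)) * ζ j (x * k) ∂κ = if i = j then 1 else 0 :=
            (integral_mul_right_eq_self (fun x ↦ conj (ζ i x) * ζ j x) k).trans (horth i j)
          rw [Matrix.one_apply, ← e]
          have e2 : ∀ x, conj (ζ i (x * k)) * ζ j (x * k) =
              ∑ l, U l j * (conj (ζ i (x * k)) * ζ l x) := by
            intro x
            rw [hU j, Finset.mul_sum]
            exact Finset.sum_congr rfl fun l _ ↦ by ring
          simp_rw [e2]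
          rw [integral_finsetSum _ fun l _ ↦ integrable κ (by fun_prop)]
          rw [Matrix.mul_apply]
          refine Finset.sum_congr rfl fun l _ ↦ ?_
          rw [integral_const_mul, mul_comm, Matrix.conjTranspose_apply]
          congr 1
          simp only [U, Matrix.of_apply, RCLike.star_def, ← integral_conj]
          congr with x
          simp [mul_comm]
        have hUU' : U * U.conjTranspose = 1 := mul_eq_one_comm.1 hUU
        have e3 : ∀ j l, ∑ i, U j i * conj (U l i) = if j = l then 1 else 0 := by
          intro j l
          have := congrFun (congrFun hUU' j) l
          rwa [Matrix.mul_apply, Matrix.one_apply] at this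
        calc ∑ i, ζ i (x * k) * conj (ζ i (y * k))
            = ∑ i, ∑ j, ∑ l, U j i * conj (U l i) * (ζ j x * conj (ζ l y)) := by
              refine Finset.sum_congr rfl fun i _ ↦ ?_
              rw [hU i x, hU i y, _root_.map_sum, Finset.sum_mul_sum]
              refine Finset.sum_congr rfl fun j _ ↦ Finset.sum_congr rfl fun l _ ↦ ?_
              rw [map_mul]; ring
          _ = ∑ j, ∑ l, (∑ i, U j i * conj (U l i)) * (ζ j x * conj (ζ l y)) := by
              rw [Finset.sum_comm]
              refine Finset.sum_congr rfl fun j _ ↦ ?_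
              rw [Finset.sum_comm]
              exact Finset.sum_congr rfl fun l _ ↦ (Finset.sum_mul _ _ _).symm
          _ = _ := by simp [e3] }
  refine ⟨S, fun φ w hw ↦ ?_⟩
  -- `P` represents the orthogonal projection of `φ`, the best `L²` approximation; on a probability
  -- space the mean is bounded by the `L²` norm.
  let P : C(K, ℂ) := ∑ j, (∫ y, conj (ζ j y) * φ y ∂κ) • ζ j
  have h1 := integral_norm_le_norm_toL2 (κ := κ) (φ - P)
  have hP : toL2 κ P = W'.starProjection (toL2 κ φ) := by
    rw [b.starProjection_eq_sum_rankOne]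
    simp only [P, _root_.map_sum, map_smul, _root_.sum_apply,
      InnerProductSpace.rankOne_apply, ← hζ, inner_toL2]
  have h2 : ‖toL2 κ φ - toL2 κ P‖ ≤ ‖toL2 κ φ - toL2 κ w‖ := by
    rw [hP, Submodule.starProjection_minimal]
    exact ciInf_le ⟨0, by rintro _ ⟨_, rfl⟩; exact norm_nonneg _⟩
      (⟨toL2 κ w, w, hw, rfl⟩ : W')
  refine le_trans (le_of_eq ?_) (h1.trans ((congrArg norm (map_sub _ _ _)).le.trans h2))
  simp [P, ContinuousMap.sum_apply, S, mul_comm]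

/-- The map sending `x` to the function `y ↦ conj (ψ (x * y⁻¹))`. -/
noncomputable def kernelMap (ψ : C(K, ℂ)) : C(K, C(K, ℂ)) :=
  ContinuousMap.curry ⟨fun p ↦ conj (ψ (p.1 * p.2⁻¹)), by fun_prop⟩

@[simp] lemma kernelMap_apply (ψ : C(K, ℂ)) (x y : K) :
    kernelMap ψ x y = conj (ψ (x * y⁻¹)) := rfl

variable (κ) in
/-- The operator of convolution by a continuous function, from `L²` to continuous functions. -/
noncomputable def convOp (ψ : C(K, ℂ)) : Lp ℂ 2 κ →L[ℂ] C(K, ℂ) :=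
  LinearMap.mkContinuous
    { toFun := fun ξ ↦ ⟨fun x ↦ inner ℂ (toL2 κ (kernelMap ψ x)) ξ, by fun_prop⟩
      map_add' := fun ξ ξ' ↦ by ext x; simp [inner_add_right]
      map_smul' := fun c ξ ↦ by ext x; simp [inner_smul_right] } (‖toL2 κ‖ * ‖kernelMap ψ‖)
    (fun ξ ↦ (ContinuousMap.norm_le _ (by positivity)).2 fun x ↦ by
      refine (norm_inner_le_norm (𝕜 := ℂ) (toL2 κ (kernelMap ψ x)) ξ).trans ?_
      gcongr
      refine ((toL2 κ).le_opNorm _).trans ?_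
      gcongr
      exact ContinuousMap.norm_coe_le_norm _ _)

lemma convOp_apply (ψ : C(K, ℂ)) (ξ : Lp ℂ 2 κ) (x : K) :
    convOp κ ψ ξ x = inner ℂ (toL2 κ (kernelMap ψ x)) ξ := rfl

lemma convOp_toL2_apply (ψ f : C(K, ℂ)) (x : K) :
    convOp κ ψ (toL2 κ f) x = ∫ y, ψ (x * y⁻¹) * f y ∂κ := by
  rw [convOp_apply, inner_toL2]
  simp

/-- Arzelà–Ascoli: the image of the unit ball is bounded, and it is equicontinuous because `x ↦
kernelMap ψ x` is continuous into `L²`. -/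
lemma isCompactOperator_convOp (ψ : C(K, ℂ)) : IsCompactOperator (convOp κ ψ) := by
  let E := ContinuousMap.linearIsometryBoundedOfCompact K ℂ ℂ
  let A := E '' (convOp κ ψ '' Metric.ball 0 1)
  have hA : IsCompact (closure A) := by
    refine BoundedContinuousFunction.arzela_ascoli (Metric.closedBall 0 ‖convOp κ ψ‖)
      (isCompact_closedBall _ _) A ?_ ?_
    · rintro _ x ⟨_, ⟨ξ, hξ, rfl⟩, rfl⟩
      rw [mem_closedBall_zero_iff]
      refine ((convOp κ ψ ξ).norm_coe_le_norm x).trans (((convOp κ ψ).le_opNorm ξ).trans ?_)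
      exact mul_le_of_le_one_right (norm_nonneg _) (mem_ball_zero_iff.1 hξ).le
    · intro x₀
      refine Metric.equicontinuousAt_of_continuity_modulus
        (fun x ↦ ‖toL2 κ (kernelMap ψ x₀) - toL2 κ (kernelMap ψ x)‖) ?_ _ ?_
      · have : Continuous fun x ↦ ‖toL2 κ (kernelMap ψ x₀) - toL2 κ (kernelMap ψ x)‖ := by
          fun_prop
        simpa using this.tendsto x₀
      · refine Filter.Eventually.of_forall fun x ↦ ?_
        rintro ⟨_, ⟨_, ⟨ξ, hξ, rfl⟩, rfl⟩⟩
        change dist (convOp κ ψ ξ x₀) (convOp κ ψ ξ x) ≤ _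
        rw [dist_eq_norm, convOp_apply, convOp_apply, ← inner_sub_left]
        refine (norm_inner_le_norm (𝕜 := ℂ) _ _).trans ?_
        exact mul_le_of_le_one_right (norm_nonneg _) (mem_ball_zero_iff.1 hξ).le
  refine (isCompactOperator_iff_image_ball_subset_compact (convOp κ ψ).toLinearMap
    one_pos).2 ⟨E.symm '' closure A, hA.image E.symm.continuous, ?_⟩
  intro f hf
  exact ⟨E f, subset_closure ⟨f, hf, rfl⟩, by simp⟩

/-- Convolution by a function `ψ` with `ψ (x⁻¹) = conj (ψ x)` is a symmetric operator on `L²`. -/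
lemma isSymmetric_toL2_convOp {ψ : C(K, ℂ)} (hψ : ∀ x, ψ x⁻¹ = conj (ψ x)) :
    ((toL2 κ ∘L convOp κ ψ : Lp ℂ 2 κ →L[ℂ] Lp ℂ 2 κ) : Lp ℂ 2 κ →ₗ[ℂ] Lp ℂ 2 κ).IsSymmetric := by
  intro ξ ξ'
  refine (ContinuousMap.toLp_denseRange (p := 2) ℂ κ ℂ ENNReal.ofNat_ne_top).induction_on₂
    (p := fun ξ ξ' ↦ inner ℂ (toL2 κ (convOp κ ψ ξ)) ξ' = inner ℂ ξ (toL2 κ (convOp κ ψ ξ')))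
    (isClosed_eq (by fun_prop) (by fun_prop)) ?_ ξ ξ'
  intro f g
  rw [inner_toL2, inner_toL2]
  simp only [convOp_toL2_apply]
  simp_rw [← integral_conj, ← integral_const_mul, ← integral_mul_const]
  rw [integral_integral_swap_of_hasCompactSupport (by fun_prop)
    (HasCompactSupport.of_compactSpace _)]
  congr with y
  congr with x
  rw [map_mul, ← hψ, mul_inv_rev, inv_inv]
  ring

/-- The right-invariant finite-dimensional spaces of continuous functions. -/
def IsInvariantSpace (W : Submodule ℂ C(K, ℂ)) : Prop :=
  FiniteDimensional ℂ W ∧ ∀ k, ∀ f ∈ W, translate k f ∈ W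

-- Left convolution commutes with right translations. For finite dimension, the eigenspace embeds in
-- one of the compact operator `toL2 κ ∘L convOp κ ψ` on `L²`.
variable (κ) in
lemma isInvariantSpace_eigenspace (ψ : C(K, ℂ)) {z : ℂ}
    (hz : z ≠ 0) : IsInvariantSpace
      (Module.End.eigenspace ((convOp κ ψ ∘L toL2 κ : C(K, ℂ) →L[ℂ] C(K, ℂ)) :
        C(K, ℂ) →ₗ[ℂ] C(K, ℂ)) z) := by
  constructor
  · have hc : IsCompactOperator (toL2 κ ∘L convOp κ ψ) :=
      (isCompactOperator_convOp ψ).clm_comp (toL2 κ)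
    have := ContinuousLinearMap.finite_dimensional_eigenspace hc z hz
    refine FiniteDimensional.of_injective (LinearMap.restrict (toL2 κ).toLinearMap (q :=
      Module.End.eigenspace (toL2 κ ∘L convOp κ ψ).toLinearMap z) fun f hf ↦ ?_) ?_
    · rw [Module.End.mem_eigenspace_iff] at hf ⊢
      have := congrArg (toL2 κ) hf
      rw [map_smul] at this
      exact this
    · intro f g h
      exact Subtype.ext (toL2_injective (κ := κ) (congrArg Subtype.val h))
  · intro k f hf
    rw [Module.End.mem_eigenspace_iff] at hf ⊢
    ext x
    have h := congrArg (fun f : C(K, ℂ) ↦ f (x * k)) hf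
    change convOp κ ψ (toL2 κ f) (x * k) = z * f (x * k) at h
    change convOp κ ψ (toL2 κ (translate k f)) x = z * f (x * k)
    rw [← h, convOp_toL2_apply, convOp_toL2_apply,
      ← integral_mul_right_eq_self (fun y ↦ ψ (x * k * y⁻¹) * f y) k]
    simp [mul_assoc]

lemma IsInvariantSpace.sup {V W : Submodule ℂ C(K, ℂ)} (hV : IsInvariantSpace V)
    (hW : IsInvariantSpace W) : IsInvariantSpace (V ⊔ W) := by
  have := hV.1
  have := hW.1
  refine ⟨inferInstance, fun k f hf ↦ ?_⟩
  obtain ⟨v, hv, w, hw, rfl⟩ := Submodule.mem_sup.1 hf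
  exact Submodule.add_mem_sup (hV.2 k v hv) (hW.2 k w hw)

/-- The `L²` density part of the Peter–Weyl theorem. -/
lemma exists_isInvariantSpace_norm_lt (ξ : Lp ℂ 2 κ) {ε : ℝ} (hε : 0 < ε) :
    ∃ W : Submodule ℂ C(K, ℂ), IsInvariantSpace W ∧ ∃ w ∈ W, ‖ξ - toL2 κ w‖ < ε := by
  let U : Submodule ℂ (Lp ℂ 2 κ) :=
    { carrier := {v | ∃ W : Submodule ℂ C(K, ℂ), IsInvariantSpace W ∧ ∃ w ∈ W, toL2 κ w = v}
      zero_mem' := ⟨⊥, ⟨inferInstance, fun k f hf ↦ by simp_all; rfl⟩, 0, by simp, by simp⟩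
      add_mem' := by
        rintro _ _ ⟨V, hV, v, hv, rfl⟩ ⟨W, hW, w, hw, rfl⟩
        exact ⟨V ⊔ W, hV.sup hW, v + w, Submodule.add_mem_sup hv hw, map_add _ _ _⟩
      smul_mem' := by
        rintro c _ ⟨W, hW, w, hw, rfl⟩
        exact ⟨W, hW, c • w, W.smul_mem c hw, map_smul _ _ _⟩ }
  suffices h : Uᗮ = ⊥ by
    have h1 := (Submodule.topologicalClosure_eq_top_iff (K := U)).2 h
    have h2 : ξ ∈ U.topologicalClosure := h1 ▸ Submodule.mem_top
    obtain ⟨_, ⟨W, hW, w, hw, rfl⟩, h3⟩ := Metric.mem_closure_iff.1 h2 ε hε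
    exact ⟨W, hW, w, hw, by rwa [dist_eq_norm] at h3⟩
  rw [Submodule.eq_bot_iff]
  intro v hv
  -- Here the operator is compact and symmetric, and its eigenvectors for nonzero eigenvalues lie in
  -- `U`. So the image of `v` is orthogonal to every eigenspace and vanishes; the value of `convOp κ
  -- ψ v` at `1` is `⟨ψ, v⟩`.
  have key : ∀ ψ : C(K, ℂ), (∀ x, ψ x⁻¹ = conj (ψ x)) → inner ℂ (toL2 κ ψ) v = 0 := by
    intro ψ hψ
    have hs := isSymmetric_toL2_convOp (κ := κ) hψ
    have hc : IsCompactOperator (toL2 κ ∘L convOp κ ψ) :=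
      (isCompactOperator_convOp ψ).clm_comp (toL2 κ)
    have h0 : toL2 κ (convOp κ ψ v) = 0 := by
      rw [← Submodule.mem_bot ℂ,
        ← ContinuousLinearMap.orthogonalComplement_iSup_eigenspaces_eq_bot hc hs,
        Submodule.mem_orthogonal]
      intro u hu
      induction hu using Submodule.iSup_induction' with
      | zero => simp
      | add x y _ _ hx hy => rw [inner_add_left, hx, hy, add_zero]
      | mem z u hu =>
        rw [Module.End.mem_eigenspace_iff] at hu
        have h1 := hs u v
        change inner ℂ u (toL2 κ (convOp κ ψ v)) = 0
        rw [hu, inner_smul_left] at h1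
        refine h1.symm.trans ?_
        rcases eq_or_ne z 0 with rfl | hz
        · simp
        · rw [(Submodule.mem_orthogonal _ _).1 hv u ⟨_, isInvariantSpace_eigenspace κ ψ hz,
            z⁻¹ • convOp κ ψ u, ?_, ?_⟩, mul_zero]
          · refine Submodule.smul_mem _ _ ((Module.End.mem_eigenspace_iff).2 ?_)
            change convOp κ ψ ((toL2 κ ∘L convOp κ ψ).toLinearMap u) = _
            rw [hu, map_smul]
          · rw [map_smul]
            change z⁻¹ • ((toL2 κ ∘L convOp κ ψ).toLinearMap u) = _
            rw [hu, smul_smul, inv_mul_cancel₀ hz, one_smul]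
    have h1 : convOp κ ψ v = 0 := toL2_injective (κ := κ) (h0.trans (map_zero _).symm)
    have h2 := congrArg (fun f : C(K, ℂ) ↦ f 1) h1
    simp only [convOp_apply, ContinuousMap.zero_apply] at h2
    convert h2 using 3
    ext y
    simp [hψ]
  have key2 : ∀ φ : C(K, ℂ), inner ℂ (toL2 κ φ) v = 0 := by
    intro φ
    -- Both `φ + φ'` and `i (φ - φ')` have the symmetry required by `key`.
    let φ' : C(K, ℂ) := ⟨fun x ↦ conj (φ x⁻¹), by fun_prop⟩
    have h1 := key (φ + φ') fun x ↦ by simp [φ', add_comm]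
    have h2 := key (Complex.I • (φ - φ')) fun x ↦ by simp [φ']; ring
    rw [map_add, inner_add_left] at h1
    rw [map_smul, inner_smul_left, map_sub, inner_sub_left] at h2
    have h3 := (mul_eq_zero.1 h2).resolve_left (by simp)
    linear_combination (h1 + h3) / 2
  have := (ContinuousMap.toLp_denseRange (p := 2) ℂ κ ℂ ENNReal.ofNat_ne_top).induction_on
    (p := fun ξ : Lp ℂ 2 κ ↦ inner ℂ ξ v = 0) v (isClosed_eq (by fun_prop) (by fun_prop)) key2
  exact inner_self_eq_zero.1 this

/-- A compact set of continuous functions is approximated in mean by the projections of a single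
reproducing system. -/
theorem exists_reproducingSystem_approx {s : Set C(K, ℂ)} (hs : IsCompact s) {ε : ℝ} (hε : 0 < ε) :
    ∃ S : ReproducingSystem κ, ∀ φ ∈ s,
      ∫ x, ‖φ x - ∑ j, S.toFun j x * ∫ y, conj (S.toFun j y) * φ y ∂κ‖ ∂κ ≤ ε := by
  obtain ⟨W, hW, h⟩ : ∃ W : Submodule ℂ C(K, ℂ), IsInvariantSpace W ∧
      ∀ φ ∈ s, ∃ w ∈ W, ‖toL2 κ φ - toL2 κ w‖ ≤ ε := by
    -- An approximant of `φ` serves a whole neighbourhood of `φ`, and finitely many invariant spaces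
    -- lie in a single one, their supremum.
    refine hs.induction_on (p := fun s ↦ ∃ W : Submodule ℂ C(K, ℂ), IsInvariantSpace W ∧
      ∀ φ ∈ s, ∃ w ∈ W, ‖toL2 κ φ - toL2 κ w‖ ≤ ε) ?_ ?_ ?_ ?_
    · exact ⟨⊥, ⟨inferInstance, fun k f hf ↦ by simp_all; rfl⟩, by simp⟩
    · rintro s t hst ⟨W, hW, h⟩
      exact ⟨W, hW, fun φ hφ ↦ h φ (hst hφ)⟩
    · rintro s t ⟨V, hV, h⟩ ⟨W, hW, h'⟩
      refine ⟨V ⊔ W, hV.sup hW, fun φ hφ ↦ ?_⟩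
      rcases hφ with hφ | hφ
      · obtain ⟨w, hw, h⟩ := h φ hφ
        exact ⟨w, Submodule.mem_sup_left hw, h⟩
      · obtain ⟨w, hw, h⟩ := h' φ hφ
        exact ⟨w, Submodule.mem_sup_right hw, h⟩
    · intro φ _
      obtain ⟨W, hW, w, hw, h⟩ := exists_isInvariantSpace_norm_lt (toL2 κ φ) hε
      have ho : IsOpen {φ' : C(K, ℂ) | ‖toL2 κ φ' - toL2 κ w‖ < ε} :=
        isOpen_lt (by fun_prop) (by fun_prop)
      exact ⟨_, mem_nhdsWithin_of_mem_nhds (ho.mem_nhds h), W, hW,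
        fun φ' hφ' ↦ ⟨w, hw, le_of_lt hφ'⟩⟩
  have := hW.1
  obtain ⟨S, hS⟩ := exists_reproducingSystem (κ := κ) W hW.2
  refine ⟨S, fun φ hφ ↦ ?_⟩
  obtain ⟨w, hw, h⟩ := h φ hφ
  exact (hS φ w hw).trans h

end CompactGroup

/-! ### From compactly supported continuous functions to `L¹` -/

namespace GroupL1

open MeasureTheory MeasureTheory.Measure GroupAlgebraL1 CompactlySupported

variable {G : Type*} [Group G] [TopologicalSpace G] [IsTopologicalGroup G] [LocallyCompactSpace G]
  [MeasurableSpace G] [BorelSpace G] (μ : Measure G) [IsHaarMeasure μ] [Regular μ]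
  {H : Type*} [Group H] [TopologicalSpace H] [IsTopologicalGroup H] [LocallyCompactSpace H]
  [MeasurableSpace H] [BorelSpace H] (ν : Measure H) [IsHaarMeasure ν] [Regular ν]

lemma integral_mul_right_eq_modular_mul {f : G → ℂ} (hf : Continuous f) (g : G) :
    ∫ x, f (x * g) ∂μ = ((modularCharacterFun g : ℝ) : ℂ) * ∫ x, f x ∂μ := by
  borelize ℂ
  rw [← integral_map (φ := fun x ↦ x * g) (continuous_mul_const g).aemeasurable
    (hf.aestronglyMeasurable), GroupAlgebraL1.map_mul_right μ, integral_smul_measure]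
  simp

lemma integrable_cc (f : C_c(G, ℂ)) : Integrable f μ :=
  f.continuous.integrable_of_hasCompactSupport f.hasCompactSupport

/-- The class of a compactly supported continuous function. -/
noncomputable def ofCc : C_c(G, ℂ) →ₗ[ℂ] GroupL1 μ where
  toFun f := mk f (integrable_cc μ f)
  map_add' f g := Integrable.toL1_add _ _ (integrable_cc μ f) (integrable_cc μ g)
  map_smul' c f := Integrable.toL1_smul f (integrable_cc μ f) c

variable {μ}

lemma norm_ofCc (f : C_c(G, ℂ)) : ‖ofCc μ f‖ = ∫ x, ‖f x‖ ∂μ :=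
  L1.norm_of_fun_eq_integral_norm (integrable_cc μ f)

lemma denseRange_ofCc : DenseRange (ofCc μ) := by
  refine Metric.denseRange_iff.2 fun f r hr ↦ ?_
  obtain ⟨g, gs, hg, gc, gi⟩ := exists_approx f.integrable (half_pos hr)
  refine ⟨⟨⟨g, gc⟩, gs⟩, ?_⟩
  rw [dist_eq_norm, norm_eq]
  refine lt_of_le_of_lt (le_of_eq_of_le (integral_congr_ae ?_) hg) (half_lt_self hr)
  have h1 : (f - mk g gi : GroupL1 μ) =ᵐ[μ] (f : G → ℂ) - mk g gi := Lp.coeFn_sub _ _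
  filter_upwards [h1, coeFn_mk gi] with x h1 h2
  change ‖(f - mk g gi : GroupL1 μ) x‖ = _
  rw [h1, Pi.sub_apply, h2]

variable (μ) in
/-- Convolution of compactly supported continuous functions. -/
noncomputable def convCc (f g : C_c(G, ℂ)) : C_c(G, ℂ) where
  toFun := convFun μ f g
  continuous_toFun := continuous_conv f.continuous g.continuous f.hasCompactSupport
  hasCompactSupport' := hasCompactSupport_conv f.hasCompactSupport g.hasCompactSupport

lemma convCc_apply (f g : C_c(G, ℂ)) (x : G) :
    convCc μ f g x = ∫ y, f y * g (y⁻¹ * x) ∂μ := rfl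

lemma ofCc_mul (f g : C_c(G, ℂ)) : ofCc μ f * ofCc μ g = ofCc μ (convCc μ f g) :=
  mk_mul_mk (integrable_cc μ f) (integrable_cc μ g)

/-- The involution on compactly supported continuous functions. -/
noncomputable def involCc (f : C_c(G, ℂ)) : C_c(G, ℂ) where
  toFun := invol f
  continuous_toFun := by
    have := continuous_modular (G := G)
    have := f.continuous
    unfold invol
    fun_prop
  hasCompactSupport' := by
    refine HasCompactSupport.intro f.hasCompactSupport.isCompact.inv fun x hx ↦ ?_
    simp [invol, image_eq_zero_of_notMem_tsupport (f := f) (x := x⁻¹) (by simpa using hx)]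

lemma involCc_apply (f : C_c(G, ℂ)) (x : G) :
    involCc f x = ((modularCharacterFun x : ℝ) : ℂ) * (starRingEnd ℂ) (f x⁻¹) := rfl

lemma star_ofCc (f : C_c(G, ℂ)) : star (ofCc μ f) = ofCc μ (involCc f) := by
  refine ext ((coeFn_star _).trans ((invol_congr (coeFn_mk (integrable_cc μ f))).trans ?_))
  exact (coeFn_mk (integrable_cc μ (involCc f))).symm

/-- An operator on compactly supported continuous functions is bounded for the `L¹` norms. -/
def IsBoundedCc (μ : Measure G) (ν : Measure H) (T : C_c(G, ℂ) →ₗ[ℂ] C_c(H, ℂ)) : Prop :=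
  ∃ C : ℝ, ∀ f, ∫ x, ‖T f x‖ ∂ν ≤ C * ∫ x, ‖f x‖ ∂μ

variable (μ) in
/-- The extension to `L¹` of a bounded operator on compactly supported continuous functions. -/
noncomputable def extend (T : C_c(G, ℂ) →ₗ[ℂ] C_c(H, ℂ)) : GroupL1 μ →L[ℂ] GroupL1 ν :=
  (ofCc ν ∘ₗ T).extendOfNorm (ofCc μ)

lemma extend_ofCc {T : C_c(G, ℂ) →ₗ[ℂ] C_c(H, ℂ)} (hT : IsBoundedCc μ ν T) (f : C_c(G, ℂ)) :
    extend μ ν T (ofCc μ f) = ofCc ν (T f) := by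
  refine LinearMap.extendOfNorm_eq denseRange_ofCc ?_ f
  obtain ⟨C, hC⟩ := hT
  exact ⟨C, fun f ↦ by simpa only [LinearMap.comp_apply, norm_ofCc] using hC f⟩

end GroupL1

/-! ### Split extensions with compact kernel and Weil's formula -/

/-- A splitting topological group extension `1 → K → G → H → 1`. -/
structure SplitExtension (K G H : Type*) [Group K] [Group G] [Group H] [TopologicalSpace K]
    [TopologicalSpace G] [TopologicalSpace H] where
  /-- the inclusion of the kernel -/
  incl : K →* G
  /-- the projection -/
  proj : G →* H
  /-- the section -/
  sec : H →* G
  /-- the component in the kernel -/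
  fiber : G → K
  continuous_incl : Continuous incl
  continuous_proj : Continuous proj
  continuous_sec : Continuous sec
  continuous_fiber : Continuous fiber
  proj_incl : ∀ k, proj (incl k) = 1
  proj_sec : ∀ h, proj (sec h) = h
  incl_mul_sec : ∀ g, incl (fiber g) * sec (proj g) = g
  fiber_mul_sec : ∀ k h, fiber (incl k * sec h) = k

namespace CompactGroup

open MeasureTheory MeasureTheory.Measure

variable {K : Type*} [Group K] [TopologicalSpace K] [IsTopologicalGroup K] [CompactSpace K]
  [MeasurableSpace K] [BorelSpace K] {κ : Measure K} [IsFiniteMeasureOnCompacts κ]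
  {X : Type*} [Group X] [TopologicalSpace X] [IsTopologicalGroup X] [MeasurableSpace X]
  [BorelSpace X] {μ : Measure X} [IsFiniteMeasureOnCompacts μ]
  {E : Type*} [NormedAddCommGroup E] [NormedSpace ℝ E]

lemma continuous_integral {Y : Type*} [TopologicalSpace Y] {F : Y → K → E}
    (hF : Continuous F.uncurry) : Continuous fun x ↦ ∫ k, F x k ∂κ :=
  continuousOn_univ.1 (continuousOn_integral_of_compact_support isCompact_univ hF.continuousOn
    (by simp))

lemma integral_integral_swap {F : X → K → E} (hF : Continuous F.uncurry) {C : Set X}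
    (hC : IsCompact C) (h : ∀ x ∉ C, ∀ k, F x k = 0) :
    ∫ x, ∫ k, F x k ∂κ ∂μ = ∫ k, ∫ x, F x k ∂μ ∂κ :=
  integral_integral_swap_of_hasCompactSupport hF
    (HasCompactSupport.intro (hC.prod isCompact_univ) fun p hp ↦ h _ (by simpa using hp) _)

end CompactGroup

namespace SplitExtension

open MeasureTheory MeasureTheory.Measure CompactGroup
open scoped NNReal ENNReal Pointwise

variable {K G H : Type*} [Group K] [TopologicalSpace K] [IsTopologicalGroup K] [CompactSpace K]
  [Group G] [TopologicalSpace G] [IsTopologicalGroup G]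
  [Group H] [TopologicalSpace H] [IsTopologicalGroup H] (S : SplitExtension K G H)

attribute [fun_prop] continuous_incl continuous_proj continuous_sec continuous_fiber
attribute [simp] proj_incl proj_sec incl_mul_sec fiber_mul_sec

lemma exists_eq_sec_mul_incl (g : G) : ∃ k, g = S.sec (S.proj g) * S.incl k := by
  refine ⟨S.fiber ((S.sec (S.proj g))⁻¹ * g), ?_⟩
  have h := S.incl_mul_sec ((S.sec (S.proj g))⁻¹ * g)
  simp only [map_mul, map_inv, proj_sec, inv_mul_cancel, map_one, mul_one] at h
  rw [h, mul_inv_cancel_left]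

lemma surjective_proj : Function.Surjective S.proj := fun h ↦ ⟨S.sec h, S.proj_sec h⟩

lemma isCompact_preimage_proj_subset {C : Set H} (hC : IsCompact C) :
    ∃ D : Set G, IsCompact D ∧ S.proj ⁻¹' C ⊆ D := by
  refine ⟨(fun x : K × H ↦ S.incl x.1 * S.sec x.2) '' (Set.univ ×ˢ C),
    (isCompact_univ.prod hC).image (by fun_prop), fun g hg ↦ ?_⟩
  exact ⟨(S.fiber g, S.proj g), ⟨trivial, hg⟩, S.incl_mul_sec g⟩

lemma hasCompactSupport_comp_proj {E : Type*} [Zero E] {w : H → E} (hw : HasCompactSupport w)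
    (u : K → G → E) (hu : ∀ g, w (S.proj g) = 0 → u (S.fiber g) g = 0) :
    HasCompactSupport fun g ↦ u (S.fiber g) g := by
  obtain ⟨D, hD, h⟩ := S.isCompact_preimage_proj_subset hw
  exact HasCompactSupport.intro hD fun g hg ↦ hu g
    (image_eq_zero_of_notMem_tsupport fun h' ↦ hg (h h'))

/-- The saturation of the support of a function. -/
def saturation {E : Type*} [Zero E] (f : G → E) : Set G :=
  Set.range S.incl * tsupport f * Set.range S.incl

lemma isCompact_saturation {E : Type*} [Zero E] {f : G → E} (hf : HasCompactSupport f) :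
    IsCompact (S.saturation f) :=
  ((isCompact_range S.continuous_incl).mul hf).mul (isCompact_range S.continuous_incl)

lemma eq_zero_of_notMem_saturation {E : Type*} [Zero E] {f : G → E} {g : G}
    (hg : g ∉ S.saturation f) (x y : K) : f (S.incl x * g * S.incl y) = 0 := by
  contrapose! hg
  exact ⟨_, ⟨_, ⟨x⁻¹, rfl⟩, _, subset_tsupport _ hg, rfl⟩, _, ⟨y⁻¹, rfl⟩, by simp [mul_assoc]⟩

lemma eq_zero_of_notMem_saturation_left {E : Type*} [Zero E] {f : G → E} {g : G}
    (hg : g ∉ S.saturation f) (x : K) : f (S.incl x * g) = 0 := by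
  simpa using S.eq_zero_of_notMem_saturation hg x 1

lemma eq_zero_of_notMem_saturation_right {E : Type*} [Zero E] {f : G → E} {g : G}
    (hg : g ∉ S.saturation f) (x : K) : f (g * S.incl x) = 0 := by
  simpa using S.eq_zero_of_notMem_saturation hg 1 x

variable [LocallyCompactSpace G] [LocallyCompactSpace H]
  [MeasurableSpace K] [BorelSpace K] (κ : Measure K) [IsHaarMeasure κ] [Regular κ]
  [IsProbabilityMeasure κ]
  [MeasurableSpace G] [BorelSpace G] (μ : Measure G) [IsHaarMeasure μ] [Regular μ]
  [MeasurableSpace H] [BorelSpace H] (ν : Measure H) [IsHaarMeasure ν] [Regular ν]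

/-- The restriction `Δ` of the modular character to `K` satisfies `∫ Δ = ∫ Δ(k x) dx = Δ(k) ∫ Δ`,
with a finite positive integral. -/
lemma modularCharacterFun_incl (k : K) : modularCharacterFun (S.incl k) = 1 := by
  borelize K
  set κ : Measure K := haar
  have hc : Continuous fun x : K ↦ (modularCharacterFun (S.incl x) : ℝ) :=
    NNReal.continuous_coe.comp (GroupAlgebraL1.continuous_modular.comp S.continuous_incl)
  have h1 := integral_mul_left_eq_self (μ := κ)
    (fun x : K ↦ (modularCharacterFun (S.incl x) : ℝ)) k
  simp only [map_mul, GroupAlgebraL1.modular_mul, NNReal.coe_mul, integral_const_mul] at h1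
  have h2 : 0 < ∫ x : K, (modularCharacterFun (S.incl x) : ℝ) ∂κ :=
    hc.integral_pos_of_hasCompactSupport_nonneg_nonzero (HasCompactSupport.of_compactSpace _)
      (fun x ↦ NNReal.coe_nonneg _) (x := 1)
      (by exact_mod_cast (modularCharacterFun_pos (S.incl 1)).ne')
  exact_mod_cast mul_right_cancel₀ h2.ne' (h1.trans (one_mul _).symm)

lemma integral_mul_incl {E : Type*} [NormedAddCommGroup E] [NormedSpace ℝ E] {f : G → E}
    (hf : Continuous f) (hs : HasCompactSupport f) (k : K) :
    ∫ a, f (a * S.incl k) ∂μ = ∫ a, f a ∂μ := by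
  have h := GroupAlgebraL1.map_mul_right μ (S.incl k)
  rw [S.modularCharacterFun_incl, ENNReal.coe_one, one_smul] at h
  conv_rhs => rw [← h]
  refine (integral_map (by fun_prop) ?_).symm
  rw [h]
  exact (hf.integrable_of_hasCompactSupport hs).1

/-- The projection is proper because `K` is compact, so it pushes Haar measure forward to a Haar
measure, which is unique up to a scalar on continuous functions with compact support. -/
lemma exists_integral_comp_proj : ∃ c : ℝ, 0 < c ∧ ∀ w : H → ℂ, Continuous w →
    HasCompactSupport w → ∫ a, w (S.proj a) ∂μ = c * ∫ h, w h ∂ν := by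
  have hm : IsHaarMeasure (μ.map S.proj) := by
    refine isHaarMeasure_map μ S.proj S.continuous_proj S.surjective_proj ?_
    intro s hs
    obtain ⟨t, ht, hts⟩ := Filter.mem_cocompact.1 hs
    obtain ⟨D, hD, h⟩ := S.isCompact_preimage_proj_subset ht
    exact Filter.mem_cocompact.2 ⟨D, hD, fun g hg ↦ hts fun h' ↦ hg (h h')⟩
  refine ⟨haarScalarFactor (μ.map S.proj) ν, haarScalarFactor_pos_of_isHaarMeasure _ _, ?_⟩
  have key : ∀ w : H → ℝ, Continuous w → HasCompactSupport w →
      ∫ h, w h ∂(μ.map S.proj) = (haarScalarFactor (μ.map S.proj) ν : ℝ) * ∫ h, w h ∂ν := by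
    intro w hw hs
    rw [integral_isMulLeftInvariant_eq_smul_of_hasCompactSupport (μ.map S.proj) ν hw hs,
      integral_smul_nnreal_measure]
    rfl
  intro w hw hs
  rw [← integral_map S.continuous_proj.aemeasurable hw.aestronglyMeasurable,
    ← integral_re_add_im (𝕜 := ℂ) (hw.integrable_of_hasCompactSupport hs),
    ← integral_re_add_im (𝕜 := ℂ) (μ := ν) (hw.integrable_of_hasCompactSupport hs),
    key (fun h ↦ RCLike.re (w h)) (by fun_prop) (hs.comp_left (map_zero (RCLike.re (K := ℂ)))),
    key (fun h ↦ RCLike.im (w h)) (by fun_prop) (hs.comp_left (map_zero (RCLike.im (K := ℂ))))]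
  have e : ∀ a b c : ℝ, ((c * a : ℝ) : ℂ) + ((c * b : ℝ) : ℂ) * Complex.I =
      (c : ℂ) * ((a : ℂ) + (b : ℂ) * Complex.I) := fun a b c ↦ by push_cast; ring
  exact e _ _ _

/-- The constant in Weil's formula. -/
noncomputable def const : ℝ := (S.exists_integral_comp_proj μ ν).choose

lemma const_pos : 0 < S.const μ ν := (S.exists_integral_comp_proj μ ν).choose_spec.1

lemma integral_comp_proj {w : H → ℂ} (hw : Continuous w) (hs : HasCompactSupport w) :
    ∫ a, w (S.proj a) ∂μ = S.const μ ν * ∫ h, w h ∂ν :=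
  (S.exists_integral_comp_proj μ ν).choose_spec.2 w hw hs

/-- Weil's integration formula, with the kernel on the right. -/
lemma integral_eq_right {f : G → ℂ} (hf : Continuous f) (hs : HasCompactSupport f) :
    ∫ a, f a ∂μ = S.const μ ν * ∫ h, ∫ y, f (S.sec h * S.incl y) ∂κ ∂ν := by
  -- Averaging `f` over `K` does not change its integral, and the average factors through the
  -- projection.
  have h1 : ∫ a, ∫ y, f (a * S.incl y) ∂κ ∂μ = ∫ a, f a ∂μ := by
    rw [CompactGroup.integral_integral_swap (by fun_prop) (S.isCompact_saturation hs)
      (fun g hg k ↦ S.eq_zero_of_notMem_saturation_right hg k)]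
    simp [S.integral_mul_incl μ hf hs]
  rw [← h1, ← S.integral_comp_proj μ ν (continuous_integral (by fun_prop))]
  · congr with a
    obtain ⟨k, hk⟩ := S.exists_eq_sec_mul_incl a
    conv_lhs => rw [hk]
    simp_rw [mul_assoc, ← map_mul]
    exact integral_mul_left_eq_self (fun y ↦ f (S.sec (S.proj a) * S.incl y)) k
  · refine HasCompactSupport.intro ((S.isCompact_saturation hs).image S.continuous_proj)
      fun h hh ↦ ?_
    have : S.sec h ∉ S.saturation f := fun h' ↦ hh ⟨_, h', S.proj_sec h⟩
    simp [S.eq_zero_of_notMem_saturation_right this]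

/-- Weil's integration formula, with the kernel on the left. -/
lemma integral_eq_left {f : G → ℂ} (hf : Continuous f) (hs : HasCompactSupport f) :
    ∫ a, f a ∂μ = S.const μ ν * ∫ h, ∫ y, f (S.incl y * S.sec h) ∂κ ∂ν := by
  have h1 : ∫ a, ∫ y, f (S.incl y * a) ∂κ ∂μ = ∫ a, f a ∂μ := by
    rw [CompactGroup.integral_integral_swap (by fun_prop) (S.isCompact_saturation hs)
      (fun g hg k ↦ S.eq_zero_of_notMem_saturation_left hg k)]
    simp [integral_mul_left_eq_self]
  rw [← h1, ← S.integral_comp_proj μ ν (continuous_integral (by fun_prop))]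
  · congr with a
    conv_lhs => rw [← S.incl_mul_sec a]
    simp_rw [← mul_assoc, ← map_mul]
    exact integral_mul_right_eq_self (fun y ↦ f (S.incl y * S.sec (S.proj a))) _
  · refine HasCompactSupport.intro ((S.isCompact_saturation hs).image S.continuous_proj)
      fun h hh ↦ ?_
    have : S.sec h ∉ S.saturation f := fun h' ↦ hh ⟨_, h', S.proj_sec h⟩
    simp [S.eq_zero_of_notMem_saturation_left this]

/-- Both characters measure the effect of the same right translation on the integral of a function
pulled back from `H`. -/
lemma modularCharacterFun_proj (g : G) :
    modularCharacterFun (S.proj g) = modularCharacterFun g := by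
  borelize G H
  set μ : Measure G := haar
  set ν : Measure H := haar
  obtain ⟨⟨f, f_cont⟩, f_comp, f_nonneg, f_one⟩ :
    ∃ f : C(H, ℝ), HasCompactSupport f ∧ 0 ≤ f ∧ f 1 ≠ 0 := exists_continuous_nonneg_pos 1
  have f_cont' : Continuous f := f_cont
  have f_comp' : HasCompactSupport f := f_comp
  have hpos : 0 < ∫ x, f x ∂ν :=
    f_cont'.integral_pos_of_hasCompactSupport_nonneg_nonzero f_comp' f_nonneg f_one
  have hf : Continuous fun h ↦ (f h : ℂ) := by fun_prop
  have hs : HasCompactSupport fun h ↦ (f h : ℂ) := f_comp'.comp_left (g := Complex.ofReal) rfl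
  have h1 := GroupL1.integral_mul_right_eq_modular_mul ν hf (S.proj g)
  have h2 := GroupL1.integral_mul_right_eq_modular_mul μ (hf.comp S.continuous_proj) g
  have h3 := S.integral_comp_proj μ ν (w := fun h ↦ (f (h * S.proj g) : ℂ)) (by fun_prop)
    (hs.comp_homeomorph (Homeomorph.mulRight (S.proj g)))
  simp only [Function.comp_apply, map_mul, S.integral_comp_proj μ ν hf hs] at h2
  rw [h2, h1, integral_complex_ofReal] at h3
  have h4 : (modularCharacterFun g : ℝ) * (S.const μ ν * ∫ x, f x ∂ν) =
      S.const μ ν * (modularCharacterFun (S.proj g) * ∫ x, f x ∂ν) := by exact_mod_cast h3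
  have h5 : S.const μ ν * ∫ x, f x ∂ν ≠ 0 := (mul_pos (S.const_pos μ ν) hpos).ne'
  have h6 : (modularCharacterFun g : ℝ) = modularCharacterFun (S.proj g) :=
    mul_right_cancel₀ h5 (by rw [h4]; ring)
  exact_mod_cast h6.symm

end SplitExtension

namespace CompactGroup

open MeasureTheory MeasureTheory.Measure

variable {K : Type*} [Group K] [TopologicalSpace K] [IsTopologicalGroup K] [CompactSpace K]
  [MeasurableSpace K] [BorelSpace K] {κ : Measure K} [IsFiniteMeasureOnCompacts κ]
  {X : Type*} [Group X] [TopologicalSpace X] [IsTopologicalGroup X] [MeasurableSpace X]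
  [BorelSpace X] {μ : Measure X} [IsFiniteMeasureOnCompacts μ]
  {E : Type*} [NormedAddCommGroup E] [NormedSpace ℝ E]

lemma integrable_integral {F : X → K → E} (hF : Continuous F.uncurry) {C : Set X}
    (hC : IsCompact C) (h : ∀ x ∉ C, ∀ k, F x k = 0) : Integrable (fun x ↦ ∫ k, F x k ∂κ) μ :=
  (continuous_integral hF).integrable_of_hasCompactSupport
    (HasCompactSupport.intro hC fun x hx ↦ by simp [h x hx])

lemma integral_norm_integral_le {F : X → K → E} (hF : Continuous F.uncurry) {C : Set X}
    (hC : IsCompact C) (h : ∀ x ∉ C, ∀ k, F x k = 0) :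
    ∫ x, ‖∫ k, F x k ∂κ‖ ∂μ ≤ ∫ x, ∫ k, ‖F x k‖ ∂κ ∂μ :=
  integral_mono (integrable_integral hF hC h).norm
    (integrable_integral (by fun_prop) hC fun x hx k ↦ by simp [h x hx])
    fun x ↦ norm_integral_le_integral_norm _

end CompactGroup

/-! ### Convolution along the fibres, for continuous functions -/

namespace SplitExtension

open MeasureTheory MeasureTheory.Measure CompactGroup CompactlySupported GroupL1
open scoped NNReal ENNReal Pointwise ComplexConjugate

variable {K G H : Type*} [Group K] [TopologicalSpace K] [IsTopologicalGroup K] [CompactSpace K]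
  [Group G] [TopologicalSpace G] [IsTopologicalGroup G]
  [Group H] [TopologicalSpace H] [IsTopologicalGroup H] (S : SplitExtension K G H)
  [MeasurableSpace K] [BorelSpace K] (κ : Measure K) [IsHaarMeasure κ] [Regular κ]
  [IsProbabilityMeasure κ]

/-- Left convolution by a function on the kernel. -/
noncomputable def leftConv (u : C(K, ℂ)) : C_c(G, ℂ) →ₗ[ℂ] C_c(G, ℂ) where
  toFun f :=
    { toFun := fun g ↦ ∫ x, u x * f (S.incl x⁻¹ * g) ∂κ
      continuous_toFun := continuous_integral (by fun_prop)
      hasCompactSupport' := HasCompactSupport.intro (S.isCompact_saturation f.hasCompactSupport)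
        fun g hg ↦ by simp [-map_inv, S.eq_zero_of_notMem_saturation_left hg] }
  map_add' f g := by
    ext a
    change ∫ x, u x * (f _ + g _) ∂κ = ∫ x, u x * f _ ∂κ + ∫ x, u x * g _ ∂κ
    simp_rw [mul_add]
    exact integral_add (integrable κ (by fun_prop)) (integrable κ (by fun_prop))
  map_smul' c f := by
    ext a
    change ∫ x, u x * (c * f _) ∂κ = c * ∫ x, u x * f _ ∂κ
    simp_rw [mul_left_comm _ c, integral_const_mul]

/-- Right convolution by a function on the kernel. -/
noncomputable def rightConv (u : C(K, ℂ)) : C_c(G, ℂ) →ₗ[ℂ] C_c(G, ℂ) where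
  toFun f :=
    { toFun := fun g ↦ ∫ x, u x * f (g * S.incl x⁻¹) ∂κ
      continuous_toFun := continuous_integral (by fun_prop)
      hasCompactSupport' := HasCompactSupport.intro (S.isCompact_saturation f.hasCompactSupport)
        fun g hg ↦ by simp [-map_inv, S.eq_zero_of_notMem_saturation_right hg] }
  map_add' f g := by
    ext a
    change ∫ x, u x * (f _ + g _) ∂κ = ∫ x, u x * f _ ∂κ + ∫ x, u x * g _ ∂κ
    simp_rw [mul_add]
    exact integral_add (integrable κ (by fun_prop)) (integrable κ (by fun_prop))
  map_smul' c f := by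
    ext a
    change ∫ x, u x * (c * f _) ∂κ = c * ∫ x, u x * f _ ∂κ
    simp_rw [mul_left_comm _ c, integral_const_mul]

/-- The coefficient of a function along the fibres of the extension. -/
noncomputable def coeff (u : C(K, ℂ)) : C_c(G, ℂ) →ₗ[ℂ] C_c(H, ℂ) where
  toFun f :=
    { toFun := fun h ↦ ∫ x, u x * f (S.incl x * S.sec h) ∂κ
      continuous_toFun := continuous_integral (by fun_prop)
      hasCompactSupport' := HasCompactSupport.intro
        ((S.isCompact_saturation f.hasCompactSupport).image S.continuous_proj) fun h hh ↦ by
          have : S.sec h ∉ S.saturation f := fun h' ↦ hh ⟨_, h', S.proj_sec h⟩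
          simp [S.eq_zero_of_notMem_saturation_left this] }
  map_add' f g := by
    ext a
    change ∫ x, u x * (f _ + g _) ∂κ = ∫ x, u x * f _ ∂κ + ∫ x, u x * g _ ∂κ
    simp_rw [mul_add]
    exact integral_add (integrable κ (by fun_prop)) (integrable κ (by fun_prop))
  map_smul' c f := by
    ext a
    change ∫ x, u x * (c * f _) ∂κ = c * ∫ x, u x * f _ ∂κ
    simp_rw [mul_left_comm _ c, integral_const_mul]

/-- The function on the extension with prescribed components. -/
noncomputable def tensor (u : C(K, ℂ)) : C_c(H, ℂ) →ₗ[ℂ] C_c(G, ℂ) where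
  toFun w :=
    { toFun := fun g ↦ u (S.fiber g) * w (S.proj g)
      continuous_toFun := by fun_prop
      hasCompactSupport' := S.hasCompactSupport_comp_proj w.hasCompactSupport
        (fun k g ↦ u k * w (S.proj g)) fun g hg ↦ by simp [hg] }
  map_add' f g := by ext a; simp [mul_add]
  map_smul' c f := by ext a; simp [mul_left_comm]

lemma leftConv_apply (u : C(K, ℂ)) (f : C_c(G, ℂ)) (g : G) :
    S.leftConv κ u f g = ∫ x, u x * f (S.incl x⁻¹ * g) ∂κ := rfl

lemma rightConv_apply (u : C(K, ℂ)) (f : C_c(G, ℂ)) (g : G) :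
    S.rightConv κ u f g = ∫ x, u x * f (g * S.incl x⁻¹) ∂κ := rfl

lemma coeff_apply (u : C(K, ℂ)) (f : C_c(G, ℂ)) (h : H) :
    S.coeff κ u f h = ∫ x, u x * f (S.incl x * S.sec h) ∂κ := rfl

lemma tensor_apply (u : C(K, ℂ)) (w : C_c(H, ℂ)) (g : G) :
    S.tensor u w g = u (S.fiber g) * w (S.proj g) := rfl

lemma rightConv_leftConv (u v : C(K, ℂ)) (f : C_c(G, ℂ)) :
    S.rightConv κ v (S.leftConv κ u f) = S.leftConv κ u (S.rightConv κ v f) := by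
  ext g
  simp only [rightConv_apply, leftConv_apply, ← integral_const_mul]
  rw [CompactGroup.integral_integral_swap (by fun_prop) isCompact_univ (by simp)]
  simp only [mul_left_comm, mul_assoc]

lemma coeff_tensor (u v : C(K, ℂ)) (w : C_c(H, ℂ)) :
    S.coeff κ u (S.tensor v w) = (∫ x, u x * v x ∂κ) • w := by
  ext h
  simp only [coeff_apply, tensor_apply, fiber_mul_sec, map_mul, proj_incl, proj_sec, one_mul,
    ← mul_assoc, integral_mul_const]
  rfl

variable {κ} in
/-- The reproducing kernel of a reproducing system, as a function on the group. -/
noncomputable def _root_.CompactGroup.ReproducingSystem.kernel (R : ReproducingSystem κ) :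
    C(K, ℂ) := ∑ j, conj (R.toFun j 1) • R.toFun j

variable {κ} in
lemma _root_.CompactGroup.ReproducingSystem.kernel_mul_inv (R : ReproducingSystem κ) (x y : K) :
    R.kernel (x * y⁻¹) = ∑ j, R.toFun j x * conj (R.toFun j y) := by
  rw [← R.kernel_mul_right x y y⁻¹]
  simp [ReproducingSystem.kernel, ContinuousMap.sum_apply, mul_comm]

variable {κ} in
lemma _root_.CompactGroup.ReproducingSystem.kernel_inv (R : ReproducingSystem κ) (x : K) :
    R.kernel x⁻¹ = conj (R.kernel x) := by
  have h1 := R.kernel_mul_inv 1 x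
  have h2 := R.kernel_mul_inv x 1
  rw [inv_one, mul_one] at h2
  rw [one_mul] at h1
  rw [h1, h2, _root_.map_sum]
  simp [mul_comm]

-- On each fibre, convolution by the kernel is the orthogonal projection onto the span of the
-- system.
variable {κ} in
lemma leftConv_kernel (R : ReproducingSystem κ) (f : C_c(G, ℂ)) :
    S.leftConv κ R.kernel f =
      ∑ j, S.tensor (R.toFun j) (S.coeff κ (star (R.toFun j)) f) := by
  ext g
  simp only [CompactlySupportedContinuousMap.sum_apply, leftConv_apply, tensor_apply, coeff_apply]
  rw [← integral_inv_eq_self,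
    ← integral_mul_right_eq_self _ (S.fiber g)⁻¹]
  simp only [mul_inv_rev, inv_inv, R.kernel_mul_inv, Finset.sum_mul]
  rw [integral_finsetSum _ fun j _ ↦ integrable κ (by fun_prop)]
  refine Finset.sum_congr rfl fun j _ ↦ ?_
  rw [← integral_const_mul]
  congr with x
  have : S.incl (x * (S.fiber g)⁻¹) * g = S.incl x * S.sec (S.proj g) := by
    rw [map_mul, mul_assoc, map_inv, mul_right_inj, inv_mul_eq_iff_eq_mul, S.incl_mul_sec]
  rw [this]
  simp [mul_assoc]

variable {κ} in
lemma rightConv_kernel (R : ReproducingSystem κ) (f : C_c(G, ℂ)) :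
    S.rightConv κ R.kernel f = ∑ j, conj (R.toFun j 1) • S.rightConv κ (R.toFun j) f := by
  ext g
  simp only [CompactlySupportedContinuousMap.sum_apply, CompactlySupportedContinuousMap.smul_apply,
    rightConv_apply, ReproducingSystem.kernel, ContinuousMap.sum_apply, Finset.sum_mul,
    ContinuousMap.smul_apply, smul_eq_mul]
  rw [integral_finsetSum _ fun j _ ↦ integrable κ (by fun_prop)]
  simp_rw [mul_assoc, integral_const_mul]

section Convolution

variable [LocallyCompactSpace G] [LocallyCompactSpace H]
  [MeasurableSpace G] [BorelSpace G] (μ : Measure G) [IsHaarMeasure μ] [Regular μ]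
  [MeasurableSpace H] [BorelSpace H] (ν : Measure H) [IsHaarMeasure ν] [Regular ν]

lemma rightConv_convCc (v : C(K, ℂ)) (f g : C_c(G, ℂ)) :
    S.rightConv κ v (convCc μ f g) = convCc μ f (S.rightConv κ v g) := by
  ext x
  simp only [rightConv_apply, convCc_apply, ← integral_const_mul]
  rw [← CompactGroup.integral_integral_swap (by fun_prop) f.hasCompactSupport
    fun a ha k ↦ by simp [image_eq_zero_of_notMem_tsupport ha]]
  simp only [mul_left_comm, mul_assoc]

lemma leftConv_convCc (u : C(K, ℂ)) (f g : C_c(G, ℂ)) :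
    S.leftConv κ u (convCc μ f g) = convCc μ (S.leftConv κ u f) g := by
  ext x
  simp only [leftConv_apply, convCc_apply, ← integral_const_mul, ← integral_mul_const]
  rw [CompactGroup.integral_integral_swap (by fun_prop)
    (S.isCompact_saturation f.hasCompactSupport)
    fun a ha k ↦ by simp [-map_inv, S.eq_zero_of_notMem_saturation_left ha]]
  congr with k
  rw [← integral_mul_left_eq_self _ (S.incl k⁻¹)]
  congr with a
  simp [mul_assoc]

lemma convCc_rightConv (v : C(K, ℂ)) (f g : C_c(G, ℂ)) :
    convCc μ (S.rightConv κ v f) g = convCc μ f (S.leftConv κ v g) := by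
  ext x
  simp only [leftConv_apply, rightConv_apply, convCc_apply, ← integral_const_mul,
    ← integral_mul_const]
  rw [CompactGroup.integral_integral_swap (by fun_prop)
    (S.isCompact_saturation f.hasCompactSupport)
    fun a ha k ↦ by simp [-map_inv, S.eq_zero_of_notMem_saturation_right ha],
    CompactGroup.integral_integral_swap (by fun_prop) f.hasCompactSupport
    fun a ha k ↦ by simp [image_eq_zero_of_notMem_tsupport ha]]
  congr with k
  rw [← S.integral_mul_incl μ (k := k) (by fun_prop)]
  · congr with a
    simp [mul_assoc, mul_left_comm]
  · refine HasCompactSupport.intro (S.isCompact_saturation f.hasCompactSupport) fun a ha ↦ ?_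
    simp [-map_inv, S.eq_zero_of_notMem_saturation_right ha]

lemma involCc_leftConv_involCc (u : C(K, ℂ)) (hu : ∀ x, u x⁻¹ = conj (u x)) (f : C_c(G, ℂ)) :
    involCc (S.leftConv κ u (involCc f)) = S.rightConv κ u f := by
  ext g
  simp only [involCc_apply, leftConv_apply, rightConv_apply]
  rw [← integral_conj, ← integral_const_mul, ← integral_inv_eq_self]
  congr with x
  have h : ((modularCharacterFun g : ℝ) : ℂ) * ((modularCharacterFun g⁻¹ : ℝ) : ℂ) = 1 := by
    rw [mul_comm]
    exact_mod_cast GroupAlgebraL1.modular_inv_mul g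
  simp only [inv_inv, map_mul, mul_inv_rev, GroupAlgebraL1.modular_mul, S.modularCharacterFun_incl,
    one_mul, Complex.conj_ofReal, Complex.conj_conj, hu, map_inv]
  linear_combination (u x * f (g * (S.incl x)⁻¹)) * h

/-- The involution exchanges the two indices of a coefficient, as for the adjoint of a matrix. -/
lemma coeff_rightConv_involCc (u v : C(K, ℂ)) (f : C_c(G, ℂ)) :
    S.coeff κ u (S.rightConv κ v (involCc f)) =
      involCc (S.coeff κ (star v) (S.rightConv κ (star u) f)) := by
  ext h
  have e : ∀ x y, (modularCharacterFun (S.incl x * S.sec h * S.incl y⁻¹) : ℝ≥0) =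
      modularCharacterFun h := fun x y ↦ by
    rw [← S.modularCharacterFun_proj]
    simp
  simp only [involCc_apply, coeff_apply, rightConv_apply, ← integral_const_mul, ← integral_conj, e]
  rw [CompactGroup.integral_integral_swap (by fun_prop) isCompact_univ (by simp)]
  congr with y
  congr with x
  simp only [mul_inv_rev, map_inv, inv_inv, ContinuousMap.star_apply, map_mul, RCLike.star_def,
    Complex.conj_conj, mul_assoc]
  ring

/-- The source of matrix multiplication: Weil's formula splits the convolution integral, the
integral over `K` turns `f` into `f * v`, and the one over `H` is a convolution with `w`. -/
lemma coeff_convCc_tensor (u v : C(K, ℂ)) (f : C_c(G, ℂ)) (w : C_c(H, ℂ)) :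
    S.coeff κ u (convCc μ f (S.tensor v w)) =
      (S.const μ ν : ℂ) • convCc ν (S.coeff κ u (S.rightConv κ v f)) w := by
  ext h
  have key : ∀ x, convCc μ f (S.tensor v w) (S.incl x * S.sec h) =
      S.const μ ν * ∫ a, ∫ y, f (S.incl x * (S.sec a * S.incl y⁻¹)) * (v y * w (a⁻¹ * h)) ∂κ ∂ν := by
    intro x
    rw [convCc_apply, ← integral_mul_left_eq_self _ (S.incl x), S.integral_eq_right κ μ ν]
    · congr with a
      rw [← integral_inv_eq_self]
      congr with y
      have e : (S.incl x * (S.sec a * S.incl y⁻¹))⁻¹ * (S.incl x * S.sec h) =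
          S.incl y * S.sec (a⁻¹ * h) := by simp [mul_assoc]
      rw [e, tensor_apply, fiber_mul_sec]
      simp
    · fun_prop
    · exact HasCompactSupport.mul_right
        (f.hasCompactSupport.comp_homeomorph (Homeomorph.mulLeft (S.incl x)))
  simp only [coeff_apply, key, CompactlySupportedContinuousMap.smul_apply, convCc_apply,
    smul_eq_mul, rightConv_apply, mul_left_comm (u _), integral_const_mul]
  congr 1
  simp_rw [← integral_const_mul, ← integral_mul_const]
  rw [← CompactGroup.integral_integral_swap ?_
    ((S.isCompact_saturation f.hasCompactSupport).image S.continuous_proj)]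
  · congr with a
    congr with x
    congr with y
    simp only [mul_assoc]
    ring
  · intro a ha x
    have : S.sec a ∉ S.saturation f := fun h' ↦ ha ⟨_, h', S.proj_sec a⟩
    simp [-map_inv, ← mul_assoc, S.eq_zero_of_notMem_saturation this]
  · refine (continuous_integral (κ := κ) (Y := H × K) (F := fun p y ↦
      u p.2 * (f (S.incl p.2 * (S.sec p.1 * S.incl y⁻¹)) * (v y * w (p.1⁻¹ * h)))) ?_).congr ?_
    · fun_prop
    · exact fun _ ↦ rfl

lemma isBoundedCc_leftConv (u : C(K, ℂ)) : IsBoundedCc μ μ (S.leftConv κ u) := by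
  refine ⟨∫ x, ‖u x‖ ∂κ, fun f ↦ ?_⟩
  have h0 : ∀ a ∉ S.saturation f, ∀ k, u k * f (S.incl k⁻¹ * a) = 0 := fun a ha k ↦ by
    simp [-map_inv, S.eq_zero_of_notMem_saturation_left ha]
  have hc := S.isCompact_saturation f.hasCompactSupport
  refine (integral_norm_integral_le (by fun_prop) hc h0).trans (le_of_eq ?_)
  rw [CompactGroup.integral_integral_swap (by fun_prop) hc fun a ha k ↦ by rw [h0 a ha, norm_zero]]
  simp_rw [norm_mul, integral_const_mul, integral_mul_left_eq_self (fun a ↦ ‖f a‖),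
    integral_mul_const]

lemma isBoundedCc_rightConv (u : C(K, ℂ)) : IsBoundedCc μ μ (S.rightConv κ u) := by
  refine ⟨∫ x, ‖u x‖ ∂κ, fun f ↦ ?_⟩
  have h0 : ∀ a ∉ S.saturation f, ∀ k, u k * f (a * S.incl k⁻¹) = 0 := fun a ha k ↦ by
    simp [-map_inv, S.eq_zero_of_notMem_saturation_right ha]
  have hc := S.isCompact_saturation f.hasCompactSupport
  refine (integral_norm_integral_le (by fun_prop) hc h0).trans (le_of_eq ?_)
  rw [CompactGroup.integral_integral_swap (by fun_prop) hc fun a ha k ↦ by rw [h0 a ha, norm_zero]]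
  simp_rw [norm_mul, integral_const_mul,
    S.integral_mul_incl μ (f := fun a ↦ ‖f a‖) f.continuous.norm f.hasCompactSupport.norm,
    integral_mul_const]

lemma integral_norm_eq_left {f : G → ℂ} (hf : Continuous f) (hs : HasCompactSupport f) :
    ∫ a, ‖f a‖ ∂μ = S.const μ ν * ∫ h, ∫ y, ‖f (S.incl y * S.sec h)‖ ∂κ ∂ν := by
  have h := S.integral_eq_left κ μ ν (f := fun a ↦ (‖f a‖ : ℂ)) (by fun_prop)
    (hs.norm.comp_left (g := Complex.ofReal) rfl)
  simp only [integral_complex_ofReal] at h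
  exact_mod_cast h

lemma isBoundedCc_coeff (u : C(K, ℂ)) : IsBoundedCc μ ν (S.coeff κ u) := by
  refine ⟨‖u‖ * (S.const μ ν)⁻¹, fun f ↦ ?_⟩
  have hc := (S.isCompact_saturation f.hasCompactSupport).image S.continuous_proj
  have h0 : ∀ a ∉ S.proj '' S.saturation f, ∀ k, f (S.incl k * S.sec a) = 0 := fun a ha k ↦ by
    have : S.sec a ∉ S.saturation f := fun h' ↦ ha ⟨_, h', S.proj_sec a⟩
    simp [S.eq_zero_of_notMem_saturation_left this]
  refine (integral_norm_integral_le (by fun_prop) hc fun a ha k ↦ by rw [h0 a ha k, mul_zero]).trans ?_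
  rw [S.integral_norm_eq_left κ μ ν (f := f) (map_continuous f) f.hasCompactSupport, mul_assoc,
    inv_mul_cancel_left₀ (S.const_pos μ ν).ne', ← integral_const_mul]
  refine integral_mono (integrable_integral (by fun_prop) hc fun a ha k ↦ by simp [h0 a ha k])
    ((integrable_integral (by fun_prop) hc fun a ha k ↦ by simp [h0 a ha k]).const_mul _)
    fun a ↦ ?_
  rw [← integral_const_mul]
  refine integral_mono (integrable κ (by fun_prop)) (integrable κ (by fun_prop)) fun k ↦ ?_
  rw [norm_mul]
  gcongr
  exact u.norm_coe_le_norm k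

lemma isBoundedCc_tensor (u : C(K, ℂ)) : IsBoundedCc ν μ (S.tensor u) := by
  refine ⟨‖u‖ * S.const μ ν, fun w ↦ ?_⟩
  have h := S.integral_comp_proj μ ν (w := fun a ↦ (‖w a‖ : ℂ)) (by fun_prop)
    (w.hasCompactSupport.norm.comp_left (g := Complex.ofReal) rfl)
  simp only [integral_complex_ofReal] at h
  have h' : ∫ a, ‖w (S.proj a)‖ ∂μ = S.const μ ν * ∫ a, ‖w a‖ ∂ν := by exact_mod_cast h
  have hi : Integrable (fun a ↦ ‖w (S.proj a)‖) μ :=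
    Continuous.integrable_of_hasCompactSupport (by fun_prop)
      (S.hasCompactSupport_comp_proj w.hasCompactSupport.norm (E := ℝ) (fun _ g ↦ ‖w (S.proj g)‖)
        fun g hg ↦ by simp [hg])
  rw [mul_assoc, ← h', ← integral_const_mul]
  refine integral_mono (integrable_cc μ (S.tensor u w)).norm (hi.const_mul _) fun a ↦ ?_
  rw [tensor_apply, norm_mul]
  gcongr
  exact u.norm_coe_le_norm _

end Convolution

end SplitExtension

/-! ### The same operators on `L¹`, and symmetry of the extension -/

namespace SplitExtension

open MeasureTheory MeasureTheory.Measure CompactGroup CompactlySupported GroupL1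
open scoped NNReal ENNReal Pointwise ComplexConjugate

variable {K G H : Type*} [Group K] [TopologicalSpace K] [IsTopologicalGroup K] [CompactSpace K]
  [Group G] [TopologicalSpace G] [IsTopologicalGroup G]
  [Group H] [TopologicalSpace H] [IsTopologicalGroup H] (S : SplitExtension K G H)
  [MeasurableSpace K] [BorelSpace K] (κ : Measure K) [IsHaarMeasure κ] [Regular κ]
  [IsProbabilityMeasure κ] [LocallyCompactSpace G] [LocallyCompactSpace H]
  [MeasurableSpace G] [BorelSpace G] (μ : Measure G) [IsHaarMeasure μ] [Regular μ]
  [MeasurableSpace H] [BorelSpace H] (ν : Measure H) [IsHaarMeasure ν] [Regular ν]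

/-- Left convolution by a function on the kernel, on `L¹`. -/
noncomputable def leftL1 (u : C(K, ℂ)) : GroupL1 μ →L[ℂ] GroupL1 μ :=
  GroupL1.extend μ μ (S.leftConv κ u)

/-- Right convolution by a function on the kernel, on `L¹`. -/
noncomputable def rightL1 (u : C(K, ℂ)) : GroupL1 μ →L[ℂ] GroupL1 μ :=
  GroupL1.extend μ μ (S.rightConv κ u)

/-- The coefficient of an integrable function along the fibres of the extension. -/
noncomputable def coeffL1 (u : C(K, ℂ)) : GroupL1 μ →L[ℂ] GroupL1 ν :=
  GroupL1.extend μ ν (S.coeff κ u)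

/-- The integrable function on the extension with prescribed components. -/
noncomputable def tensorL1 (u : C(K, ℂ)) : GroupL1 ν →L[ℂ] GroupL1 μ :=
  GroupL1.extend ν μ (S.tensor u)

variable {μ ν}

@[simp] lemma leftL1_ofCc (u : C(K, ℂ)) (f : C_c(G, ℂ)) :
    S.leftL1 κ μ u (ofCc μ f) = ofCc μ (S.leftConv κ u f) :=
  extend_ofCc _ (S.isBoundedCc_leftConv κ μ u) f

@[simp] lemma rightL1_ofCc (u : C(K, ℂ)) (f : C_c(G, ℂ)) :
    S.rightL1 κ μ u (ofCc μ f) = ofCc μ (S.rightConv κ u f) :=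
  extend_ofCc _ (S.isBoundedCc_rightConv κ μ u) f

@[simp] lemma coeffL1_ofCc (u : C(K, ℂ)) (f : C_c(G, ℂ)) :
    S.coeffL1 κ μ ν u (ofCc μ f) = ofCc ν (S.coeff κ u f) :=
  extend_ofCc _ (S.isBoundedCc_coeff κ μ ν u) f

@[simp] lemma tensorL1_ofCc (u : C(K, ℂ)) (f : C_c(H, ℂ)) :
    S.tensorL1 μ ν u (ofCc ν f) = ofCc μ (S.tensor u f) :=
  extend_ofCc _ (S.isBoundedCc_tensor μ ν u) f

lemma leftL1_mul (u : C(K, ℂ)) (x y : GroupL1 μ) :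
    S.leftL1 κ μ u (x * y) = S.leftL1 κ μ u x * y := by
  refine denseRange_ofCc.induction_on₂
    (p := fun x y ↦ S.leftL1 κ μ u (x * y) = S.leftL1 κ μ u x * y)
    (isClosed_eq (by fun_prop) (by fun_prop)) (fun f g ↦ ?_) x y
  simp only [ofCc_mul, leftL1_ofCc, leftConv_convCc]

lemma rightL1_mul (u : C(K, ℂ)) (x y : GroupL1 μ) :
    S.rightL1 κ μ u (x * y) = x * S.rightL1 κ μ u y := by
  refine denseRange_ofCc.induction_on₂
    (p := fun x y ↦ S.rightL1 κ μ u (x * y) = x * S.rightL1 κ μ u y)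
    (isClosed_eq (by fun_prop) (by fun_prop)) (fun f g ↦ ?_) x y
  simp only [ofCc_mul, rightL1_ofCc, rightConv_convCc]

lemma rightL1_mul_eq_mul_leftL1 (u : C(K, ℂ)) (x y : GroupL1 μ) :
    S.rightL1 κ μ u x * y = x * S.leftL1 κ μ u y := by
  refine denseRange_ofCc.induction_on₂
    (p := fun x y ↦ S.rightL1 κ μ u x * y = x * S.leftL1 κ μ u y)
    (isClosed_eq (by fun_prop) (by fun_prop)) (fun f g ↦ ?_) x y
  simp only [ofCc_mul, rightL1_ofCc, leftL1_ofCc, convCc_rightConv]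

lemma rightL1_leftL1 (u v : C(K, ℂ)) (x : GroupL1 μ) :
    S.rightL1 κ μ v (S.leftL1 κ μ u x) = S.leftL1 κ μ u (S.rightL1 κ μ v x) := by
  refine denseRange_ofCc.induction_on
    (p := fun x ↦ S.rightL1 κ μ v (S.leftL1 κ μ u x) = S.leftL1 κ μ u (S.rightL1 κ μ v x)) x
    (isClosed_eq (by fun_prop) (by fun_prop)) fun f ↦ ?_
  simp only [rightL1_ofCc, leftL1_ofCc, rightConv_leftConv]

lemma star_leftL1_star {u : C(K, ℂ)} (hu : ∀ x, u x⁻¹ = conj (u x)) (x : GroupL1 μ) :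
    star (S.leftL1 κ μ u (star x)) = S.rightL1 κ μ u x := by
  refine denseRange_ofCc.induction_on
    (p := fun x ↦ star (S.leftL1 κ μ u (star x)) = S.rightL1 κ μ u x) x
    (isClosed_eq (by fun_prop) (by fun_prop)) fun f ↦ ?_
  simp only [star_ofCc, rightL1_ofCc, leftL1_ofCc, S.involCc_leftConv_involCc κ u hu]

lemma coeffL1_rightL1_star (u v : C(K, ℂ)) (x : GroupL1 μ) :
    S.coeffL1 κ μ ν u (S.rightL1 κ μ v (star x)) =
      star (S.coeffL1 κ μ ν (star v) (S.rightL1 κ μ (star u) x)) := by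
  refine denseRange_ofCc.induction_on
    (p := fun x ↦ S.coeffL1 κ μ ν u (S.rightL1 κ μ v (star x)) =
      star (S.coeffL1 κ μ ν (star v) (S.rightL1 κ μ (star u) x))) x
    (isClosed_eq (by fun_prop) (by fun_prop)) fun f ↦ ?_
  simp only [star_ofCc, rightL1_ofCc, coeffL1_ofCc, coeff_rightConv_involCc]

lemma coeffL1_tensorL1 (u v : C(K, ℂ)) (w : GroupL1 ν) :
    S.coeffL1 κ μ ν u (S.tensorL1 μ ν v w) = (∫ x, u x * v x ∂κ) • w := by
  refine denseRange_ofCc.induction_on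
    (p := fun w ↦ S.coeffL1 κ μ ν u (S.tensorL1 μ ν v w) = (∫ x, u x * v x ∂κ) • w) w
    (isClosed_eq (by fun_prop) (by fun_prop)) fun f ↦ ?_
  simp only [tensorL1_ofCc, coeffL1_ofCc, coeff_tensor, map_smul]

lemma coeffL1_mul_tensorL1 (u v : C(K, ℂ)) (x : GroupL1 μ) (w : GroupL1 ν) :
    S.coeffL1 κ μ ν u (x * S.tensorL1 μ ν v w) =
      (S.const μ ν : ℂ) • (S.coeffL1 κ μ ν u (S.rightL1 κ μ v x) * w) := by
  refine denseRange_ofCc.induction_on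
    (p := fun x ↦ S.coeffL1 κ μ ν u (x * S.tensorL1 μ ν v w) =
      (S.const μ ν : ℂ) • (S.coeffL1 κ μ ν u (S.rightL1 κ μ v x) * w)) x
    (isClosed_eq (by fun_prop) (by fun_prop)) fun f ↦ ?_
  refine denseRange_ofCc.induction_on
    (p := fun w ↦ S.coeffL1 κ μ ν u (ofCc μ f * S.tensorL1 μ ν v w) =
      (S.const μ ν : ℂ) • (S.coeffL1 κ μ ν u (S.rightL1 κ μ v (ofCc μ f)) * w)) w
    (isClosed_eq (by fun_prop) (by fun_prop)) fun g ↦ ?_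
  simp only [ofCc_mul, rightL1_ofCc, coeffL1_ofCc, tensorL1_ofCc, ← map_smul,
    S.coeff_convCc_tensor κ μ ν]

variable {κ}

lemma leftL1_kernel (R : ReproducingSystem κ) (x : GroupL1 μ) :
    S.leftL1 κ μ R.kernel x =
      ∑ j, S.tensorL1 μ ν (R.toFun j) (S.coeffL1 κ μ ν (star (R.toFun j)) x) := by
  refine denseRange_ofCc.induction_on
    (p := fun x ↦ S.leftL1 κ μ R.kernel x =
      ∑ j, S.tensorL1 μ ν (R.toFun j) (S.coeffL1 κ μ ν (star (R.toFun j)) x)) x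
    (isClosed_eq (by fun_prop) (by fun_prop)) fun f ↦ ?_
  simp only [leftL1_ofCc, coeffL1_ofCc, tensorL1_ofCc, leftConv_kernel, _root_.map_sum]

lemma rightL1_kernel (R : ReproducingSystem κ) (x : GroupL1 μ) :
    S.rightL1 κ μ R.kernel x = ∑ j, conj (R.toFun j 1) • S.rightL1 κ μ (R.toFun j) x := by
  refine denseRange_ofCc.induction_on
    (p := fun x ↦ S.rightL1 κ μ R.kernel x =
      ∑ j, conj (R.toFun j 1) • S.rightL1 κ μ (R.toFun j) x) x
    (isClosed_eq (by fun_prop) (by fun_prop)) fun f ↦ ?_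
  simp only [rightL1_ofCc, rightConv_kernel, _root_.map_sum, map_smul]

lemma coeffL1_leftL1_kernel (R : ReproducingSystem κ) (i : Fin R.card) (x : GroupL1 μ) :
    S.coeffL1 κ μ ν (star (R.toFun i)) (S.leftL1 κ μ R.kernel x) =
      S.coeffL1 κ μ ν (star (R.toFun i)) x := by
  rw [S.leftL1_kernel (ν := ν), _root_.map_sum]
  simp [coeffL1_tensorL1, R.orthonormal]

lemma leftL1_kernel_idem (R : ReproducingSystem κ) (x : GroupL1 μ) :
    S.leftL1 κ μ R.kernel (S.leftL1 κ μ R.kernel x) = S.leftL1 κ μ R.kernel x := by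
  borelize H
  rw [S.leftL1_kernel (ν := (haar : Measure H))]
  simp only [coeffL1_leftL1_kernel]
  rw [← S.leftL1_kernel]

lemma coeffL1_mul_leftL1_kernel (R : ReproducingSystem κ) (u : C(K, ℂ)) (x y : GroupL1 μ) :
    S.coeffL1 κ μ ν u (x * S.leftL1 κ μ R.kernel y) =
      (S.const μ ν : ℂ) • ∑ j, S.coeffL1 κ μ ν u (S.rightL1 κ μ (R.toFun j) x) *
        S.coeffL1 κ μ ν (star (R.toFun j)) y := by
  rw [S.leftL1_kernel (ν := ν), Finset.mul_sum, _root_.map_sum, Finset.smul_sum]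
  simp only [coeffL1_mul_tensorL1]

/-- Self-adjointness of the kernel identifies the adjoint multiplier with right convolution by it,
and left and right convolutions commute. -/
lemma isProjectionMultiplier_leftL1 (R : ReproducingSystem κ) :
    IsProjectionMultiplier (S.leftL1 κ μ R.kernel).toLinearMap where
  map_mul := S.leftL1_mul κ _
  adjoint_mul x y :=
    (congrArg (· * y) (S.star_leftL1_star κ R.kernel_inv x)).trans
      (S.rightL1_mul_eq_mul_leftL1 κ _ x y)
  idem := S.leftL1_kernel_idem R
  comm x := by
    change S.leftL1 κ μ R.kernel (star (S.leftL1 κ μ R.kernel (star x))) =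
      star (S.leftL1 κ μ R.kernel (star (S.leftL1 κ μ R.kernel x)))
    rw [S.star_leftL1_star κ R.kernel_inv, S.star_leftL1_star κ R.kernel_inv, rightL1_leftL1]

/-- The functions in the ranges of the projections defined by reproducing systems are dense. -/
lemma dense_leftL1_kernel :
    Dense {x | ∃ (R : ReproducingSystem κ) (y : GroupL1 μ), x = S.leftL1 κ μ R.kernel y} := by
  borelize H
  set ν : Measure H := haar
  refine dense_iff_closure_eq.2 (Set.eq_univ_of_forall fun x ↦ ?_)
  refine closure_minimal ?_ isClosed_closure (denseRange_ofCc (μ := μ) x)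
  rintro _ ⟨f, rfl⟩
  refine Metric.mem_closure_iff.2 fun ε hε ↦ ?_
  -- The restrictions of `f` to the fibres over the compact set `C` form a compact set in `C(K)`,
  -- approximated by a single system. The `+ 1` in `δ` covers the case of a null set `C`.
  let φ : C(H, C(K, ℂ)) := ContinuousMap.curry ⟨fun p ↦ f (S.incl p.2 * S.sec p.1), by fun_prop⟩
  let C := S.proj '' S.saturation f
  have hC : IsCompact C := (S.isCompact_saturation f.hasCompactSupport).image S.continuous_proj
  let δ := ε / (2 * S.const μ ν * (ν.real C + 1))
  have hδ : 0 < δ := div_pos hε (mul_pos (mul_pos two_pos (S.const_pos μ ν)) (by positivity))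
  obtain ⟨R, hR⟩ := exists_reproducingSystem_approx (κ := κ) (hC.image φ.continuous) hδ
  refine ⟨_, ⟨R, ofCc μ f, rfl⟩, ?_⟩
  rw [dist_eq_norm, leftL1_ofCc, ← map_sub, norm_ofCc,
    S.integral_norm_eq_left κ μ ν (map_continuous _)
      (CompactlySupportedContinuousMap.hasCompactSupport _)]
  have h0 : ∀ h ∉ C, ∀ k, (f - S.leftConv κ R.kernel f) (S.incl k * S.sec h) = 0 := by
    intro h hh k
    have : S.sec h ∉ S.saturation f := fun h' ↦ hh ⟨_, h', S.proj_sec h⟩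
    simp only [CompactlySupportedContinuousMap.sub_apply, leftConv_apply, ← mul_assoc, ← map_mul,
      S.eq_zero_of_notMem_saturation_left this, mul_zero, integral_zero, sub_zero]
  have h1 : ∀ h ∈ C, ‖∫ y, ‖(f - S.leftConv κ R.kernel f) (S.incl y * S.sec h)‖ ∂κ‖ ≤ δ := by
    intro h hh
    rw [Real.norm_of_nonneg (integral_nonneg fun _ ↦ norm_nonneg _)]
    refine le_of_eq_of_le ?_ (hR (φ h) ⟨h, hh, rfl⟩)
    congr with y
    rw [CompactlySupportedContinuousMap.sub_apply, leftConv_kernel]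
    simp [tensor_apply, coeff_apply, φ]
  have h2 := norm_setIntegral_le_of_norm_le_const (μ := ν) hC.measure_lt_top h1
  rw [setIntegral_eq_integral_of_forall_compl_eq_zero fun h hh ↦ by simp [h0 h hh]] at h2
  have hc := S.const_pos μ ν
  have hn : 0 ≤ ν.real C := measureReal_nonneg
  calc _ ≤ S.const μ ν * (δ * ν.real C) := by
        gcongr
        exact (le_abs_self _).trans h2
    _ ≤ S.const μ ν * (δ * (ν.real C + 1)) := by gcongr; linarith
    _ = ε / 2 := by
        simp only [δ]
        field_simp
    _ < ε := half_lt_self hε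

/-- If the quotient has a symmetric group algebra, so has the extension. -/
theorem isSymmetricStarAlgebra_of_quotient (S : SplitExtension K G H) (κ : Measure K)
    [IsHaarMeasure κ] [Regular κ] [IsProbabilityMeasure κ]
    (hH : IsSymmetricStarAlgebra (GroupL1 ν)) : IsSymmetricStarAlgebra (GroupL1 μ) := by
  let J : GroupL1 ν →L[ℂ] L1Unitization (GroupL1 ν) :=
    LinearMap.mkContinuous (L1Unitization.inr (GroupL1 ν) : GroupL1 ν →ₗ[ℂ] _) 1
      fun x ↦ by
        rw [one_mul]
        exact (L1Unitization.norm_inr x).le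
  have J_mul : ∀ x y, J (x * y) = J x * J y := map_mul (L1Unitization.inr (GroupL1 ν))
  have J_star : ∀ x, J (star x) = star (J x) := L1Unitization.inr_star
  have J_norm : ∀ x, ‖J x‖ = ‖x‖ := L1Unitization.norm_inr
  set c : ℂ := (S.const μ ν : ℂ) with hc
  have c_star : star c = c := Complex.conj_ofReal _
  have c_ne : c ≠ 0 := Complex.ofReal_ne_zero.2 (S.const_pos μ ν).ne'
  -- The scalar `c`, the constant in Weil's formula, absorbs the factor which
  -- `coeffL1_mul_leftL1_kernel` produces, so that `Φ` turns products into matrix products.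
  let Φ : C(K, ℂ) → C(K, ℂ) → GroupL1 μ →L[ℂ] GroupL1 ν := fun u v ↦
    c • (S.coeffL1 κ μ ν (star u) ∘L S.rightL1 κ μ v)
  have Φ_apply : ∀ u v x, Φ u v x = c • S.coeffL1 κ μ ν (star u) (S.rightL1 κ μ v x) :=
    fun _ _ _ ↦ rfl
  have Φ_star : ∀ u v x, Φ u v (star x) = star (Φ v u x) := by
    intro u v x
    rw [Φ_apply, Φ_apply, coeffL1_rightL1_star, star_smul, c_star, star_star]
  have Φ_mul : ∀ (R : ReproducingSystem κ) u v x y,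
      Φ u v (x * S.leftL1 κ μ R.kernel y) = ∑ k, Φ u (R.toFun k) x * Φ (R.toFun k) v y := by
    intro R u v x y
    simp only [Φ_apply]
    rw [rightL1_mul, rightL1_leftL1, coeffL1_mul_leftL1_kernel, Finset.smul_sum, Finset.smul_sum]
    simp only [smul_mul_assoc, mul_smul_comm, hc]
  refine isSymmetricStarAlgebra_of_corners (L1Unitization.isHermitianAlgebra hH)
    (I := ReproducingSystem κ) (n := fun R ↦ Fin R.card)
    (fun R ↦ (S.leftL1 κ μ R.kernel).toLinearMap) (fun R ↦ S.isProjectionMultiplier_leftL1 R)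
    (fun R p q ↦ J ∘L Φ (R.toFun p) (R.toFun q)) ?_ ?_ ?_ ?_ ?_ ?_
  · intro R p q x y
    change J (Φ _ _ (x * S.leftL1 κ μ R.kernel y)) = ∑ k, J (Φ _ _ x) * J (Φ _ _ y)
    rw [Φ_mul, _root_.map_sum]
    simp only [J_mul]
  · intro R p q x
    change J (Φ _ _ (star x)) = star (J (Φ _ _ x))
    rw [Φ_star, J_star]
  · intro R p q x
    change J (Φ _ _ (S.leftL1 κ μ R.kernel x)) = J (Φ _ _ x)
    rw [Φ_apply, Φ_apply, rightL1_leftL1, coeffL1_leftL1_kernel]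
  · intro R
    let C : ℝ := ∑ p, ∑ q, ‖conj (R.toFun q 1)‖ * ‖S.tensorL1 μ ν (R.toFun p)‖ * ‖c⁻¹‖
    refine ⟨C, fun x ↦ ?_⟩
    change ‖S.leftL1 κ μ R.kernel (star (S.leftL1 κ μ R.kernel (star x)))‖ ≤
      C * ∑ p, ∑ q, ‖J (Φ (R.toFun p) (R.toFun q) x)‖
    -- A corner element is rebuilt from its matrix entries, so the embedding of the corner is
    -- bounded below.
    have e : S.leftL1 κ μ R.kernel (star (S.leftL1 κ μ R.kernel (star x))) = ∑ p, ∑ q,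
        conj (R.toFun q 1) • S.tensorL1 μ ν (R.toFun p) (c⁻¹ • Φ (R.toFun p) (R.toFun q) x) := by
      rw [S.star_leftL1_star κ R.kernel_inv, S.leftL1_kernel (ν := ν), rightL1_kernel]
      simp only [_root_.map_sum, map_smul, Φ_apply, inv_smul_smul₀ c_ne]
    rw [e, Finset.sum_mul]
    refine (norm_sum_le _ _).trans (Finset.sum_le_sum fun p _ ↦ ?_)
    rw [Finset.sum_mul]
    refine (norm_sum_le _ _).trans (Finset.sum_le_sum fun q _ ↦ ?_)
    have h1 : ‖Φ (R.toFun p) (R.toFun q) x‖ ≤ ∑ p, ∑ q, ‖J (Φ (R.toFun p) (R.toFun q) x)‖ := by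
      rw [← J_norm]
      refine le_trans ?_ (Finset.single_le_sum (f := fun p ↦ ∑ q, ‖J (Φ (R.toFun p) (R.toFun q) x)‖)
        (fun p _ ↦ Finset.sum_nonneg fun q _ ↦ norm_nonneg _) (Finset.mem_univ p))
      exact Finset.single_le_sum (f := fun q ↦ ‖J (Φ (R.toFun p) (R.toFun q) x)‖)
        (fun q _ ↦ norm_nonneg _) (Finset.mem_univ q)
    rw [norm_smul, mul_assoc, mul_assoc]
    gcongr
    refine ((S.tensorL1 μ ν (R.toFun p)).le_opNorm _).trans ?_
    rw [norm_smul]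
    gcongr
  -- As `l'`, the multiplier of `R'`, is a self-adjoint idempotent, `(l' x)* (l' x) = x* (l' x)`,
  -- and `Φ_mul` over `R'` writes it as `Y* Y`.
  · intro R R' x
    refine ⟨fun k p ↦ J (Φ (R'.toFun k) (R.toFun p) x), fun p q ↦ ?_⟩
    change J (Φ _ _ (star (S.leftL1 κ μ R'.kernel x) * S.leftL1 κ μ R'.kernel x)) = _
    have e : star (S.leftL1 κ μ R'.kernel x) = S.rightL1 κ μ R'.kernel (star x) := by
      rw [← S.star_leftL1_star κ R'.kernel_inv, star_star]
    rw [e, rightL1_mul_eq_mul_leftL1, leftL1_kernel_idem, Φ_mul, _root_.map_sum]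
    simp only [J_mul, Φ_star, J_star]
  · exact S.dense_leftL1_kernel

end SplitExtension

namespace SplitExtension

open MeasureTheory MeasureTheory.Measure CompactGroup CompactlySupported GroupL1 Topology
open scoped NNReal ENNReal Pointwise ComplexConjugate

/-! ### Symmetry passes to the quotient -/

section Converse

variable {K G H : Type*} [Group K] [TopologicalSpace K] [IsTopologicalGroup K] [CompactSpace K]
  [Group G] [TopologicalSpace G] [IsTopologicalGroup G]
  [Group H] [TopologicalSpace H] [IsTopologicalGroup H] (S : SplitExtension K G H)
  [MeasurableSpace K] [BorelSpace K] (κ : Measure K) [IsHaarMeasure κ] [Regular κ]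
  [IsProbabilityMeasure κ] [LocallyCompactSpace G] [LocallyCompactSpace H]
  [MeasurableSpace G] [BorelSpace G] {μ : Measure G} [IsHaarMeasure μ] [Regular μ]
  [MeasurableSpace H] [BorelSpace H] {ν : Measure H} [IsHaarMeasure ν] [Regular ν]

/-- The reproducing system of the constant functions. -/
noncomputable def _root_.CompactGroup.ReproducingSystem.trivial : ReproducingSystem κ where
  card := 1
  toFun _ := 1
  orthonormal i j := by simp [Subsingleton.elim i j]
  kernel_mul_right _ _ _ := rfl

lemma _root_.CompactGroup.ReproducingSystem.sum_trivial {M : Type*} [AddCommMonoid M]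
    (F : C(K, ℂ) → M) : ∑ j, F ((ReproducingSystem.trivial κ).toFun j) = F 1 := by
  change ∑ _ : Fin 1, F 1 = F 1
  simp

lemma _root_.CompactGroup.ReproducingSystem.kernel_trivial :
    (ReproducingSystem.trivial κ).kernel = 1 :=
  (ReproducingSystem.sum_trivial κ fun u ↦ conj (u 1) • u).trans (by simp)

lemma rightL1_one_tensorL1_one (w : GroupL1 ν) :
    S.rightL1 κ μ 1 (S.tensorL1 μ ν 1 w) = S.tensorL1 μ ν 1 w := by
  refine denseRange_ofCc.induction_on
    (p := fun w ↦ S.rightL1 κ μ 1 (S.tensorL1 μ ν 1 w) = S.tensorL1 μ ν 1 w) w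
    (isClosed_eq (by fun_prop) (by fun_prop)) fun f ↦ ?_
  rw [tensorL1_ofCc, rightL1_ofCc]
  congr 1
  ext g
  simp [rightConv_apply, tensor_apply]

/-- If an extension has a symmetric group algebra, so has the quotient. -/
theorem isSymmetricStarAlgebra_of_extension (S : SplitExtension K G H) (κ : Measure K)
    [IsHaarMeasure κ] [Regular κ] [IsProbabilityMeasure κ]
    (hG : IsSymmetricStarAlgebra (GroupL1 μ)) : IsSymmetricStarAlgebra (GroupL1 ν) := by
  intro b z hz
  rcases eq_or_ne z 0 with rfl | z_ne
  · simp
  set c : ℂ := (S.const μ ν : ℂ) with hc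
  have c_star : star c = c := Complex.conj_ofReal _
  have c_ne : c ≠ 0 := Complex.ofReal_ne_zero.2 (S.const_pos μ ν).ne'
  have one_inv : ∀ x : K, (1 : C(K, ℂ)) x⁻¹ = conj ((1 : C(K, ℂ)) x) := fun x ↦ by simp
  let R := ReproducingSystem.trivial κ
  have hR : R.kernel = 1 := ReproducingSystem.kernel_trivial κ
  let Φ : GroupL1 μ →L[ℂ] GroupL1 ν := c • (S.coeffL1 κ μ ν 1 ∘L S.rightL1 κ μ 1)
  have Φ_apply : ∀ x, Φ x = c • S.coeffL1 κ μ ν 1 (S.rightL1 κ μ 1 x) := fun _ ↦ rfl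
  have Φ_star : ∀ x, Φ (star x) = star (Φ x) := by
    intro x
    rw [Φ_apply, Φ_apply, coeffL1_rightL1_star, star_smul, c_star, star_one]
  have Φ_mul : ∀ x y, Φ (x * S.leftL1 κ μ 1 y) = Φ x * Φ y := by
    intro x y
    have h := S.coeffL1_mul_leftL1_kernel (ν := ν) R 1 x (S.rightL1 κ μ 1 y)
    rw [hR] at h
    simp only [Φ_apply]
    rw [rightL1_mul, rightL1_leftL1, h]
    rw [ReproducingSystem.sum_trivial κ fun u ↦ S.coeffL1 κ μ ν 1 (S.rightL1 κ μ u x) *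
      S.coeffL1 κ μ ν (star u) (S.rightL1 κ μ 1 y), star_one, smul_mul_assoc, mul_smul_comm, hc]
  -- `a` lifts `b` to the corner of functions invariant under `K` on both sides, where `Φ` is
  -- multiplicative.
  set a : GroupL1 μ := c⁻¹ • S.tensorL1 μ ν 1 b with ha
  have Φ_a : Φ a = b := by
    rw [Φ_apply, ha, map_smul, rightL1_one_tensorL1_one, map_smul, coeffL1_tensorL1,
      smul_inv_smul₀ c_ne]
    simp
  have right_a : S.rightL1 κ μ 1 a = a := by
    rw [ha, map_smul, rightL1_one_tensorL1_one]
  have left_a : S.leftL1 κ μ 1 a = a := by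
    have h := S.leftL1_kernel (ν := ν) R (S.tensorL1 μ ν 1 b)
    rw [hR] at h
    rw [ha, map_smul, h, ReproducingSystem.sum_trivial κ fun u ↦
      S.tensorL1 μ ν u (S.coeffL1 κ μ ν (star u) (S.tensorL1 μ ν 1 b)), coeffL1_tensorL1]
    simp
  set s : GroupL1 μ := star a * a with hs
  have Φ_s : Φ s = star b * b := by
    conv_lhs => rw [hs, ← left_a, left_a]
    rw [show star a * a = star a * S.leftL1 κ μ 1 a by rw [left_a], Φ_mul, Φ_star, Φ_a]
  have right_s : S.rightL1 κ μ 1 s = s := by rw [hs, rightL1_mul, right_a]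
  have left_s : S.leftL1 κ μ 1 s = s := by
    have h := S.star_leftL1_star κ one_inv a
    rw [right_a] at h
    rw [hs, leftL1_mul, ← star_star (S.leftL1 κ μ 1 (star a)), h]
  -- A quasi-inverse `y` of `t` need not lie in the corner, but `t` does, and this already gives `Φ
  -- (t y) = Φ t Φ y` and `Φ (y t) = Φ y Φ t`. So `Φ y` is a quasi-inverse of `Φ t`.
  refine hG a z ?_
  intro hu hq
  refine hz hu ?_
  rw [isQuasiregular_iff] at hq ⊢
  obtain ⟨y, h1, h2⟩ := hq
  set t : GroupL1 μ := -(hu.unit⁻¹ • s) with ht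
  have Φ_t : Φ t = -(hu.unit⁻¹ • (star b * b)) := by
    rw [ht, _root_.map_neg, ← Φ_s]
    exact congrArg _ (map_smul Φ ((hu.unit⁻¹ : ℂˣ) : ℂ) s)
  have right_t : S.rightL1 κ μ 1 t = t := by
    rw [ht, _root_.map_neg]
    refine congrArg _ ((map_smul _ ((hu.unit⁻¹ : ℂˣ) : ℂ) s).trans ?_)
    rw [right_s]
    rfl
  have left_t : S.leftL1 κ μ 1 t = t := by
    rw [ht, _root_.map_neg]
    refine congrArg _ ((map_smul _ ((hu.unit⁻¹ : ℂˣ) : ℂ) s).trans ?_)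
    rw [left_s]
    rfl
  have h3 : Φ (t * y) = Φ t * Φ y := by
    rw [← Φ_mul, ← rightL1_mul_eq_mul_leftL1, right_t]
  have h4 : Φ (y * t) = Φ y * Φ t := by
    rw [← Φ_mul, left_t]
  refine ⟨Φ y, ?_, ?_⟩
  · rw [← Φ_t, ← h3, ← _root_.map_add, ← _root_.map_add, h1, _root_.map_zero]
  · rw [← Φ_t, ← h4, ← _root_.map_add, ← _root_.map_add, h2, _root_.map_zero]

end Converse

/-! ### Continuity of Borel sections over a compact kernel -/

section Quotient

variable {G : Type*} [Group G] [TopologicalSpace G] [IsTopologicalGroup G]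
  {K : Subgroup G} [K.Normal]

/-- The preimage of a compact set under a quotient map with compact kernel is compact. -/
lemma _root_.Subgroup.isCompact_preimage_mk [LocallyCompactSpace G] (hK : IsCompact (K : Set G))
    {C : Set (G ⧸ K)} (hC : IsCompact C) :
    ∃ D : Set G, IsCompact D ∧ (QuotientGroup.mk : G → G ⧸ K) ⁻¹' C ⊆ D := by
  have h : ∀ x ∈ C, ∃ U : Set (G ⧸ K), U ∈ 𝓝[C] x ∧
      ∃ D : Set G, IsCompact D ∧ (QuotientGroup.mk : G → G ⧸ K) ⁻¹' U ⊆ D := by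
    intro x _
    obtain ⟨g, rfl⟩ := QuotientGroup.mk_surjective x
    obtain ⟨D, hD, hg⟩ := exists_compact_mem_nhds g
    refine ⟨QuotientGroup.mk '' D,
      mem_nhdsWithin_of_mem_nhds (QuotientGroup.isOpenMap_coe.image_mem_nhds hg),
      D * K, hD.mul hK, ?_⟩
    rw [QuotientGroup.preimage_image_mk_eq_mul]
  refine hC.induction_on (p := fun U ↦ ∃ D : Set G, IsCompact D ∧
    (QuotientGroup.mk : G → G ⧸ K) ⁻¹' U ⊆ D) ⟨∅, isCompact_empty, by simp⟩ ?_ ?_ h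
  · rintro s t hst ⟨D, hD, h⟩
    exact ⟨D, hD, (Set.preimage_mono hst).trans h⟩
  · rintro s t ⟨D, hD, h⟩ ⟨D', hD', h'⟩
    exact ⟨D ∪ D', hD.union hD', Set.union_subset_union h h'⟩

/-- A Borel section of a quotient map with compact kernel is continuous. -/
lemma _root_.Subgroup.continuous_section [LocallyCompactSpace G] (hK : IsCompact (K : Set G))
    {η : G ⧸ K →* G} (hη : @Measurable (G ⧸ K) G (borel (G ⧸ K)) (borel G) η)
    (hsec : ∀ x : G ⧸ K, (QuotientGroup.mk (η x) : G ⧸ K) = x) : Continuous η := by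
  refine continuous_of_continuousAt_one η ?_
  rw [ContinuousAt, map_one]
  intro V hV
  obtain ⟨W, hW, hWV⟩ : ∃ W ∈ 𝓝 (1 : G), ∀ x ∈ W, ∀ y ∈ W, x / y ∈ V := exists_nhds_split_inv hV
  obtain ⟨U, hUW, hU, h1U⟩ := mem_nhds_iff.1 hW
  obtain ⟨N, hN, h1N⟩ := exists_compact_mem_nhds (1 : G ⧸ K)
  obtain ⟨D, hD, hND⟩ := Subgroup.isCompact_preimage_mk hK hN
  -- A Steinhaus argument. The preimage of `N` lies in a compact set, so finitely many translates of
  -- `U` suffice, and no countability of `G` is needed. Some `E g` then has positive finite measure,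
  -- `E g / E g` is a neighbourhood of `1`, and `η` maps it into `U U⁻¹ ⊆ V`.
  obtain ⟨t, ht⟩ := hD.elim_finite_subcover (fun g : G ↦ (fun x ↦ x * g⁻¹) ⁻¹' U)
    (fun g ↦ hU.preimage (continuous_mul_const _))
    fun g _ ↦ Set.mem_iUnion.2 ⟨g, by simpa using h1U⟩
  borelize G
  borelize (G ⧸ K)
  let ν : Measure (G ⧸ K) := haar
  let E : G → Set (G ⧸ K) := fun g ↦ η ⁻¹' ((fun x ↦ x * g⁻¹) ⁻¹' U) ∩ interior N
  have hcover : interior N ⊆ ⋃ g ∈ t, E g := by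
    intro x hx
    have : η x ∈ D := hND (by simpa [hsec x] using interior_subset hx)
    obtain ⟨g, hg, h⟩ := Set.mem_iUnion₂.1 (ht this)
    exact Set.mem_iUnion₂.2 ⟨g, hg, h, hx⟩
  have hpos : 0 < ν (interior N) :=
    isOpen_interior.measure_pos ν ⟨1, mem_interior_iff_mem_nhds.2 h1N⟩
  obtain ⟨g, -, hg⟩ : ∃ g ∈ t, ν (E g) ≠ 0 := by
    by_contra! h
    exact hpos.ne' (le_antisymm ((measure_mono hcover).trans
      ((measure_biUnion_null_iff t.countable_toSet).2 h).le) bot_le)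
  have hE : MeasurableSet (E g) :=
    (hη (hU.preimage (continuous_mul_const _)).measurableSet).inter isOpen_interior.measurableSet
  have hfin : ν (E g) ≠ ∞ := ((measure_mono (Set.inter_subset_right.trans
    interior_subset)).trans_lt hN.measure_lt_top).ne
  refine Filter.mem_map.2 ?_
  filter_upwards [div_mem_nhds_one_of_haar_pos_ne_top ν (E g) hE (pos_iff_ne_zero.2 hg) hfin]
  rintro _ ⟨x, hx, y, hy, rfl⟩
  have := hWV _ (hUW hx.1) _ (hUW hy.1)
  rw [mul_div_mul_right_eq_div] at this
  simpa using this

lemma _root_.Subgroup.mul_inv_section_mem {η : G ⧸ K →* G}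
    (hsec : ∀ x : G ⧸ K, (QuotientGroup.mk (η x) : G ⧸ K) = x) (g : G) :
    g * (η (QuotientGroup.mk g))⁻¹ ∈ K := by
  rw [← QuotientGroup.eq_one_iff, QuotientGroup.mk_mul, QuotientGroup.mk_inv, hsec,
    mul_inv_cancel]

/-- The split extension defined by a continuous section of a quotient map. -/
noncomputable def ofSection {η : G ⧸ K →* G} (hη : Continuous η)
    (hsec : ∀ x : G ⧸ K, (QuotientGroup.mk (η x) : G ⧸ K) = x) : SplitExtension K G (G ⧸ K) where
  incl := K.subtype
  proj := QuotientGroup.mk' K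
  sec := η
  fiber g := ⟨g * (η (QuotientGroup.mk g))⁻¹, Subgroup.mul_inv_section_mem hsec g⟩
  continuous_incl := continuous_subtype_val
  continuous_proj := QuotientGroup.continuous_mk
  continuous_sec := hη
  continuous_fiber := Continuous.subtype_mk
    (continuous_id.mul (hη.comp QuotientGroup.continuous_mk).inv) _
  proj_incl k := (QuotientGroup.eq_one_iff _).2 k.2
  proj_sec := hsec
  incl_mul_sec g := by simp
  fiber_mul_sec k h := by
    have : ((k : G) : G ⧸ K) = 1 := (QuotientGroup.eq_one_iff _).2 k.2
    ext
    simp [this, hsec]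

end Quotient

end SplitExtension
theorem theorem4p1 {G : Type*} [Group G] [TopologicalSpace G] [IsTopologicalGroup G]
    [LocallyCompactSpace G] [T2Space G] (K : Subgroup G) [K.Normal] (hK : IsCompact (K : Set G))
    (η : G ⧸ K →* G) (hη : @Measurable (G ⧸ K) G (borel (G ⧸ K)) (borel G) η)
    (hsec : ∀ x : G ⧸ K, (QuotientGroup.mk (η x) : G ⧸ K) = x) :
    (IsSymmetricGroup (G ⧸ K) → IsSymmetricGroup G) ∧
      (IsSymmetricGroup G ↔ IsSymmetricGroup (G ⧸ K)) := by
  have : CompactSpace K := isCompact_iff_compactSpace.1 hK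
  let S := SplitExtension.ofSection (Subgroup.continuous_section hK hη hsec) hsec
  let : MeasurableSpace K := borel K
  have : BorelSpace K := ⟨rfl⟩
  -- Haar measure normalized to give the whole compact group mass one.
  let κ : MeasureTheory.Measure K := MeasureTheory.Measure.haarMeasure ⊤
  have : MeasureTheory.IsProbabilityMeasure κ :=
    ⟨MeasureTheory.Measure.haarMeasure_self (K₀ := (⊤ : TopologicalSpace.PositiveCompacts K))⟩
  have h1 : IsSymmetricGroup (G ⧸ K) → IsSymmetricGroup G := by
    let : MeasurableSpace G := borel G
    have : BorelSpace G := ⟨rfl⟩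
    let : MeasurableSpace (G ⧸ K) := borel (G ⧸ K)
    have : BorelSpace (G ⧸ K) := ⟨rfl⟩
    exact fun h ↦ S.isSymmetricStarAlgebra_of_quotient κ h
  have h2 : IsSymmetricGroup G → IsSymmetricGroup (G ⧸ K) := by
    let : MeasurableSpace G := borel G
    have : BorelSpace G := ⟨rfl⟩
    let : MeasurableSpace (G ⧸ K) := borel (G ⧸ K)
    have : BorelSpace (G ⧸ K) := ⟨rfl⟩
    exact fun h ↦ S.isSymmetricStarAlgebra_of_extension κ h
  exact ⟨h1, h2, h1⟩
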